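/- Notation. Let $\mathbb T=\mathbb R/\mathbb Z$, $M_1=M_2=\mathbb T\times\mathbb R$, and let $M_1\times M_2$ have coordinates $(\theta_1,r_1,\theta_2,r_2)$, the flat (Euclidean) product metric $d$ and the symplectic form $d\theta_1\wedge dr_1+d\theta_2\wedge dr_2$. For $\omega=(\omega_1,\omega_2)\in\mathbb R^2$ let $T_0(\theta_1,r_1,\theta_2,r_2)=(\theta_1+\omega_1+r_1,\,r_1,\,\theta_2+\omega_2+r_2,\,r_2)$, and let $\mathcal T_{(r_1,r_2)}=\mathbb T^2\times\{(r_1,r_2)\}$. For $\alpha>1$ and $L>0$, $G^{\alpha,L}(M)$, with $M=M_1$ ($N=2$) or $M=M_1\times M_2$ ($N=4$), is the space of the $C^\infty$ functions $f$ on $M$ with $$\|f\|_{\alpha,L}=\sum_{\ell\in\mathbb N^N}\frac{L^{|\ell|\alpha}}{\ell!^{\alpha}}\ \sup_M|\partial^\ell f|<\infty .$$ A function is flat on a set if it vanishes there together with all its partial derivatives. When a function $H$ on $M_1\times M_2$ generates a complete Hamiltonian vector field, $\Phi^H$ denotes the time-$1$ map of its flow; a function on $M_1$ is also viewed as a function on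 $M_1\times M_2$ that does not depend on $(\theta_2,r_2)$. For $C,\gamma>0$ put $E_{C,\gamma}(\nu)=\exp(\exp(C\nu^{-\gamma}))$ for $\nu>0$ and $E^*_{C,\gamma}(\nu)=E_{C,\gamma}(\nu/|\ln\nu|)$ for $0<\nu<1$. A set $Z\subset M_1\times M_2$ is diffusive-$*$ for a map $T$ of $M_1\times M_2$ to itself, with constant $C$ and exponent $\gamma$, if there is a sequence $\nu_n\in(0,\tfrac12)$ with $\nu_n\to0$ such that for every $n$ and every $z\in Z$ there are a point $\hat z\in M_1\times M_2$ and an integer $t\ge1$ with $$d(\hat z,z)\le\nu_n,\qquad t\le E^*_{C,\gamma}(\nu_n),\qquad d(T^t\hat z,z)\ge E^*_{C,\gamma}(2\nu_n).$$ Theorem. Let $\alpha>1$ and $L>0$ be real and let $\gamma=\frac1{\alpha-1}$. There is a constant $C>0$, depending only on $\alpha$ and $L$, such that for every $\omega\in\mathbb R^2$ and every $\varepsilon>0$ there exist $u\in G^{\alpha,L}(M_1)$ and $v\in G^{\alpha,L}(M_1\times M_2)$, both $1$-periodic in $r_1$, and a closed set $X_\varepsilon\subset[0,1]$ with $\operatorname{Leb}(X_\varepsilon)\ge1-\varepsilon$,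 such that: (1) $u$ and $v$ are flat for $r_1\in X_\varepsilon+\mathbb Z$; (2) $\|u\|_{\alpha,L}+\|v\|_{\alpha,L}<\varepsilon$; (3) $u$ and $v$ generate complete Hamiltonian vector fields on $M_1\times M_2$ and, for each $(r_1,r_2)\in(X_\varepsilon+\mathbb Z)\times\mathbb R$, the torus $\mathcal T_{(r_1,r_2)}$ is invariant and diffusive-$*$ for $T=\Phi^v\circ\Phi^u\circ T_0$, with constant $C$ and exponent $\gamma$; moreover the union $\mathbb T\times(X_\varepsilon+\mathbb Z)\times M_2$ of all these tori is itself diffusive-$*$ for $T$, with constant $C$ and exponent $\gamma$. -/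

import Mathlib

open scoped ENNReal Topology Nat

noncomputable section

namespace ManyTori

/-! ### Multi-index derivatives and the uniform Gevrey norm on `ℝ^N` -/

/-- The partial derivative with respect to the `i`-th coordinate. -/
def pderiv {N : ℕ} (i : Fin N) (f : (Fin N → ℝ) → ℝ) : (Fin N → ℝ) → ℝ :=
  fun x => fderiv ℝ f x (Pi.single i 1)

/-- `∂^ℓ f = ∂_0^{ℓ 0} ∂_1^{ℓ 1} ⋯ ∂_{N-1}^{ℓ (N-1)} f`. -/
def multiDeriv {N : ℕ} (ℓ : Fin N → ℕ) (f : (Fin N → ℝ) → ℝ) : (Fin N → ℝ) → ℝ :=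
  (List.finRange N).foldr (fun i g => (pderiv i)^[ℓ i] g) f

/-- `‖f‖_{α,L} = ∑_ℓ L^{|ℓ| α} / (ℓ!)^α * sup |∂^ℓ f|`, with value in `[0, ∞]`. -/
def gevreyNorm {N : ℕ} (α L : ℝ) (f : (Fin N → ℝ) → ℝ) : ℝ≥0∞ :=
  ∑' ℓ : Fin N → ℕ,
    ENNReal.ofReal (L ^ (((∑ i, ℓ i : ℕ) : ℝ) * α) / ((∏ i, (ℓ i)! : ℕ) : ℝ) ^ α) *
      ⨆ x : Fin N → ℝ, ‖multiDeriv ℓ f x‖ₑ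

/-- `f` is a uniformly Gevrey-`(α, L)` function on `ℝ^N`. -/
def IsGevrey {N : ℕ} (α L : ℝ) (f : (Fin N → ℝ) → ℝ) : Prop :=
  ContDiff ℝ ((⊤ : ℕ∞) : WithTop ℕ∞) f ∧ gevreyNorm α L f < ⊤

/-- `f` vanishes on `S` together with all its partial derivatives. -/
def IsFlatOn {N : ℕ} (f : (Fin N → ℝ) → ℝ) (S : Set (Fin N → ℝ)) : Prop :=
  ∀ x ∈ S, ∀ ℓ : Fin N → ℕ, multiDeriv ℓ f x = 0

/-! ### The phase space `M₁ × M₂`, with `M₁ = M₂ = 𝕋 × ℝ`, and its flat (Euclidean) metric -/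

/-- The annulus `𝕋 × ℝ`, `𝕋 = ℝ / ℤ`. -/
abbrev Annulus : Type := WithLp 2 (UnitAddCircle × ℝ)

/-- The space `M₁ × M₂`. -/
abbrev Phase : Type := WithLp 2 (Annulus × Annulus)

/-- The point `(θ, r)` of the annulus. -/
def annulusPt (θ : UnitAddCircle) (r : ℝ) : Annulus := WithLp.toLp 2 (θ, r)

/-- The point `(z₁, z₂)` of `M₁ × M₂`. -/
def phasePt (z₁ z₂ : Annulus) : Phase := WithLp.toLp 2 (z₁, z₂)

/-- The universal covering `ℝ² → M₁`, in the coordinates `(θ₁, r₁)`. -/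
def annulusCover (x : Fin 2 → ℝ) : Annulus := annulusPt (x 0 : UnitAddCircle) (x 1)

/-- The universal covering `ℝ⁴ → M₁ × M₂`, in the coordinates `(θ₁, r₁, θ₂, r₂)`. -/
def phaseCover (x : Fin 4 → ℝ) : Phase :=
  phasePt (annulusPt (x 0 : UnitAddCircle) (x 1)) (annulusPt (x 2 : UnitAddCircle) (x 3))

/-- A function on `M₁`, viewed as a function on `M₁ × M₂`. -/
def extend (u : Annulus → ℝ) : Phase → ℝ := fun z => u z.fst

/-! ### Hamiltonian flows for `dθ₁ ∧ dr₁ + dθ₂ ∧ dr₂` -/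

/-- The vector field `θ_j' = ∂H/∂r_j`, `r_j' = -∂H/∂θ_j`, in the coordinates `(θ₁, r₁, θ₂, r₂)`. -/
def hamVectorField (H : (Fin 4 → ℝ) → ℝ) (x : Fin 4 → ℝ) : Fin 4 → ℝ :=
  ![pderiv 1 H x, -pderiv 0 H x, pderiv 3 H x, -pderiv 2 H x]

/-- `c : ℝ → ℝ⁴` is (the lift of) an integral curve, defined for all times, of the Hamiltonian
vector field generated by `H`. -/
def IsHamCurve (H : Phase → ℝ) (c : ℝ → Fin 4 → ℝ) : Prop :=
  ∀ t : ℝ, HasDerivAt c (hamVectorField (H ∘ phaseCover) (c t)) t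

/-- `H` generates a complete Hamiltonian vector field, and `Φ` is the time-`1` map of its flow. -/
def IsTimeOneMap (H : Phase → ℝ) (Φ : Phase → Phase) : Prop :=
  (∀ x : Fin 4 → ℝ, ∃ c : ℝ → Fin 4 → ℝ, IsHamCurve H c ∧ c 0 = x) ∧
  ∀ c : ℝ → Fin 4 → ℝ, IsHamCurve H c → Φ (phaseCover (c 0)) = phaseCover (c 1)

/-- The integrable twist map `F₀` (and `G₀`): `(θ, r) ↦ (θ + ω + r, r)`. -/
def twist (ω : ℝ) (z : Annulus) : Annulus :=
  annulusPt (z.fst + ((ω + z.snd : ℝ) : UnitAddCircle)) z.snd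

/-- `T₀ = F₀ × G₀`. -/
def T₀ (ω₁ ω₂ : ℝ) (z : Phase) : Phase := phasePt (twist ω₁ z.fst) (twist ω₂ z.snd)

/-- The torus `𝕋² × {(r₁, r₂)}`. -/
def torus (r₁ r₂ : ℝ) : Set Phase := {z | z.fst.snd = r₁ ∧ z.snd.snd = r₂}

/-- `X + ℤ`. -/
def addInt (X : Set ℝ) : Set ℝ := {r | ∃ x ∈ X, ∃ k : ℤ, r = x + k}

/-! ### Diffusive dynamics -/

/-- `E_{C,γ}(ν) = exp (exp (C ν^{-γ}))`. -/
def E (C γ ν : ℝ) : ℝ := Real.exp (Real.exp (C * ν ^ (-γ)))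

/-- `E*_{C,γ}(ν) = E_{C,γ}(ν / |ln ν|)`, for `0 < ν < 1`. -/
def Estar (C γ ν : ℝ) : ℝ := E C γ (ν / |Real.log ν|)

/-- The point `z` is `ν`-diffusive-`*` for `T` (with constant `C` and exponent `γ`). -/
def IsNuDiffusiveStarAt {M : Type*} [MetricSpace M] (C γ : ℝ) (T : M → M) (ν : ℝ) (z : M) :
    Prop :=
  ∃ (z' : M) (t : ℕ), 0 < t ∧ dist z' z ≤ ν ∧ (t : ℝ) ≤ Estar C γ ν ∧
    Estar C γ (2 * ν) ≤ dist (T^[t] z') z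

/-- The set `X` is diffusive-`*` for `T` (with constant `C` and exponent `γ`): for some sequence
`ν_n → 0` of positive numbers, all points of `X` are `ν_n`-diffusive-`*` for every `n`.
The bound `ν_n < 1/2` keeps `ν_n` and `2 ν_n` in the domain `(0, 1)` of `E*`. -/
def IsDiffusiveStar {M : Type*} [MetricSpace M] (C γ : ℝ) (T : M → M) (X : Set M) : Prop :=
  ∃ ν : ℕ → ℝ, (∀ n, 0 < ν n ∧ ν n < 1 / 2) ∧ Filter.Tendsto ν Filter.atTop (𝓝 0) ∧
    ∀ n, ∀ z ∈ X, IsNuDiffusiveStarAt C γ T (ν n) z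

end ManyTori

end

/-! Near a resonance r₁ + ω₁ = p/Q put y = Qθ₁ and V = Q(r₁ + ω₁) - p. The potential κ/(2πQ²)
cos(2πQθ₁), localized in r₁ by a bump, turns Φ^u ∘ T₀ into the standard map y' = y + V, V' = V + κ
sin(2πy'), up to the integer shift p in y. Its orbits can pass the hyperbolic point y ∈ ℤ as slowly
as desired: for every m ≥ 1 one of them goes from 1/2 to 3/2 in exactly 2m steps, recovers its
velocity, and meanwhile keeps a distance √κ/4 from both ends (`exists_standard_orbit`).

The function v multiplies a bump in θ₁ around y = 1/2 mod 1, so narrow that the rest of the orbit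
does not see it, by - sin(2πQθ₂)/(4πQm). Once per turn it adds 1/(2m) to r₂, provided that
cos(2πQθ₂) = 1. If r₂ + ω₂ = l/(2m), the angle θ₂ advances by the integer l during a turn, so every
kick finds it at the same place and r₂ drifts linearly (`exists_drift`).

The sizes come from the Gevrey cost exp(O(w^(-γ))) of a bump of width w (`exists_gevreyBound_bump`).
Put W = (Q log Q)^γ. The bump in r₁ has width 1/(Q log Q) and costs exp(O(W)), which forces κ to be
exponentially small in W. The bump in θ₁ has width √κ/(8Q), so it costs exp(exp(O(W))), which forces
m to be doubly exponential in W (`exists_resonanceData`). Drifting by E*(2ν) takes about 4m² E*(2ν)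
steps. For ν = 4/Q this is less than E*(ν), since doubling ν multiplies the inner exponent by at
most 2^(-γ) < 1 (`estar_time`).

In [0,1] the zones of order Q have measure O(1/log Q), although the resonances p/Q are 1/Q-dense.
Along a fast growing sequence Q_n the zones, even doubled, have total measure at most ε; the set X
is what they leave in [0,1]. For r₁ in X + ℤ the resonance p/Q_n nearest to r₁ + ω₁ has a zone
disjoint from those of smaller order (`adm_round`), so a drifting orbit starts within 4/Q_n of every
point of every torus. The scale 4/Q_n is the same for all tori, whence the statement on their union.
-/

noncomputable section

namespace ManyTori

/-! ### One-dimensional Gevrey estimates -/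

/-- `f` is smooth and `|f^{(k)}| ≤ A R^k (k!)^α` for all `k`. -/
def GevreyBound (α R A : ℝ) (f : ℝ → ℝ) : Prop :=
  ContDiff ℝ ((⊤ : ℕ∞) : WithTop ℕ∞) f ∧
    ∀ k x, |iteratedDeriv k f x| ≤ A * R ^ k * (k ! : ℝ) ^ α

theorem factorial_rpow_pos (α : ℝ) (k : ℕ) : 0 < (k ! : ℝ) ^ α :=
  Real.rpow_pos_of_pos (by exact_mod_cast k.factorial_pos) _

namespace GevreyBound

variable {α R A A' : ℝ} {f g : ℝ → ℝ}

theorem nonneg (hf : GevreyBound α R A f) : 0 ≤ A := by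
  have := (abs_nonneg _).trans (hf.2 0 0)
  simpa using this

theorem mono_const (hf : GevreyBound α R A f) (hR : 0 ≤ R) (h : A ≤ A') :
    GevreyBound α R A' f :=
  ⟨hf.1, fun k x => (hf.2 k x).trans (by
    have := (factorial_rpow_pos α k).le
    gcongr)⟩

theorem const (hR : 0 ≤ R) (c : ℝ) : GevreyBound α R |c| (fun _ => c) := by
  refine ⟨contDiff_const, fun k x => ?_⟩
  rcases k with _ | k
  · simp
  · rw [iteratedDeriv_const]
    have := (factorial_rpow_pos α (k + 1)).le
    simp only [Nat.add_eq_zero_iff, one_ne_zero, and_false, if_false, abs_zero]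
    positivity

theorem const_mul (hf : GevreyBound α R A f) (c : ℝ) :
    GevreyBound α R (|c| * A) (fun x => c * f x) := by
  refine ⟨contDiff_const.mul hf.1, fun k x => ?_⟩
  rw [iteratedDeriv_const_mul_field, abs_mul, mul_assoc |c|, mul_assoc |c|]
  exact mul_le_mul_of_nonneg_left (hf.2 k x) (abs_nonneg c)

theorem comp_add_const (hf : GevreyBound α R A f) (c : ℝ) :
    GevreyBound α R A (fun x => f (x + c)) := by
  refine ⟨hf.1.comp (contDiff_id.add contDiff_const), fun k x => ?_⟩
  rw [iteratedDeriv_comp_add_const]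
  exact hf.2 k _

theorem comp_const_sub (hf : GevreyBound α R A f) (c : ℝ) :
    GevreyBound α R A (fun x => f (c - x)) := by
  refine ⟨hf.1.comp (contDiff_const.sub contDiff_id), fun k x => ?_⟩
  rw [iteratedDeriv_comp_const_sub]
  simpa [abs_mul] using hf.2 k _

/-- In Leibniz' formula i! (k-i)! ≤ k!, and the binomial coefficients add up to 2^k: this is what
doubles the rate. -/
theorem mul (hα : 1 ≤ α) (hR : 0 ≤ R) (hf : GevreyBound α R A f) (hg : GevreyBound α R A' g) :
    GevreyBound α (2 * R) (A * A') (fun x => f x * g x) := by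
  refine ⟨hf.1.mul hg.1, fun k x => ?_⟩
  have hA := hf.nonneg
  have hA' := hg.nonneg
  have key : iteratedDeriv k (fun x => f x * g x) x = ∑ i ∈ Finset.range (k + 1),
      (k.choose i : ℝ) * iteratedDeriv i f x * iteratedDeriv (k - i) g x :=
    iteratedDeriv_mul (hf.1.contDiffAt.of_le (by exact_mod_cast le_top))
      (hg.1.contDiffAt.of_le (by exact_mod_cast le_top))
  have hfac := factorial_rpow_pos α k
  rw [key]
  refine (Finset.abs_sum_le_sum_abs _ _).trans ?_
  have hterm : ∀ i ∈ Finset.range (k + 1),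
      |(k.choose i : ℝ) * iteratedDeriv i f x * iteratedDeriv (k - i) g x| ≤
        (k.choose i : ℝ) * (A * A' * R ^ k * (k ! : ℝ) ^ α) := by
    intro i hi
    have hik : i ≤ k := Nat.lt_succ_iff.1 (Finset.mem_range.1 hi)
    have h1 := hf.2 i x
    have h2 := hg.2 (k - i) x
    have h3 : (i ! : ℝ) ^ α * ((k - i)! : ℝ) ^ α ≤ (k ! : ℝ) ^ α := by
      rw [← Real.mul_rpow (by positivity) (by positivity)]
      refine Real.rpow_le_rpow (by positivity) ?_ (by linarith)
      exact_mod_cast Nat.le_of_dvd k.factorial_pos (Nat.factorial_mul_factorial_dvd_factorial hik)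
    have p1 := (factorial_rpow_pos α i).le
    have p2 := (factorial_rpow_pos α (k - i)).le
    rw [abs_mul, abs_mul, Nat.abs_cast, mul_assoc]
    refine mul_le_mul_of_nonneg_left ?_ (by positivity)
    calc |iteratedDeriv i f x| * |iteratedDeriv (k - i) g x|
        ≤ (A * R ^ i * (i ! : ℝ) ^ α) * (A' * R ^ (k - i) * ((k - i)! : ℝ) ^ α) := by gcongr
      _ = A * A' * (R ^ i * R ^ (k - i)) * ((i ! : ℝ) ^ α * ((k - i)! : ℝ) ^ α) := by ring
      _ = A * A' * R ^ k * ((i ! : ℝ) ^ α * ((k - i)! : ℝ) ^ α) := by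
          rw [← pow_add, Nat.add_sub_cancel' hik]
      _ ≤ _ := by gcongr
  refine (Finset.sum_le_sum hterm).trans (le_of_eq ?_)
  rw [← Finset.sum_mul]
  have : (∑ i ∈ Finset.range (k + 1), (k.choose i : ℝ)) = 2 ^ k := by
    exact_mod_cast Nat.sum_range_choose k
  rw [this, mul_pow]
  ring

/-- A function that agrees, near every point, with a translate of `f` or with `0`. -/
theorem of_locally (hf : GevreyBound α R A f) (hR : 0 ≤ R)
    (hg : ∀ x, g =ᶠ[𝓝 x] (fun _ => 0) ∨ ∃ c, g =ᶠ[𝓝 x] (fun y => f (y - c))) :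
    GevreyBound α R A g := by
  have hA := hf.nonneg
  refine ⟨contDiff_iff_contDiffAt.2 fun x => ?_, fun k x => ?_⟩
  · rcases hg x with h | ⟨c, h⟩
    · exact contDiffAt_const.congr_of_eventuallyEq h
    · exact (hf.1.comp (contDiff_id.sub contDiff_const)).contDiffAt.congr_of_eventuallyEq h
  · rcases hg x with h | ⟨c, h⟩
    · rw [h.iteratedDeriv_eq k]
      have := (factorial_rpow_pos α k).le
      have h0 : iteratedDeriv k (fun _ : ℝ => (0 : ℝ)) x = 0 := by
        rw [iteratedDeriv_const]; simp
      rw [h0, abs_zero]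
      positivity
    · rw [h.iteratedDeriv_eq k, iteratedDeriv_comp_sub_const]
      exact hf.2 k _

end GevreyBound

theorem iteratedDeriv_sin_mul_add (a : ℝ) (k : ℕ) : ∀ b : ℝ,
    iteratedDeriv k (fun x => Real.sin (a * x + b)) =
      fun x => a ^ k * Real.sin (a * x + (b + k * (Real.pi / 2))) := by
  induction k with
  | zero => intro b; simp
  | succ k ih =>
    intro b
    have hd : deriv (fun x => Real.sin (a * x + b)) =
        fun x => a * Real.sin (a * x + (b + Real.pi / 2)) := by
      funext x
      have : HasDerivAt (fun x => Real.sin (a * x + b)) (Real.cos (a * x + b) * (a * 1)) x :=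
        (((hasDerivAt_id x).const_mul a).add_const b).sin
      rw [this.deriv, ← add_assoc, Real.sin_add_pi_div_two]
      ring
    rw [iteratedDeriv_succ', hd]
    funext x
    rw [iteratedDeriv_const_mul_field, ih]
    push_cast
    ring_nf

/-- This is t^k / k! ≤ exp t at t = y^(1/α), raised to the power α. -/
theorem pow_le_exp_mul_factorial_rpow {α y : ℝ} (hα : 0 < α) (hy : 0 ≤ y) (k : ℕ) :
    y ^ k ≤ Real.exp (α * y ^ (1 / α)) * (k ! : ℝ) ^ α := by
  have h1 : (y ^ (1 / α)) ^ k ≤ Real.exp (y ^ (1 / α)) * (k ! : ℝ) := by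
    have := Real.pow_div_factorial_le_exp (x := y ^ (1 / α)) (by positivity) k
    rwa [div_le_iff₀ (by exact_mod_cast k.factorial_pos)] at this
  have h2 := Real.rpow_le_rpow (by positivity) h1 hα.le
  rw [Real.mul_rpow (by positivity) (by positivity), ← Real.exp_mul] at h2
  have h3 : ((y ^ (1 / α)) ^ k) ^ α = y ^ k := by
    rw [← Real.rpow_natCast, ← Real.rpow_mul hy, ← Real.rpow_mul hy, ← Real.rpow_natCast]
    congr 1
    field_simp
  rw [h3] at h2
  rwa [mul_comm α]

theorem GevreyBound.sin_mul_add {α R a : ℝ} (hα : 0 < α) (hR : 0 < R) (ha : 0 ≤ a) (b : ℝ) :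
    GevreyBound α R (Real.exp (α * (a / R) ^ (1 / α))) (fun x => Real.sin (a * x + b)) := by
  refine ⟨by fun_prop, fun k x => ?_⟩
  rw [iteratedDeriv_sin_mul_add, abs_mul, abs_of_nonneg (by positivity)]
  calc a ^ k * |Real.sin (a * x + (b + k * (Real.pi / 2)))| ≤ a ^ k * 1 := by
        gcongr; exact Real.abs_sin_le_one _
    _ = (a / R) ^ k * R ^ k := by
        rw [mul_one, ← mul_pow, div_mul_cancel₀ _ hR.ne']
    _ ≤ (Real.exp (α * (a / R) ^ (1 / α)) * (k ! : ℝ) ^ α) * R ^ k := by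
        gcongr
        exact pow_le_exp_mul_factorial_rpow hα (by positivity) k
    _ = _ := by ring

/-! ### The flat function `exp (-λ x^{-γ})` -/

/-- Continuity of ζ^(-γ) at 1. By homogeneity it controls z^(-γ) on the disc of centre x and radius
κx for every x > 0, where Cauchy's estimate is applied. -/
theorem exists_half_le_re_cpow (γ : ℝ) :
    ∃ κ : ℝ, 0 < κ ∧ κ < 1 ∧ ∀ ζ : ℂ, ‖ζ - 1‖ ≤ κ → 1 / 2 ≤ (ζ ^ (-(γ : ℂ))).re := by
  have hc : ContinuousAt (fun ζ : ℂ => (ζ ^ (-(γ : ℂ))).re) 1 :=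
    Complex.continuous_re.continuousAt.comp
      (continuousAt_cpow_const (b := -(γ : ℂ)) Complex.one_mem_slitPlane)
  have h1 : (((1 : ℂ) ^ (-(γ : ℂ))).re) = 1 := by simp
  have hev : ∀ᶠ ζ : ℂ in 𝓝 1, 1 / 2 < (ζ ^ (-(γ : ℂ))).re :=
    hc.eventually_const_lt (by simp only [h1]; norm_num)
  obtain ⟨δ, hδ, h⟩ := Metric.eventually_nhds_iff.1 hev
  refine ⟨min (δ / 2) (1 / 2), by positivity, by
    exact (min_le_right _ _).trans_lt (by norm_num), fun ζ hζ => (h ?_).le⟩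
  rw [dist_eq_norm]
  have := min_le_left (δ / 2) (1 / 2 : ℝ)
  linarith

theorem ofReal_mul_cpow {x : ℝ} (hx : 0 < x) {ζ : ℂ} (hζ : ζ ≠ 0) (γ : ℝ) :
    ((x : ℂ) * ζ) ^ (-(γ : ℂ)) = ((x ^ (-γ) : ℝ) : ℂ) * ζ ^ (-(γ : ℂ)) := by
  have hx0 : (x : ℂ) ≠ 0 := by exact_mod_cast hx.ne'
  rw [Complex.cpow_def_of_ne_zero (mul_ne_zero hx0 hζ), Complex.log_ofReal_mul hx hζ, add_mul,
    Complex.exp_add, ← Complex.cpow_def_of_ne_zero hζ, Complex.ofReal_cpow hx.le,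
    Complex.cpow_def_of_ne_zero hx0, Complex.ofReal_log hx.le]
  simp

/-- The restriction to the positive axis of a function holomorphic near that axis. -/
theorem iteratedDeriv_re_of_analyticOnNhd {H : ℂ → ℂ} {f : ℝ → ℝ}
    (hH : ∀ x : ℝ, 0 < x → AnalyticAt ℂ H x) (hf : ∀ x : ℝ, 0 < x → f x = (H x).re) (k : ℕ) :
    ∀ x : ℝ, 0 < x → iteratedDeriv k f x = (iteratedDeriv k H x).re ∧
      HasDerivAt (iteratedDeriv k f) (iteratedDeriv (k + 1) H x).re x := by
  have step : ∀ k, (∀ x : ℝ, 0 < x → iteratedDeriv k f x = (iteratedDeriv k H x).re) →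
      ∀ x : ℝ, 0 < x → HasDerivAt (iteratedDeriv k f) (iteratedDeriv (k + 1) H x).re x := by
    intro k hk x hx
    have hd : HasDerivAt (iteratedDeriv k H) (iteratedDeriv (k + 1) H x) (x : ℂ) := by
      rw [iteratedDeriv_succ]
      rw [iteratedDeriv_eq_iterate]
      exact ((hH x hx).iterated_deriv k).differentiableAt.hasDerivAt
    refine hd.real_of_complex.congr_of_eventuallyEq ?_
    filter_upwards [lt_mem_nhds hx] with y hy using hk y hy
  have main : ∀ k, ∀ x : ℝ, 0 < x → iteratedDeriv k f x = (iteratedDeriv k H x).re := by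
    intro k
    induction k with
    | zero => simpa using hf
    | succ k ih =>
      intro x hx
      rw [iteratedDeriv_succ, (step k ih x hx).deriv]
  exact fun x hx => ⟨main k x hx, step k (main k) x hx⟩

theorem analyticAt_cexp_cpow (lam γ : ℝ) {z : ℂ} (hz : z ∈ Complex.slitPlane) :
    AnalyticAt ℂ (fun z : ℂ => Complex.exp (-(lam : ℂ) * z ^ (-(γ : ℂ)))) z :=
  ((analyticAt_const.mul (analyticAt_id.cpow analyticAt_const hz))).cexp

/-- Cauchy estimate for `exp (-λ x^{-γ})` on the positive axis. -/
theorem exists_abs_iteratedDeriv_exp_rpow_le (γ : ℝ) :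
    ∃ κ : ℝ, 0 < κ ∧ ∀ lam : ℝ, 0 ≤ lam → ∀ k : ℕ, ∀ x : ℝ, 0 < x →
      DifferentiableAt ℝ (iteratedDeriv k (fun x : ℝ => Real.exp (-lam * x ^ (-γ)))) x ∧
      |iteratedDeriv k (fun x : ℝ => Real.exp (-lam * x ^ (-γ))) x| ≤
        (k ! : ℝ) * Real.exp (-(lam / 2) * x ^ (-γ)) / (κ * x) ^ k := by
  obtain ⟨κ, hκ, hκ1, hre⟩ := exists_half_le_re_cpow γ
  refine ⟨κ, hκ, fun lam hlam k x hx => ?_⟩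
  set H : ℂ → ℂ := fun z => Complex.exp (-(lam : ℂ) * z ^ (-(γ : ℂ))) with hHdef
  have hslit : ∀ y : ℝ, 0 < y → (y : ℂ) ∈ Complex.slitPlane := fun y hy =>
    Complex.ofReal_mem_slitPlane.2 hy
  have hval : ∀ y : ℝ, 0 < y → Real.exp (-lam * y ^ (-γ)) = (H y).re := by
    intro y hy
    have : H y = ((Real.exp (-lam * y ^ (-γ)) : ℝ) : ℂ) := by
      simp only [hHdef]
      rw [Complex.ofReal_exp]
      push_cast
      rw [Complex.ofReal_cpow hy.le]
      simp
    rw [this, Complex.ofReal_re]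
  obtain ⟨h1, h2⟩ := iteratedDeriv_re_of_analyticOnNhd
    (fun y hy => analyticAt_cexp_cpow lam γ (hslit y hy)) hval k x hx
  refine ⟨h2.differentiableAt, ?_⟩
  rw [h1]
  refine (Complex.abs_re_le_norm _).trans ?_
  have hmem : ∀ z : ℂ, z ∈ Metric.closedBall (x : ℂ) (κ * x) → z ∈ Complex.slitPlane := by
    intro z hz
    left
    have h3 : |z.re - x| ≤ κ * x := by
      have := (Complex.abs_re_le_norm (z - x)).trans (mem_closedBall_iff_norm.1 hz)
      simpa using this
    have h4 := (abs_le.1 h3).1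
    nlinarith
  refine Complex.norm_iteratedDeriv_le_of_forall_mem_sphere_norm_le k (by positivity) ?_ ?_
  · refine DifferentiableOn.diffContOnCl fun z hz => ?_
    have hz' := Metric.closure_ball_subset_closedBall hz
    exact (analyticAt_cexp_cpow lam γ (hmem z hz')).differentiableAt.differentiableWithinAt
  · intro z hz
    have hx0 : (x : ℂ) ≠ 0 := by exact_mod_cast hx.ne'
    have hz0 : z ≠ 0 := Complex.slitPlane_ne_zero (hmem z (Metric.sphere_subset_closedBall hz))
    have hzx : z = (x : ℂ) * (z / x) := by field_simp
    have hζ : ‖z / x - 1‖ ≤ κ := by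
      have : z / x - 1 = (z - x) / x := by field_simp
      rw [this, norm_div, mem_sphere_iff_norm.1 hz, Complex.norm_real, Real.norm_of_nonneg hx.le]
      exact (mul_div_cancel_right₀ _ hx.ne').le
    -- On the circle Re z^(-γ) ≥ x^(-γ) / 2; this turns λ into λ / 2 in the bound.
    have hr := hre _ hζ
    rw [Complex.norm_exp, Real.exp_le_exp]
    rw [hzx, ofReal_mul_cpow hx (div_ne_zero hz0 hx0), ← mul_assoc, ← Complex.ofReal_neg,
      ← Complex.ofReal_mul, Complex.re_ofReal_mul]
    have hp : 0 ≤ lam * x ^ (-γ) := by positivity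
    nlinarith

/-- The function equal to `exp (-λ x^{-γ})` for `x > 0` and to `0` for `x ≤ 0`. -/
def flatExp (lam γ : ℝ) (x : ℝ) : ℝ := if 0 < x then Real.exp (-lam * x ^ (-γ)) else 0

/-- Extension by `0` of a smooth function on the positive axis all of whose derivatives
are `O(x²)` at the origin. -/
theorem iteratedDeriv_extend_zero {f g : ℝ → ℝ} (hg : ∀ x, g x = if 0 < x then f x else 0)
    (hd : ∀ k x, 0 < x → DifferentiableAt ℝ (iteratedDeriv k f) x)
    (hb : ∀ k, ∃ M, ∀ x, 0 < x → |iteratedDeriv k f x| ≤ M * x ^ 2) :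
    ContDiff ℝ ((⊤ : ℕ∞) : WithTop ℕ∞) g ∧
      ∀ k x, iteratedDeriv k g x = if 0 < x then iteratedDeriv k f x else 0 := by
  have hasD : ∀ k x, HasDerivAt (fun x => if 0 < x then iteratedDeriv k f x else 0)
      (if 0 < x then iteratedDeriv (k + 1) f x else 0) x := by
    intro k x
    rcases lt_trichotomy x 0 with hx | rfl | hx
    · rw [if_neg hx.not_gt]
      refine (hasDerivAt_const x (0 : ℝ)).congr_of_eventuallyEq ?_
      filter_upwards [gt_mem_nhds hx] with y hy
      rw [if_neg (not_lt.2 hy.le)]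
    · rw [if_neg (lt_irrefl _)]
      obtain ⟨M, hM⟩ := hb k
      have hM0 : 0 ≤ M := by
        have := (abs_nonneg _).trans (hM 1 one_pos)
        simpa using this
      rw [hasDerivAt_iff_isLittleO_nhds_zero]
      simp only [zero_add, lt_irrefl, if_false, sub_zero, smul_zero]
      refine Asymptotics.IsBigO.trans_isLittleO (g := fun h : ℝ => h ^ 2) ?_ ?_
      · refine Asymptotics.IsBigO.of_bound M (Filter.Eventually.of_forall fun h => ?_)
        split_ifs with hh
        · simpa using hM h hh
        · simp only [norm_zero]; positivity
      · exact Asymptotics.isLittleO_pow_id one_lt_two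
    · rw [if_pos hx, iteratedDeriv_succ]
      refine (hd k x hx).hasDerivAt.congr_of_eventuallyEq ?_
      filter_upwards [lt_mem_nhds hx] with y hy
      rw [if_pos hy]
  have main : ∀ k, iteratedDeriv k g = fun x => if 0 < x then iteratedDeriv k f x else 0 := by
    intro k
    induction k with
    | zero => funext x; simpa using hg x
    | succ k ih =>
      funext x
      rw [iteratedDeriv_succ, ih, (hasD k x).deriv]
  refine ⟨contDiff_of_differentiable_iteratedDeriv fun k _ => ?_, fun k x => by rw [main k]⟩
  rw [main k]
  exact fun x => (hasD k x).differentiableAt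

/-- The flat exponential absorbs the pole x^(-k) at the price of k!^(1/γ):
`pow_le_exp_mul_factorial_rpow` with exponent 1/γ at y = s/x. -/
theorem inv_pow_mul_exp_le {γ s x : ℝ} (hγ : 0 < γ) (hs : 0 < s) (hx : 0 < x) (k : ℕ) :
    Real.exp (-(s ^ γ / γ) * x ^ (-γ)) / x ^ k ≤ (k ! : ℝ) ^ (1 / γ) / s ^ k := by
  have h := pow_le_exp_mul_factorial_rpow (α := 1 / γ) (y := s / x) (by positivity)
    (by positivity) k
  rw [one_div_one_div, Real.div_rpow hs.le hx.le, div_pow] at h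
  rw [Real.rpow_neg hx.le]
  have e1 : Real.exp (-(s ^ γ / γ) * (x ^ γ)⁻¹) * Real.exp (1 / γ * (s ^ γ / x ^ γ)) = 1 := by
    rw [← Real.exp_add, Real.exp_eq_one_iff]
    field_simp
    ring
  have hE := Real.exp_pos (-(s ^ γ / γ) * (x ^ γ)⁻¹)
  rw [div_le_div_iff₀ (by positivity) (by positivity)]
  rw [div_le_iff₀ (by positivity)] at h
  calc _ ≤ Real.exp (-(s ^ γ / γ) * (x ^ γ)⁻¹) *
        (Real.exp (1 / γ * (s ^ γ / x ^ γ)) * (k ! : ℝ) ^ (1 / γ) * x ^ k) := by gcongr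
    _ = (Real.exp (-(s ^ γ / γ) * (x ^ γ)⁻¹) * Real.exp (1 / γ * (s ^ γ / x ^ γ))) *
        ((k ! : ℝ) ^ (1 / γ) * x ^ k) := by ring
    _ = _ := by rw [e1, one_mul]

/-- Cauchy's k! and the k!^(1/γ) paid for the pole give the exponent 1 + 1/γ. Any rate R is reached
with λ large: s is chosen so that 1/(κ s) = R. -/
theorem exists_gevreyBound_flatExp {γ R : ℝ} (hγ : 0 < γ) (hR : 0 < R) :
    ∃ lam : ℝ, 0 < lam ∧ GevreyBound (1 + 1 / γ) R 1 (flatExp lam γ) := by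
  obtain ⟨κ, hκ, hb⟩ := exists_abs_iteratedDeriv_exp_rpow_le γ
  set s : ℝ := 1 / (κ * R) with hs
  have hs0 : 0 < s := by positivity
  set lam : ℝ := 2 * (s ^ γ / γ) with hlam
  have hlam0 : 0 < lam := by positivity
  have hl2 : lam / 2 = s ^ γ / γ := by rw [hlam]; ring
  obtain ⟨hc, hi⟩ := iteratedDeriv_extend_zero (f := fun x : ℝ => Real.exp (-lam * x ^ (-γ)))
    (g := flatExp lam γ) (fun x => rfl) (fun k x hx => (hb lam hlam0.le k x hx).1) (by
      intro k
      -- Absorbing two more powers of x than needed leaves the factor x² that smoothness at 0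
      -- requires.
      refine ⟨(k ! : ℝ) * (((k + 2)! : ℝ) ^ (1 / γ) / s ^ (k + 2)) / κ ^ k, fun x hx => ?_⟩
      refine (hb lam hlam0.le k x hx).2.trans ?_
      have h := inv_pow_mul_exp_le hγ hs0 hx (k + 2)
      rw [hl2]
      calc (k ! : ℝ) * Real.exp (-(s ^ γ / γ) * x ^ (-γ)) / (κ * x) ^ k
          = (k ! : ℝ) * (Real.exp (-(s ^ γ / γ) * x ^ (-γ)) / x ^ (k + 2)) / κ ^ k * x ^ 2 := by
            rw [mul_pow, pow_add]; field_simp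
        _ ≤ _ := by gcongr)
  refine ⟨lam, hlam0, hc, fun k x => ?_⟩
  rw [hi]
  have hfac := factorial_rpow_pos (1 + 1 / γ) k
  split_ifs with hx
  · refine (hb lam hlam0.le k x hx).2.trans ?_
    have h := inv_pow_mul_exp_le hγ hs0 hx k
    rw [hl2]
    calc (k ! : ℝ) * Real.exp (-(s ^ γ / γ) * x ^ (-γ)) / (κ * x) ^ k
        = (k ! : ℝ) * (Real.exp (-(s ^ γ / γ) * x ^ (-γ)) / x ^ k) / κ ^ k := by
          rw [mul_pow]; field_simp
      _ ≤ (k ! : ℝ) * ((k ! : ℝ) ^ (1 / γ) / s ^ k) / κ ^ k := by gcongr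
      _ = 1 * R ^ k * (k ! : ℝ) ^ (1 + 1 / γ) := by
          rw [Real.rpow_add (by exact_mod_cast k.factorial_pos), Real.rpow_one, hs, div_pow,
            mul_pow, one_pow]
          field_simp
  · rw [abs_zero]
    positivity

/-! ### Gevrey bump functions of small width -/

theorem flatExp_nonneg (lam γ x : ℝ) : 0 ≤ flatExp lam γ x := by
  unfold flatExp
  split_ifs <;> positivity

theorem flatExp_of_nonpos {lam γ x : ℝ} (hx : x ≤ 0) : flatExp lam γ x = 0 :=
  if_neg hx.not_gt

theorem exp_le_flatExp {lam γ x y : ℝ} (hlam : 0 ≤ lam) (hγ : 0 ≤ γ) (hy : 0 < y) (hyx : y ≤ x) :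
    Real.exp (-lam * y ^ (-γ)) ≤ flatExp lam γ x := by
  rw [flatExp, if_pos (hy.trans_le hyx), Real.exp_le_exp]
  have : x ^ (-γ) ≤ y ^ (-γ) := Real.rpow_le_rpow_of_nonpos hy hyx (by linarith)
  nlinarith

/-- A smooth step, `0` for `x ≤ 0` and `1` for `x ≥ a`. -/
theorem GevreyBound.exists_step {α R a I : ℝ} {η : ℝ → ℝ} (hα : 0 ≤ α) (hR : 0 < R)
    (hη : GevreyBound α R 1 η) (h0 : ∀ x, 0 ≤ η x) (hl : ∀ x ≤ 0, η x = 0)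
    (hr : ∀ x, a ≤ x → η x = 0) (hI : 0 < I) (hIη : I ≤ ∫ x in (0 : ℝ)..a, η x) :
    ∃ S : ℝ → ℝ, GevreyBound α R (1 + 1 / (I * R)) S ∧ (∀ x ≤ 0, S x = 0) ∧
      ∀ x, a ≤ x → S x = 1 := by
  have hcont : Continuous η := hη.1.continuous
  set J := ∫ x in (0 : ℝ)..a, η x with hJ
  have hJ0 : 0 < J := hI.trans_le hIη
  have hηint : ∀ x y : ℝ, IntervalIntegrable η MeasureTheory.volume x y := fun x y =>
    hcont.intervalIntegrable x y
  set S : ℝ → ℝ := fun x => J⁻¹ * ∫ t in (0 : ℝ)..x, η t with hS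
  have hderiv : ∀ x, HasDerivAt S (J⁻¹ * η x) x := fun x =>
    (intervalIntegral.integral_hasDerivAt_right (hηint 0 x)
      (hcont.stronglyMeasurableAtFilter _ _) hcont.continuousAt).const_mul _
  have hdS : deriv S = fun x => J⁻¹ * η x := funext fun x => (hderiv x).deriv
  have hSl : ∀ x ≤ 0, S x = 0 := by
    intro x hx
    have : ∫ t in (0 : ℝ)..x, η t = 0 := by
      rw [intervalIntegral.integral_symm, neg_eq_zero]
      rw [intervalIntegral.integral_congr (g := fun _ => (0 : ℝ))]
      · simp
      · intro t ht
        rw [Set.uIcc_of_le hx] at ht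
        exact hl t ht.2
    simp [hS, this]
  have hSr : ∀ x, a ≤ x → S x = 1 := by
    intro x hx
    have h1 : ∫ t in a..x, η t = 0 := by
      rw [intervalIntegral.integral_congr (g := fun _ => (0 : ℝ))]
      · simp
      · intro t ht
        rw [Set.uIcc_of_le hx] at ht
        exact hr t ht.1
    have h2 := intervalIntegral.integral_add_adjacent_intervals (hηint 0 a) (hηint a x)
    simp only [hS]
    rw [← h2, h1, add_zero]
    exact inv_mul_cancel₀ hJ0.ne'
  have hmono : Monotone S := monotone_of_deriv_nonneg (fun x => (hderiv x).differentiableAt) fun x => by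
    rw [hdS]
    have := h0 x
    positivity
  have hS01 : ∀ x, 0 ≤ S x ∧ S x ≤ 1 := fun x =>
    ⟨(hSl _ (min_le_right x 0)).symm.le.trans (hmono (min_le_left x 0)),
      (hmono (le_max_left x a)).trans (hSr _ (le_max_right x a)).le⟩
  refine ⟨S, ⟨?_, fun k x => ?_⟩, hSl, hSr⟩
  · rw [contDiff_infty_iff_deriv]
    refine ⟨fun x => (hderiv x).differentiableAt, ?_⟩
    rw [hdS]
    exact contDiff_const.mul hη.1
  · have hpos : 0 < 1 / (I * R) := by positivity
    rcases k with _ | k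
    · have := hS01 x
      simp only [iteratedDeriv_zero, pow_zero, mul_one, Nat.factorial_zero, Nat.cast_one,
        Real.one_rpow]
      rw [abs_of_nonneg this.1]
      linarith
    · rw [iteratedDeriv_succ', hdS, iteratedDeriv_const_mul_field, abs_mul,
        abs_of_pos (inv_pos.2 hJ0)]
      have h1 := hη.2 k x
      have hf1 := (factorial_rpow_pos α k).le
      have hf2 : (k ! : ℝ) ^ α ≤ ((k + 1)! : ℝ) ^ α := by
        refine Real.rpow_le_rpow (by positivity) ?_ hα
        exact_mod_cast Nat.factorial_le (Nat.le_succ k)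
      calc J⁻¹ * |iteratedDeriv k η x| ≤ I⁻¹ * (1 * R ^ k * ((k + 1)! : ℝ) ^ α) := by
            refine mul_le_mul (inv_anti₀ hI hIη) (h1.trans ?_) (abs_nonneg _) (by positivity)
            gcongr
        _ = (0 + 1 / (I * R)) * R ^ (k + 1) * ((k + 1)! : ℝ) ^ α := by
            rw [pow_succ]; field_simp; ring
        _ ≤ _ := by gcongr; exact zero_le_one

/-- The bump is a rising step times a falling one, both being normalized primitives of `flatExp lam
γ x * flatExp lam γ (w / 2 - x)`. The cost is the inverse of the integral of this product. The
initial rate is R / 4 because two products follow, each doubling it. -/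
theorem exists_gevreyBound_bump {α R : ℝ} (hα : 1 < α) (hR : 0 < R) :
    ∃ c : ℝ, 0 < c ∧ ∀ w : ℝ, 0 < w → w ≤ 1 → ∃ b : ℝ → ℝ,
      GevreyBound α R (Real.exp (c * w ^ (-(1 / (α - 1))))) b ∧
      (∀ x, |x| ≤ w / 2 → b x = 1) ∧ ∀ x, w ≤ |x| → b x = 0 := by
  set γ : ℝ := 1 / (α - 1) with hγdef
  have hα1 : 0 < α - 1 := by linarith
  have hγ : 0 < γ := by positivity
  have hαγ : 1 + 1 / γ = α := by rw [hγdef]; field_simp; ring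
  clear_value γ
  obtain ⟨lam, hlam, hh⟩ := exists_gevreyBound_flatExp hγ (show 0 < R / 4 by positivity)
  rw [hαγ] at hh
  -- The outer 2 counts the two steps. Inside, 8 / R and 1 / γ take care of the prefactor 8 / (R w),
  -- and the last term is the inverse square of exp(-λ (w/8)^(-γ)).
  refine ⟨2 * (8 / R + 1 / γ + 2 * lam * 8 ^ γ), by positivity, fun w hw hw1 => ?_⟩
  set a : ℝ := w / 2 with ha
  have ha0 : 0 < a := by positivity
  have hη := hh.mul hα.le (by positivity) (hh.comp_const_sub a)
  rw [one_mul, show 2 * (R / 4) = R / 2 by ring] at hη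
  set η : ℝ → ℝ := fun x => flatExp lam γ x * flatExp lam γ (a - x) with hηdef
  set e : ℝ := Real.exp (-lam * (a / 4) ^ (-γ)) with he
  have he0 : 0 < e := Real.exp_pos _
  -- On the middle half of [0, a] both factors of η are at least e.
  have hIη : a / 2 * e ^ 2 ≤ ∫ x in (0 : ℝ)..a, η x := by
    have hcont : Continuous η := hη.1.continuous
    have hηint : ∀ x y : ℝ, IntervalIntegrable η MeasureTheory.volume x y := fun x y =>
      hcont.intervalIntegrable x y
    have h0 : ∀ x, 0 ≤ η x := fun x => mul_nonneg (flatExp_nonneg _ _ _) (flatExp_nonneg _ _ _)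
    have h1 : ∫ x in (a / 4)..(3 * a / 4), η x ≤ ∫ x in (0 : ℝ)..a, η x :=
      intervalIntegral.integral_mono_interval (by linarith) (by linarith) (by linarith)
        (Filter.Eventually.of_forall h0) (hηint _ _)
    have h2 : ∫ x in (a / 4)..(3 * a / 4), e ^ 2 ≤ ∫ x in (a / 4)..(3 * a / 4), η x := by
      refine intervalIntegral.integral_mono_on (by linarith) (by simp) (hηint _ _) fun x hx => ?_
      have p1 := exp_le_flatExp hlam.le hγ.le (show 0 < a / 4 by positivity) hx.1
      have p2 := exp_le_flatExp hlam.le hγ.le (show 0 < a / 4 by positivity)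
        (show a / 4 ≤ a - x by linarith [hx.2])
      rw [sq]
      exact mul_le_mul p1 p2 he0.le (flatExp_nonneg _ _ _)
    rw [intervalIntegral.integral_const, smul_eq_mul] at h2
    calc a / 2 * e ^ 2 = (3 * a / 4 - a / 4) * e ^ 2 := by ring
      _ ≤ _ := h2.trans h1
  obtain ⟨S, hS, hS0, hS1⟩ := hη.exists_step (by linarith) (by positivity)
    (fun x => mul_nonneg (flatExp_nonneg _ _ _) (flatExp_nonneg _ _ _))
    (fun x hx => by simp only [hηdef]; rw [flatExp_of_nonpos hx, zero_mul])
    (fun x hx => by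
      simp only [hηdef]; rw [flatExp_of_nonpos (show a - x ≤ 0 by linarith), mul_zero])
    (by positivity) hIη
  have hb := (hS.comp_add_const w).mul hα.le (by positivity) (hS.comp_const_sub w)
  rw [show 2 * (R / 2) = R by ring] at hb
  refine ⟨_, hb.mono_const hR.le ?_, fun x hx => ?_, fun x hx => ?_⟩
  · set Y : ℝ := w ^ (-γ) with hY
    have hY1 : 1 ≤ Y := Real.one_le_rpow_of_pos_of_le_one_of_nonpos hw hw1 (by linarith)
    have hA : 1 + 1 / (a / 2 * e ^ 2 * (R / 2)) ≤
        Real.exp ((8 / R + 1 / γ + 2 * lam * 8 ^ γ) * Y) := by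
      have q1 : 1 / w ≤ Real.exp (1 / γ * Y) := by
        have := pow_le_exp_mul_factorial_rpow (α := 1 / γ) (y := 1 / w) (by positivity)
          (by positivity) 1
        rw [one_div_one_div, Real.div_rpow zero_le_one hw.le, Real.one_rpow] at this
        rw [hY, Real.rpow_neg hw.le]
        simpa only [pow_one, Nat.factorial_one, Nat.cast_one, Real.one_rpow, mul_one,
          one_div (w ^ γ)] using this
      have q2 : (e ^ 2)⁻¹ = Real.exp (2 * lam * 8 ^ γ * Y) := by
        rw [he, ← Real.exp_nat_mul, ← Real.exp_neg, hY, ha,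
          show w / 2 / 4 = w / 8 by ring, Real.div_rpow hw.le (by norm_num),
          Real.rpow_neg (show (0 : ℝ) ≤ 8 by norm_num)]
        congr 1
        push_cast
        rw [div_inv_eq_mul]
        ring
      have q3 : 1 + 8 / R ≤ Real.exp (8 / R * Y) := by
        have := Real.add_one_le_exp (8 / R * Y)
        have : 8 / R ≤ 8 / R * Y := le_mul_of_one_le_right (by positivity) hY1
        linarith
      have q4 : 1 / (a / 2 * e ^ 2 * (R / 2)) = 8 / R * (1 / w * (e ^ 2)⁻¹) := by
        rw [ha]; field_simp; norm_num
      have q5 : 1 ≤ 1 / w * (e ^ 2)⁻¹ := by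
        rw [q2]
        refine one_le_mul_of_one_le_of_one_le ?_ (Real.one_le_exp (by positivity))
        rw [le_div_iff₀ hw]; linarith
      rw [q4, add_mul, add_mul, Real.exp_add, Real.exp_add, mul_assoc]
      calc 1 + 8 / R * (1 / w * (e ^ 2)⁻¹) ≤ (1 + 8 / R) * (1 / w * (e ^ 2)⁻¹) := by
            rw [add_mul, one_mul]; linarith
        _ ≤ _ := by
            rw [← q2]
            gcongr
    have hpos : 0 ≤ 1 + 1 / (a / 2 * e ^ 2 * (R / 2)) := by positivity
    calc _ ≤ Real.exp ((8 / R + 1 / γ + 2 * lam * 8 ^ γ) * Y) *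
          Real.exp ((8 / R + 1 / γ + 2 * lam * 8 ^ γ) * Y) :=
        mul_le_mul hA hA hpos (Real.exp_pos _).le
      _ = _ := by
        rw [← Real.exp_add]
        congr 1
        ring
  · have := abs_le.1 hx
    rw [hS1 _ (by linarith), hS1 _ (by linarith), one_mul]
  · rcases le_abs.1 hx with h | h
    · rw [hS0 (w - x) (by linarith), mul_zero]
    · rw [hS0 (x + w) (by linarith), zero_mul]

/-! ### Sums of tensor products of one-variable functions -/

/-- `∑_n ∏_i (∂^{k i} h_{n,i}) (x_i)`. -/
def tensorSum {N : ℕ} (h : ℕ → Fin N → ℝ → ℝ) (k : Fin N → ℕ) (x : Fin N → ℝ) : ℝ :=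
  ∑' n, ∏ i, iteratedDeriv (k i) (h n i) (x i)

section

variable {N : ℕ} {α R : ℝ} {A : ℕ → Fin N → ℝ} {h : ℕ → Fin N → ℝ → ℝ}

theorem abs_prod_iteratedDeriv_le (hh : ∀ n i, GevreyBound α R (A n i) (h n i))
    (k : Fin N → ℕ) (n : ℕ) (x : Fin N → ℝ) :
    |∏ i, iteratedDeriv (k i) (h n i) (x i)| ≤
      (∏ i, A n i) * ∏ i, (R ^ k i * ((k i)! : ℝ) ^ α) := by
  rw [Finset.abs_prod, ← Finset.prod_mul_distrib]
  refine Finset.prod_le_prod (fun i _ => abs_nonneg _) fun i _ => ?_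
  rw [← mul_assoc]
  exact (hh n i).2 (k i) (x i)

theorem summable_tensor (hh : ∀ n i, GevreyBound α R (A n i) (h n i))
    (hs : Summable fun n => ∏ i, A n i) (k : Fin N → ℕ) (x : Fin N → ℝ) :
    Summable fun n => ∏ i, iteratedDeriv (k i) (h n i) (x i) :=
  Summable.of_norm_bounded (hs.mul_right _) fun n => abs_prod_iteratedDeriv_le hh k n x

theorem abs_tensorSum_le (hh : ∀ n i, GevreyBound α R (A n i) (h n i))
    (hs : Summable fun n => ∏ i, A n i) (k : Fin N → ℕ) (x : Fin N → ℝ) :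
    |tensorSum h k x| ≤ (∑' n, ∏ i, A n i) * ∏ i, (R ^ k i * ((k i)! : ℝ) ^ α) := by
  rw [← tsum_mul_right, tensorSum, ← Real.norm_eq_abs]
  exact tsum_of_norm_bounded (hs.mul_right _).hasSum fun n => abs_prod_iteratedDeriv_le hh k n x

/-- Differentiating in x_j only raises `k j` by one, so all derivatives stay in the same family and
obey the same estimates. -/
theorem hasFDerivAt_tensor (hh : ∀ n i, GevreyBound α R (A n i) (h n i))
    (k : Fin N → ℕ) (n : ℕ) (x : Fin N → ℝ) :
    HasFDerivAt (fun x : Fin N → ℝ => ∏ i, iteratedDeriv (k i) (h n i) (x i))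
      (∑ j, (∏ i, iteratedDeriv ((k + Pi.single j 1 : Fin N → ℕ) i) (h n i) (x i)) •
        (ContinuousLinearMap.proj j : (Fin N → ℝ) →L[ℝ] ℝ)) x := by
  have h1 : ∀ i ∈ (Finset.univ : Finset (Fin N)),
      HasFDerivAt (fun x : Fin N → ℝ => iteratedDeriv (k i) (h n i) (x i))
        (iteratedDeriv (k i + 1) (h n i) (x i) •
          (ContinuousLinearMap.proj i : (Fin N → ℝ) →L[ℝ] ℝ)) x := by
    intro i _
    have hd : HasDerivAt (iteratedDeriv (k i) (h n i))
        (iteratedDeriv (k i + 1) (h n i) (x i)) (x i) := by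
      rw [iteratedDeriv_succ]
      exact ((hh n i).1.differentiable_iteratedDeriv (k i)
        (by exact_mod_cast WithTop.coe_lt_top _) (x i)).hasDerivAt
    exact hd.comp_hasFDerivAt x (ContinuousLinearMap.proj (R := ℝ) i).hasFDerivAt
  have h2 := HasFDerivAt.finsetProd h1
  refine h2.congr_fderiv (Finset.sum_congr rfl fun j _ => ?_)
  rw [smul_smul]
  congr 1
  rw [← Finset.mul_prod_erase _ _ (Finset.mem_univ j), mul_comm]
  congr 1
  · simp
  · refine Finset.prod_congr rfl fun i hi => ?_
    simp [Pi.single_eq_of_ne (Finset.ne_of_mem_erase hi)]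

theorem norm_tensor_fderiv_le (hh : ∀ n i, GevreyBound α R (A n i) (h n i))
    (k : Fin N → ℕ) (n : ℕ) (x : Fin N → ℝ) :
    ‖∑ j, (∏ i, iteratedDeriv ((k + Pi.single j 1 : Fin N → ℕ) i) (h n i) (x i)) •
        (ContinuousLinearMap.proj j : (Fin N → ℝ) →L[ℝ] ℝ)‖ ≤
      (∏ i, A n i) * ∑ j, ∏ i, (R ^ (k + Pi.single j 1 : Fin N → ℕ) i *
        (((k + Pi.single j 1 : Fin N → ℕ) i)! : ℝ) ^ α) := by
  rw [Finset.mul_sum]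
  refine (norm_sum_le _ _).trans (Finset.sum_le_sum fun j _ => ?_)
  rw [norm_smul]
  have hp : ‖(ContinuousLinearMap.proj j : (Fin N → ℝ) →L[ℝ] ℝ)‖ ≤ 1 :=
    ContinuousLinearMap.opNorm_le_bound _ zero_le_one fun y => by
      rw [one_mul]; exact norm_le_pi_norm y j
  calc _ ≤ ‖∏ i, iteratedDeriv ((k + Pi.single j 1 : Fin N → ℕ) i) (h n i) (x i)‖ * 1 := by gcongr
    _ ≤ _ := by
      rw [mul_one]
      exact abs_prod_iteratedDeriv_le hh _ n x

theorem hasFDerivAt_tensorSum (hh : ∀ n i, GevreyBound α R (A n i) (h n i))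
    (hs : Summable fun n => ∏ i, A n i) (k : Fin N → ℕ) (x : Fin N → ℝ) :
    HasFDerivAt (tensorSum h k) (∑ j, tensorSum h (k + Pi.single j 1) x •
      (ContinuousLinearMap.proj j : (Fin N → ℝ) →L[ℝ] ℝ)) x := by
  have h1 := hasFDerivAt_tsum (hs.mul_right _) (fun n x => hasFDerivAt_tensor hh k n x)
    (fun n x => norm_tensor_fderiv_le hh k n x) (summable_tensor hh hs k 0) x
  refine h1.congr_fderiv ?_
  rw [Summable.tsum_finsetSum]
  · refine Finset.sum_congr rfl fun j _ => ?_
    exact (summable_tensor hh hs _ x).tsum_smul_const _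
  · intro j _
    exact (summable_tensor hh hs _ x).smul_const _

theorem pderiv_tensorSum (hh : ∀ n i, GevreyBound α R (A n i) (h n i))
    (hs : Summable fun n => ∏ i, A n i) (k : Fin N → ℕ) (j : Fin N) :
    pderiv j (tensorSum h k) = tensorSum h (k + Pi.single j 1) := by
  funext x
  rw [pderiv, (hasFDerivAt_tensorSum hh hs k x).fderiv]
  simp [Pi.single_apply]

theorem contDiff_tensorSum (hh : ∀ n i, GevreyBound α R (A n i) (h n i))
    (hs : Summable fun n => ∏ i, A n i) (k : Fin N → ℕ) :
    ContDiff ℝ ((⊤ : ℕ∞) : WithTop ℕ∞) (tensorSum h k) := by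
  refine contDiff_infty.2 fun m => ?_
  induction m generalizing k with
  | zero =>
    exact contDiff_zero.2 (continuous_iff_continuousAt.2 fun x =>
      (hasFDerivAt_tensorSum hh hs k x).continuousAt)
  | succ m ih =>
    exact contDiff_succ_iff_hasFDerivAt.2 ⟨_,
      ContDiff.sum fun j _ => (ih (k + Pi.single j 1)).smul contDiff_const,
      fun x => hasFDerivAt_tensorSum hh hs k x⟩

theorem iterate_pderiv_tensorSum (hh : ∀ n i, GevreyBound α R (A n i) (h n i))
    (hs : Summable fun n => ∏ i, A n i) (k : Fin N → ℕ) (j : Fin N) (m : ℕ) :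
    (pderiv j)^[m] (tensorSum h k) = tensorSum h (k + Pi.single j m) := by
  induction m with
  | zero => simp
  | succ m ih =>
    rw [Function.iterate_succ_apply', ih, pderiv_tensorSum hh hs, add_assoc, ← Pi.single_add]

theorem multiDeriv_tensorSum (hh : ∀ n i, GevreyBound α R (A n i) (h n i))
    (hs : Summable fun n => ∏ i, A n i) (ℓ : Fin N → ℕ) :
    multiDeriv ℓ (tensorSum h 0) = tensorSum h ℓ := by
  have key : ∀ l : List (Fin N), l.foldr (fun i g => (pderiv i)^[ℓ i] g) (tensorSum h 0) =
      tensorSum h (l.map fun i => Pi.single i (ℓ i)).sum := by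
    intro l
    induction l with
    | nil => simp
    | cons a l ih =>
      rw [List.foldr_cons, ih, iterate_pderiv_tensorSum hh hs, List.map_cons, List.sum_cons,
        add_comm]
  rw [multiDeriv, key]
  congr 1
  rw [← Fin.sum_univ_def]
  exact Finset.univ_sum_single ℓ

end

/-! ### Gevrey norm of a tensor sum -/

theorem tsum_pi_prod_inv_two (N : ℕ) :
    ∑' ℓ : Fin N → ℕ, ∏ i, (2⁻¹ : ℝ≥0∞) ^ ℓ i = 2 ^ N := by
  induction N with
  | zero => simp
  | succ N ih =>
    rw [← (Fin.consEquiv fun _ : Fin (N + 1) => ℕ).tsum_eq, ENNReal.tsum_prod']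
    simp only [Fin.consEquiv_apply, Fin.prod_univ_succ, Fin.cons_zero, Fin.cons_succ]
    simp_rw [ENNReal.tsum_mul_left, ih, ENNReal.tsum_mul_right, ENNReal.tsum_geometric,
      ENNReal.one_sub_inv_two, inv_inv, pow_succ, mul_comm]

/-- With the rate 1/(2 L^α) the weight of ∂^ℓ times its bound is 2^(-|ℓ|) times the sum of the
amplitudes, and these powers add up to 2^N. -/
theorem gevreyNorm_tensorSum_le {N : ℕ} {α L : ℝ} (hL : 0 < L) {A : ℕ → Fin N → ℝ}
    {h : ℕ → Fin N → ℝ → ℝ} (hh : ∀ n i, GevreyBound α (1 / (2 * L ^ α)) (A n i) (h n i))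
    (hs : Summable fun n => ∏ i, A n i) :
    gevreyNorm α L (tensorSum h 0) ≤ 2 ^ N * ENNReal.ofReal (∑' n, ∏ i, A n i) := by
  have hLα : 0 < L ^ α := Real.rpow_pos_of_pos hL α
  have hterm : ∀ ℓ : Fin N → ℕ,
      ENNReal.ofReal (L ^ (((∑ i, ℓ i : ℕ) : ℝ) * α) / ((∏ i, (ℓ i)! : ℕ) : ℝ) ^ α) *
        ⨆ x : Fin N → ℝ, ‖multiDeriv ℓ (tensorSum h 0) x‖ₑ ≤
      (∏ i, (2⁻¹ : ℝ≥0∞) ^ ℓ i) * ENNReal.ofReal (∑' n, ∏ i, A n i) := by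
    intro ℓ
    rw [multiDeriv_tensorSum hh hs]
    have hsup : ⨆ x : Fin N → ℝ, ‖tensorSum h ℓ x‖ₑ ≤ ENNReal.ofReal ((∑' n, ∏ i, A n i) *
        ∏ i, ((1 / (2 * L ^ α)) ^ ℓ i * ((ℓ i)! : ℝ) ^ α)) := by
      refine iSup_le fun x => ?_
      rw [← ofReal_norm]
      exact ENNReal.ofReal_le_ofReal (abs_tensorSum_le hh hs ℓ x)
    refine (mul_le_mul_right hsup _).trans (le_of_eq ?_)
    have h2 : (∏ i, (2⁻¹ : ℝ≥0∞) ^ ℓ i) = ENNReal.ofReal (∏ i, (2⁻¹ : ℝ) ^ ℓ i) := by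
      rw [ENNReal.ofReal_prod_of_nonneg (fun i _ => by positivity)]
      refine Finset.prod_congr rfl fun i _ => ?_
      rw [ENNReal.ofReal_pow (by positivity), ENNReal.ofReal_inv_of_pos (by norm_num)]
      simp
    have e1 : L ^ (((∑ i, ℓ i : ℕ) : ℝ) * α) = ∏ i, (L ^ α) ^ ℓ i := by
      rw [mul_comm, Real.rpow_mul hL.le, Real.rpow_natCast, Finset.prod_pow_eq_pow_sum]
    have e2 : ((∏ i, (ℓ i)! : ℕ) : ℝ) ^ α = ∏ i, ((ℓ i)! : ℝ) ^ α := by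
      push_cast
      rw [Real.finsetProd_rpow]
      exact fun i _ => by positivity
    rw [h2, ← ENNReal.ofReal_mul (by positivity),
      ← ENNReal.ofReal_mul (Finset.prod_nonneg fun i _ => by positivity), e1, e2]
    congr 1
    rw [mul_comm (∑' n, ∏ i, A n i), ← mul_assoc]
    congr 1
    rw [← Finset.prod_div_distrib, ← Finset.prod_mul_distrib]
    refine Finset.prod_congr rfl fun i _ => ?_
    have := (factorial_rpow_pos α (ℓ i)).ne'
    rw [one_div, mul_inv, mul_pow, inv_pow (L ^ α)]
    field_simp
  rw [gevreyNorm]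
  refine (ENNReal.tsum_le_tsum hterm).trans ?_
  rw [ENNReal.tsum_mul_right, tsum_pi_prod_inv_two]

/-! ### Complete flows of bounded Lipschitz vector fields -/

/-- Up to time T a solution stays in the ball of radius M T, and the Lipschitz constant is the same
everywhere, so Picard–Lindelöf applies on every [-T, T]. Uniqueness glues the solutions together. -/
theorem exists_global_integral_curve {F : Type*} [NormedAddCommGroup F] [NormedSpace ℝ F]
    [CompleteSpace F] {v : F → F} {K : NNReal} {M : ℝ} (hv : LipschitzWith K v)
    (hM : ∀ x, ‖v x‖ ≤ M) (x : F) :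
    ∃ c : ℝ → F, (∀ t, HasDerivAt c (v (c t)) t) ∧ c 0 = x := by
  have hM0 : 0 ≤ M := (norm_nonneg _).trans (hM x)
  have hloc : ∀ T : ℝ, 0 < T → ∃ c : ℝ → F, c 0 = x ∧
      ∀ t ∈ Set.Ioo (-T) T, HasDerivAt c (v (c t)) t := by
    intro T hT
    have h0 : (0 : ℝ) ∈ Set.Icc (-T) T := ⟨by linarith, hT.le⟩
    have hPL : IsPicardLindelof (fun _ => v) (⟨0, h0⟩ : Set.Icc (-T) T) x
        (M.toNNReal * T.toNNReal) 0 M.toNNReal K :=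
      { lipschitzOnWith := fun t _ => hv.lipschitzOnWith
        continuousOn := fun y _ => continuousOn_const
        norm_le := fun t _ y _ => by rw [Real.coe_toNNReal _ hM0]; exact hM y
        mul_max_le := by
          simp [Real.coe_toNNReal _ hM0, Real.coe_toNNReal _ hT.le] }
    obtain ⟨c, hc0, hc⟩ := hPL.exists_eq_forall_mem_Icc_hasDerivWithinAt₀
    exact ⟨c, hc0, fun t ht =>
      (hc t (Set.Ioo_subset_Icc_self ht)).hasDerivAt (Icc_mem_nhds ht.1 ht.2)⟩
  choose! c hc0 hc using hloc
  have hagree : ∀ T T' : ℝ, 0 < T → T ≤ T' → ∀ t ∈ Set.Ioo (-T) T, c T t = c T' t := by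
    intro T T' hT hTT' t ht
    refine ODE_solution_unique_of_mem_Ioo (v := fun _ => v) (s := fun _ => Set.univ) (K := K)
      (fun _ _ => hv.lipschitzOnWith) (t₀ := 0) ⟨by linarith, hT⟩
      (fun s hs => ⟨hc T hT s hs, trivial⟩)
      (fun s hs => ⟨hc T' (hT.trans_le hTT') s ⟨by linarith [hs.1], by linarith [hs.2]⟩, trivial⟩)
      (by rw [hc0 T hT, hc0 T' (hT.trans_le hTT')]) ht
  refine ⟨fun t => c (|t| + 1) t, fun t => ?_, hc0 _ (by positivity)⟩
  have hmem : ∀ s : ℝ, s ∈ Set.Ioo (-(|s| + 1)) (|s| + 1) := fun s =>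
    ⟨by linarith [neg_abs_le s], by linarith [le_abs_self s]⟩
  refine (hc (|t| + 1) (by positivity) t (hmem t)).congr_of_eventuallyEq ?_
  filter_upwards [Ioo_mem_nhds (hmem t).1 (hmem t).2] with s hs
  rcases le_total (|s| + 1) (|t| + 1) with h | h
  · exact hagree _ _ (by positivity) h s (hmem s)
  · exact (hagree _ _ (by positivity) h s hs).symm

theorem phaseCover_eq_iff {x y : Fin 4 → ℝ} : phaseCover x = phaseCover y ↔
    ((x 0 : UnitAddCircle) = (y 0 : UnitAddCircle) ∧ x 1 = y 1) ∧
      ((x 2 : UnitAddCircle) = (y 2 : UnitAddCircle) ∧ x 3 = y 3) := by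
  simp only [phaseCover, phasePt, annulusPt]
  rw [(WithLp.toLp_injective 2).eq_iff, Prod.mk.injEq, (WithLp.toLp_injective 2).eq_iff,
    (WithLp.toLp_injective 2).eq_iff, Prod.mk.injEq, Prod.mk.injEq]

theorem phaseCover_surjective : Function.Surjective phaseCover := by
  intro z
  obtain ⟨a, ha⟩ := QuotientAddGroup.mk_surjective z.fst.fst
  obtain ⟨b, hb⟩ := QuotientAddGroup.mk_surjective z.snd.fst
  refine ⟨![a, z.fst.snd, b, z.snd.snd], ?_⟩
  have ha' : (a : UnitAddCircle) = z.fst.fst := ha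
  have hb' : (b : UnitAddCircle) = z.snd.fst := hb
  simp only [phaseCover, phasePt, annulusPt, Matrix.cons_val_zero, Matrix.cons_val_one,
    Matrix.cons_val]
  rw [ha', hb']
  rfl

theorem phaseCover_add_of_eq {x y : Fin 4 → ℝ} (h : phaseCover x = phaseCover y)
    (a : Fin 4 → ℝ) : phaseCover (a + x) = phaseCover (a + y) := by
  rw [phaseCover_eq_iff] at h ⊢
  obtain ⟨⟨h0, h1⟩, h2, h3⟩ := h
  refine ⟨⟨?_, ?_⟩, ?_, ?_⟩
  · simp only [Pi.add_apply, AddCircle.coe_add, h0]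
  · simp only [Pi.add_apply, h1]
  · simp only [Pi.add_apply, AddCircle.coe_add, h2]
  · simp only [Pi.add_apply, h3]

theorem hamVectorField_add_of_periodic {H : (Fin 4 → ℝ) → ℝ} {a : Fin 4 → ℝ}
    (ha : ∀ x, H (x + a) = H x) (x : Fin 4 → ℝ) :
    hamVectorField H (x + a) = hamVectorField H x := by
  have hp : ∀ i, pderiv i H (x + a) = pderiv i H x := by
    intro i
    rw [pderiv, pderiv, ← fderiv_comp_add_right a]
    simp only [ha]
  simp only [hamVectorField, hp]

/-- Two lifts of a point differ by a period of `H ∘ phaseCover`, and translating an integral curve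
by a period gives an integral curve; so the end point in the phase space does not depend on the
lift. -/
theorem exists_isTimeOneMap {H : Phase → ℝ} {K : NNReal} {M : ℝ}
    (hv : LipschitzWith K (hamVectorField (H ∘ phaseCover)))
    (hM : ∀ x, ‖hamVectorField (H ∘ phaseCover) x‖ ≤ M) :
    ∃ Φ : Phase → Phase, IsTimeOneMap H Φ := by
  choose c hc hc0 using exists_global_integral_curve hv hM
  choose l hl using phaseCover_surjective
  refine ⟨fun z => phaseCover (c (l z) 1), fun x => ⟨c x, hc x, hc0 x⟩, fun e he => ?_⟩
  set x := l (phaseCover (e 0)) with hx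
  have hcov : phaseCover x = phaseCover (e 0) := hl _
  have hper : ∀ y, (H ∘ phaseCover) (y + (e 0 - x)) = (H ∘ phaseCover) y := by
    intro y
    have := phaseCover_add_of_eq hcov (y - x)
    simp only [Function.comp_apply]
    rw [show y + (e 0 - x) = y - x + e 0 by abel, ← this, sub_add_cancel]
  have heq : (fun t => c x t + (e 0 - x)) = e := by
    refine ODE_solution_unique_univ (v := fun _ => hamVectorField (H ∘ phaseCover))
      (s := fun _ => Set.univ) (K := K) (t₀ := 0) (fun _ => hv.lipschitzOnWith)
      (fun t => ⟨?_, trivial⟩) (fun t => ⟨he t, trivial⟩) (by rw [hc0]; abel)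
    rw [hamVectorField_add_of_periodic hper]
    exact (hc x t).add_const _
  have h1 := phaseCover_add_of_eq hcov (c x 1 - x)
  rw [sub_add_cancel] at h1
  have h2 : c x 1 + (e 0 - x) = e 1 := congrFun heq 1
  change phaseCover (c x 1) = _
  rw [h1, ← h2]
  congr 1
  abel

theorem IsTimeOneMap.apply_of_hasDerivAt {H : Phase → ℝ} {Φ : Phase → Phase} {K : NNReal}
    (hΦ : IsTimeOneMap H Φ) (hv : LipschitzWith K (hamVectorField (H ∘ phaseCover)))
    {c : ℝ → Fin 4 → ℝ}
    (hc : ∀ t ∈ Set.Icc (0 : ℝ) 1, HasDerivAt c (hamVectorField (H ∘ phaseCover) (c t)) t) :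
    Φ (phaseCover (c 0)) = phaseCover (c 1) := by
  obtain ⟨e, he, he0⟩ := hΦ.1 (c 0)
  have heq : Set.EqOn e c (Set.Icc 0 1) :=
    ODE_solution_unique (v := fun _ => hamVectorField (H ∘ phaseCover)) (fun _ => hv)
      (fun t _ => (he t).continuousAt.continuousWithinAt)
      (fun t _ => (he t).hasDerivWithinAt)
      (fun t ht => (hc t ht).continuousAt.continuousWithinAt)
      (fun t ht => (hc t ⟨ht.1, ht.2.le⟩).hasDerivWithinAt) he0
  rw [← he0, hΦ.2 e he, heq ⟨zero_le_one, le_rfl⟩]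

/-! ### Bounds on the Hamiltonian vector field of a tensor sum -/

section

variable {α R : ℝ} {A : ℕ → Fin 4 → ℝ} {h : ℕ → Fin 4 → ℝ → ℝ}

theorem lipschitz_tensorSum {N : ℕ} {A : ℕ → Fin N → ℝ} {h : ℕ → Fin N → ℝ → ℝ}
    (hh : ∀ n i, GevreyBound α R (A n i) (h n i))
    (hs : Summable fun n => ∏ i, A n i) (k : Fin N → ℕ) :
    ∃ K : NNReal, LipschitzWith K (tensorSum h k) := by
  set B : ℝ := ∑ j : Fin N, (∑' n, ∏ i, A n i) *
    ∏ i, (R ^ (k + Pi.single j 1 : Fin N → ℕ) i *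
      (((k + Pi.single j 1 : Fin N → ℕ) i)! : ℝ) ^ α) with hB
  refine ⟨B.toNNReal, lipschitzWith_of_nnnorm_fderiv_le (𝕜 := ℝ)
    (fun x => (hasFDerivAt_tensorSum hh hs k x).differentiableAt) fun x => ?_⟩
  rw [← NNReal.coe_le_coe, coe_nnnorm, (hasFDerivAt_tensorSum hh hs k x).fderiv]
  refine le_trans ?_ (Real.le_coe_toNNReal B)
  refine (norm_sum_le _ _).trans (Finset.sum_le_sum fun j _ => ?_)
  rw [norm_smul]
  have hp : ‖(ContinuousLinearMap.proj j : (Fin N → ℝ) →L[ℝ] ℝ)‖ ≤ 1 :=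
    ContinuousLinearMap.opNorm_le_bound _ zero_le_one fun y => by
      rw [one_mul]; exact norm_le_pi_norm y j
  calc _ ≤ ‖tensorSum h (k + Pi.single j 1) x‖ * 1 := by gcongr
    _ ≤ _ := by
      rw [mul_one]
      exact abs_tensorSum_le hh hs _ x

theorem hamVectorField_tensorSum (hh : ∀ n i, GevreyBound α R (A n i) (h n i))
    (hs : Summable fun n => ∏ i, A n i) (x : Fin 4 → ℝ) :
    hamVectorField (tensorSum h 0) x =
      ![tensorSum h (Pi.single 1 1) x, -tensorSum h (Pi.single 0 1) x,
        tensorSum h (Pi.single 3 1) x, -tensorSum h (Pi.single 2 1) x] := by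
  simp only [hamVectorField, pderiv_tensorSum hh hs, zero_add]

theorem exists_lipschitzWith_hamVectorField (hh : ∀ n i, GevreyBound α R (A n i) (h n i))
    (hs : Summable fun n => ∏ i, A n i) :
    ∃ K : NNReal, LipschitzWith K (hamVectorField (tensorSum h 0)) := by
  choose K hK using lipschitz_tensorSum hh hs
  refine ⟨∑ j, K (Pi.single j 1), ?_⟩
  have hle : ∀ j, LipschitzWith (∑ j, K (Pi.single j 1)) (tensorSum h (Pi.single j 1)) :=
    fun j => (hK _).weaken (Finset.single_le_sum
      (f := fun j : Fin 4 => K (Pi.single j 1)) (fun _ _ => zero_le) (Finset.mem_univ j))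
  refine LipschitzWith.of_dist_le_mul fun x y => ?_
  refine (dist_pi_le_iff (by positivity)).2 fun i => ?_
  rw [hamVectorField_tensorSum hh hs, hamVectorField_tensorSum hh hs]
  fin_cases i
  · exact (hle 1).dist_le_mul x y
  · simpa using (hle 0).dist_le_mul x y
  · exact (hle 3).dist_le_mul x y
  · simpa using (hle 2).dist_le_mul x y

theorem exists_norm_hamVectorField_le (hh : ∀ n i, GevreyBound α R (A n i) (h n i))
    (hs : Summable fun n => ∏ i, A n i) :
    ∃ M : ℝ, ∀ x, ‖hamVectorField (tensorSum h 0) x‖ ≤ M := by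
  have h1 := fun k x => abs_tensorSum_le hh hs k x
  set B : (Fin 4 → ℕ) → ℝ := fun k =>
    (∑' n, ∏ i, A n i) * ∏ i, (R ^ k i * ((k i)! : ℝ) ^ α) with hB
  have hB0 : ∀ k, 0 ≤ B k := fun k => (abs_nonneg _).trans (h1 k 0)
  refine ⟨∑ j, B (Pi.single j 1), fun x => ?_⟩
  have hle : ∀ j, |tensorSum h (Pi.single j 1) x| ≤ ∑ j, B (Pi.single j 1) := fun j =>
    (h1 _ x).trans (Finset.single_le_sum (f := fun j : Fin 4 => B (Pi.single j 1))
      (fun _ _ => hB0 _) (Finset.mem_univ j))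
  refine (pi_norm_le_iff_of_nonneg (Finset.sum_nonneg fun _ _ => hB0 _)).2 fun i => ?_
  rw [hamVectorField_tensorSum hh hs]
  fin_cases i
  · exact hle 1
  · simpa using hle 0
  · exact hle 3
  · simpa using hle 2

end

/-! ### Slow periodic orbits of the standard map -/

/-- The force `κ sin (2π x)`, cut off to `0` for `x ≥ 1/2`. -/
def cutForce (κ x : ℝ) : ℝ := κ * max 0 (Real.sin (2 * Real.pi * min x (1 / 2)))

/-- Position and velocity, after `j` steps, of the orbit of the cut-off standard map issued from
the position `0` with velocity `ρ`. -/
def halfOrbit (κ ρ : ℝ) : ℕ → ℝ × ℝ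
  | 0 => (0, ρ)
  | j + 1 =>
    ((halfOrbit κ ρ j).1 + (halfOrbit κ ρ j).2,
      (halfOrbit κ ρ j).2 + cutForce κ ((halfOrbit κ ρ j).1 + (halfOrbit κ ρ j).2))

theorem cutForce_nonneg {κ : ℝ} (hκ : 0 ≤ κ) (x : ℝ) : 0 ≤ cutForce κ x :=
  mul_nonneg hκ (le_max_left _ _)

theorem cutForce_of_mem {κ x : ℝ} (h0 : 0 ≤ x) (h1 : x ≤ 1 / 2) :
    cutForce κ x = κ * Real.sin (2 * Real.pi * x) := by
  rw [cutForce, min_eq_left h1, max_eq_right]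
  have := Real.pi_pos
  exact Real.sin_nonneg_of_nonneg_of_le_pi (by positivity) (by nlinarith)

theorem continuous_halfOrbit (κ : ℝ) (j : ℕ) : Continuous fun ρ => halfOrbit κ ρ j := by
  induction j with
  | zero => exact continuous_const.prodMk continuous_id
  | succ j ih =>
    have h1 : Continuous fun ρ => (halfOrbit κ ρ j).1 + (halfOrbit κ ρ j).2 := by fun_prop
    have hc : Continuous (cutForce κ) := by unfold cutForce; fun_prop
    exact h1.prodMk (ih.snd.add (hc.comp h1))

theorem halfOrbit_zero_velocity (κ : ℝ) (j : ℕ) : halfOrbit κ 0 j = (0, 0) := by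
  induction j with
  | zero => rfl
  | succ j ih => simp [halfOrbit, ih, cutForce]

theorem le_halfOrbit {κ ρ : ℝ} (hκ : 0 ≤ κ) (j : ℕ) :
    j * ρ ≤ (halfOrbit κ ρ j).1 ∧ ρ ≤ (halfOrbit κ ρ j).2 := by
  induction j with
  | zero => simp [halfOrbit]
  | succ j ih =>
    have := cutForce_nonneg hκ ((halfOrbit κ ρ j).1 + (halfOrbit κ ρ j).2)
    simp only [halfOrbit]
    push_cast
    constructor <;> linarith [ih.1, ih.2]

/-- A convex orbit segment of the standard map going from `0` to `1/2` in `m` steps. -/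
theorem exists_half_orbit {κ : ℝ} (hκ : 0 ≤ κ) {m : ℕ} (hm : 1 ≤ m) :
    ∃ e v : ℕ → ℝ, e 0 = 0 ∧ e m = 1 / 2 ∧ (∀ j, e (j + 1) = e j + v j) ∧
      (∀ j, j + 1 ≤ m → v (j + 1) = v j + κ * Real.sin (2 * Real.pi * e (j + 1))) ∧
      (∀ j, 0 ≤ v j) ∧ (∀ j, v j ≤ v (j + 1)) ∧ v 0 ≤ 1 / (2 * m) := by
  have hm' : (1 : ℝ) ≤ m := by exact_mod_cast hm
  -- Shooting in the initial velocity: velocity 0 never leaves 0, velocity 1/2 gets at least to m/2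
  -- in m steps. The cut-off makes the force nonnegative everywhere, and the orbit found lies in [0,
  -- 1/2] up to time m, where the force is the true one.
  have hivt := intermediate_value_Icc (show (0 : ℝ) ≤ 1 / 2 by norm_num)
    (continuous_halfOrbit κ m).fst.continuousOn
  have hmem : (1 / 2 : ℝ) ∈ Set.Icc (halfOrbit κ 0 m).1 (halfOrbit κ (1 / 2) m).1 := by
    rw [halfOrbit_zero_velocity]
    refine ⟨by norm_num, ?_⟩
    have := (le_halfOrbit (ρ := 1 / 2) hκ m).1
    linarith
  obtain ⟨ρ, ⟨hρ0, -⟩, hρ⟩ := hivt hmem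
  have hρ : (halfOrbit κ ρ m).1 = 1 / 2 := hρ
  have hv0 : ∀ j, 0 ≤ (halfOrbit κ ρ j).2 := fun j => hρ0.trans (le_halfOrbit hκ j).2
  have hmono : Monotone fun j => (halfOrbit κ ρ j).1 := monotone_nat_of_le_succ fun j => by
    have := hv0 j
    simp only [halfOrbit]
    linarith
  refine ⟨fun j => (halfOrbit κ ρ j).1, fun j => (halfOrbit κ ρ j).2, rfl, hρ, fun j => rfl,
    fun j hj => ?_, hv0, fun j => ?_, ?_⟩
  · have h1 : (halfOrbit κ ρ (j + 1)).1 ≤ 1 / 2 := (hmono hj).trans hρ.le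
    have h0 : 0 ≤ (halfOrbit κ ρ (j + 1)).1 := hmono (Nat.zero_le (j + 1))
    rw [← cutForce_of_mem h0 h1]
    rfl
  · have := cutForce_nonneg hκ ((halfOrbit κ ρ j).1 + (halfOrbit κ ρ j).2)
    simp only [halfOrbit]
    linarith
  · have := (le_halfOrbit (ρ := ρ) hκ m).1
    rw [hρ] at this
    change ρ ≤ _
    rw [le_div_iff₀ (by positivity)]
    linarith

theorem half_le_sin_two_pi_mul {x : ℝ} (h1 : 1 / 8 ≤ x) (h2 : x ≤ 3 / 8) :
    1 / 2 ≤ Real.sin (2 * Real.pi * x) := by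
  have hpi := Real.pi_pos
  rw [← Real.cos_pi_div_two_sub, ← Real.cos_abs, ← Real.cos_pi_div_three]
  refine Real.cos_le_cos_of_nonneg_of_le_pi (abs_nonneg _) (by linarith) (abs_le.2 ⟨?_, ?_⟩)
  · nlinarith
  · nlinarith

/-- The standard map with parameter `κ` has an orbit that goes from `1/2` to `3/2` in `2 * m` steps,
comes back with the same velocity and stays away from `1/2` and `3/2` in between. -/
theorem exists_standard_orbit {κ : ℝ} (hκ : 0 < κ) (hκ4 : κ ≤ 1 / 4) {m : ℕ} (hm : 1 ≤ m) :
    ∃ y V : ℕ → ℝ, y 0 = 1 / 2 ∧ y (2 * m) = 3 / 2 ∧ V (2 * m) = V 0 ∧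
      (∀ k, k < 2 * m → y (k + 1) = y k + V k) ∧
      (∀ k, k < 2 * m → V (k + 1) = V k + κ * Real.sin (2 * Real.pi * y (k + 1))) ∧
      (∀ k, 0 < k → k < 2 * m → 1 / 2 + √κ / 4 ≤ y k ∧ y k ≤ 3 / 2 - √κ / 4) ∧
      ∀ k, k ≤ 2 * m → 0 ≤ V k ∧ V k ^ 2 ≤ κ + (1 / (2 * m)) ^ 2 := by
  obtain ⟨e, v, e0, em, he, hv, v0, vmono, vρ⟩ := exists_half_orbit hκ.le hm
  obtain ⟨p, rfl⟩ : ∃ p, m = p + 1 := ⟨m - 1, by omega⟩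
  have vm : Monotone v := monotone_nat_of_le_succ vmono
  have emono : Monotone e := monotone_nat_of_le_succ fun j => by
    rw [he]; linarith [v0 j]
  have hsin : ∀ j, j ≤ p + 1 → 0 ≤ Real.sin (2 * Real.pi * e j) ∧
      Real.sin (2 * Real.pi * e j) ≤ 1 := by
    intro j hj
    have h1 : e j ≤ 1 / 2 := (emono hj).trans em.le
    have h0 : 0 ≤ e j := e0.symm.le.trans (emono (Nat.zero_le j))
    have := Real.pi_pos
    exact ⟨Real.sin_nonneg_of_nonneg_of_le_pi (by positivity) (by nlinarith), Real.sin_le_one _⟩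
  -- Discrete energy: v_{j+1}² - v_j² = κ (v_{j+1} + v_j) sin(2π e_{j+1}) and v_{j+1} + v_j =
  -- e_{j+2} - e_j, so bounding the sine by 1 gives a telescoping sum.
  have hupper : ∀ j, j ≤ p → v j ^ 2 ≤ v 0 ^ 2 + κ * (e (j + 1) + e j) := by
    intro j
    induction j with
    | zero =>
      intro _
      have : 0 ≤ e 1 := e0.symm.le.trans (emono (Nat.zero_le 1))
      rw [zero_add, e0]
      nlinarith
    | succ j ih =>
      intro hj
      have ih' := ih (by omega)
      have hs := hsin (j + 1) (by omega)
      have h1 := hv j (by omega)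
      have h2 : v (j + 1) ^ 2 - v j ^ 2 ≤ κ * (v (j + 1) + v j) := by
        have : v (j + 1) ^ 2 - v j ^ 2 =
            (κ * (v (j + 1) + v j)) * Real.sin (2 * Real.pi * e (j + 1)) := by
          linear_combination (v (j + 1) + v j) * h1
        rw [this]
        exact mul_le_of_le_one_right (mul_nonneg hκ.le (add_nonneg (v0 _) (v0 _))) hs.2
      have h3 := he j
      have h4 := he (j + 1)
      have h5 : κ * (v (j + 1) + v j) = κ * (e (j + 1 + 1) + e (j + 1)) - κ * (e (j + 1) + e j) := by
        rw [h4, h3]; ring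
      linarith
  set σ := v p with hσ
  have hvσ : ∀ j, j ≤ p → v j ≤ σ := fun j hj => vm hj
  -- The same energy, counting only the gain on [1/8, 3/8], where the sine is at least 1/2; the loss
  -- σ pays for the step that enters this interval.
  have hlower : ∀ j, j ≤ p → κ / 2 * (min (e (j + 1)) (3 / 8) - 1 / 8 - σ) ≤ v j ^ 2 := by
    intro j
    induction j with
    | zero =>
      intro hj
      have h1 := hvσ 0 hj
      have h2 : e 1 = v 0 := by rw [← zero_add 1, he, e0, zero_add]
      have h3 := min_le_left (e 1) (3 / 8)
      rw [zero_add]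
      nlinarith [sq_nonneg (v 0)]
    | succ j ih =>
      intro hj
      have ih' := ih (by omega)
      have hs := hsin (j + 1) (by omega)
      have h1 := hv j (by omega)
      have h4 := he (j + 1)
      have hvj := hvσ (j + 1) hj
      have hv1 := v0 (j + 1)
      have hv2 := v0 j
      have h6 := min_le_left (e (j + 1 + 1)) (3 / 8)
      have h7 := min_le_right (e (j + 1 + 1)) (3 / 8)
      rcases lt_or_ge (e (j + 1)) (1 / 8) with hlt | hge
      · have : min (e (j + 1 + 1)) (3 / 8) - 1 / 8 - σ ≤ 0 := by linarith
        nlinarith [sq_nonneg (v (j + 1))]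
      · rcases le_or_gt (e (j + 1)) (3 / 8) with hle | hgt
        · have hhalf := half_le_sin_two_pi_mul hge hle
          rw [min_eq_left hle] at ih'
          have h2 : v (j + 1) ^ 2 - v j ^ 2 =
              (κ * (v (j + 1) + v j)) * Real.sin (2 * Real.pi * e (j + 1)) := by
            linear_combination (v (j + 1) + v j) * h1
          have h3 : κ * (v (j + 1) + v j) * (1 / 2) ≤
              (κ * (v (j + 1) + v j)) * Real.sin (2 * Real.pi * e (j + 1)) :=
            mul_le_mul_of_nonneg_left hhalf (mul_nonneg hκ.le (add_nonneg hv1 hv2))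
          have h5 : κ / 2 * (min (e (j + 1 + 1)) (3 / 8) - 1 / 8 - σ) ≤
              κ / 2 * (e (j + 1) - 1 / 8 - σ) + κ / 2 * v (j + 1) := by
            rw [← mul_add]
            refine mul_le_mul_of_nonneg_left ?_ (by positivity)
            linarith
          have h8 : 0 ≤ κ * v j := mul_nonneg hκ.le hv2
          linarith
        · rw [min_eq_right hgt.le] at ih'
          have h2 : v j ^ 2 ≤ v (j + 1) ^ 2 := pow_le_pow_left₀ hv2 (vmono j) 2
          have h5 : κ / 2 * (min (e (j + 1 + 1)) (3 / 8) - 1 / 8 - σ) ≤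
              κ / 2 * (3 / 8 - 1 / 8 - σ) :=
            mul_le_mul_of_nonneg_left (by linarith) (by positivity)
          linarith
  -- The last step σ is the distance from 1/2 to the nearest earlier point; this bound dictates the
  -- width of the bump in θ₁.
  have hσlow : √κ / 4 ≤ σ := by
    have h1 := hlower p le_rfl
    rw [em, min_eq_right (by norm_num)] at h1
    have hsq : √κ ^ 2 = κ := Real.sq_sqrt hκ.le
    have hs0 := Real.sqrt_nonneg κ
    rcases le_or_gt σ (1 / 8) with hle | hgt
    · refine le_of_sq_le_sq ?_ (v0 p)
      have : κ / 2 * (1 / 8) ≤ κ / 2 * (3 / 8 - 1 / 8 - σ) :=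
        mul_le_mul_of_nonneg_left (by linarith) (by positivity)
      rw [div_pow, hsq]
      linarith
    · have : √κ ≤ 1 / 2 := by
        rw [Real.sqrt_le_left (by norm_num)]
        linarith
      linarith
  have hep : e p = 1 / 2 - σ := by
    have := he p
    rw [em] at this
    linarith
  have hσup : σ ^ 2 ≤ κ + (1 / (2 * ((p + 1 : ℕ) : ℝ))) ^ 2 := by
    have h1 := hupper p le_rfl
    have h2 : v 0 ^ 2 ≤ (1 / (2 * ((p + 1 : ℕ) : ℝ))) ^ 2 := pow_le_pow_left₀ (v0 0) vρ 2
    rw [em, hep] at h1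
    have h3 : κ * (1 / 2 + (1 / 2 - σ)) ≤ κ * 1 :=
      mul_le_mul_of_nonneg_left (by linarith [v0 p]) hκ.le
    linarith
  have hVbound : ∀ j, j ≤ p → 0 ≤ v j ∧ v j ^ 2 ≤ κ + (1 / (2 * ((p + 1 : ℕ) : ℝ))) ^ 2 :=
    fun j hj => ⟨v0 j, (pow_le_pow_left₀ (v0 j) (hvσ j hj) 2).trans hσup⟩
  -- The symmetry y ↦ 2 - y reverses the standard map: the half orbit, run backwards on the left of
  -- 1 and forwards on its right, makes a full turn with middle point 1.
  obtain ⟨y, y1, y2⟩ : ∃ y : ℕ → ℝ, (∀ k, k ≤ p + 1 → y k = 1 - e (p + 1 - k)) ∧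
      ∀ k, p + 1 < k → y k = 1 + e (k - (p + 1)) :=
    ⟨fun k => if k ≤ p + 1 then 1 - e (p + 1 - k) else 1 + e (k - (p + 1)),
      fun k hk => if_pos hk, fun k hk => if_neg hk.not_ge⟩
  -- `V k` is the velocity with which `y k` is left. The value `v p` occurs at both times 2p + 1 and
  -- 2p + 2, since the force vanishes at 3/2.
  obtain ⟨V, V1, V2, V3⟩ : ∃ V : ℕ → ℝ, (∀ k, k ≤ p → V k = v (p - k)) ∧
      (∀ k, p < k → k ≤ 2 * p + 1 → V k = v (k - (p + 1))) ∧ ∀ k, 2 * p + 1 < k → V k = v p := by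
    refine ⟨fun k => if k ≤ p then v (p - k) else if k ≤ 2 * p + 1 then v (k - (p + 1)) else v p,
      fun k hk => if_pos hk, fun k hk hk' => ?_, fun k hk => ?_⟩
    · simp only
      rw [if_neg hk.not_ge, if_pos hk']
    · simp only
      rw [if_neg (by omega), if_neg hk.not_ge]
  refine ⟨y, V, ?_, ?_, ?_, ?_, ?_, ?_, ?_⟩
  · rw [y1 0 (by omega), Nat.sub_zero, em]; norm_num
  · rw [y2 _ (by omega), show 2 * (p + 1) - (p + 1) = p + 1 by omega, em]; norm_num
  · rw [V3 _ (by omega), V1 0 (by omega), Nat.sub_zero]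
  · intro k hk
    rcases lt_trichotomy k (p + 1) with h | h | h
    · rw [y1 _ (by omega), y1 k (by omega), V1 k (by omega),
        show p + 1 - k = (p - k) + 1 by omega, he, show p + 1 - (k + 1) = p - k by omega]
      ring
    · rw [h, y2 _ (by omega), y1 _ le_rfl, V2 _ (by omega) (by omega),
        show p + 1 + 1 - (p + 1) = 0 + 1 by omega, he, Nat.sub_self, e0]
      ring
    · rw [y2 _ (by omega), y2 k h, V2 k (by omega) (by omega),
        show k + 1 - (p + 1) = (k - (p + 1)) + 1 by omega, he]
      ring
  · intro k hk
    rcases lt_trichotomy k p with h | h | h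
    · rw [V1 _ (by omega), V1 k (by omega), y1 _ (by omega),
        show p - k = (p - (k + 1)) + 1 by omega, hv _ (by omega),
        show p + 1 - (k + 1) = p - (k + 1) + 1 by omega,
        show 2 * Real.pi * (1 - e (p - (k + 1) + 1)) =
          2 * Real.pi - 2 * Real.pi * e (p - (k + 1) + 1) by ring, Real.sin_two_pi_sub]
      ring
    · rw [h, V2 _ (by omega) (by omega), V1 _ le_rfl, y1 _ le_rfl, Nat.sub_self,
        Nat.sub_self, e0]
      simp
    · rcases eq_or_ne k (2 * p + 1) with h' | h'
      · rw [h', V3 _ (by omega), V2 _ (by omega) le_rfl, y2 _ (by omega),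
          show 2 * p + 1 + 1 - (p + 1) = p + 1 by omega, em,
          show 2 * p + 1 - (p + 1) = p by omega,
          show 2 * Real.pi * (1 + 1 / 2) = Real.pi + 2 * Real.pi by ring,
          Real.sin_add_two_pi, Real.sin_pi]
        ring
      · rw [V2 _ (by omega) (by omega), V2 k (by omega) (by omega), y2 _ (by omega),
          show k + 1 - (p + 1) = (k - (p + 1)) + 1 by omega, hv _ (by omega),
          show 2 * Real.pi * (1 + e (k - (p + 1) + 1)) =
            2 * Real.pi * e (k - (p + 1) + 1) + 2 * Real.pi by ring, Real.sin_add_two_pi]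
  · intro k hk0 hk
    have hpos : ∀ j, 0 ≤ e j := fun j => e0.symm.le.trans (emono (Nat.zero_le j))
    have hle : ∀ j, j ≤ p → e j ≤ 1 / 2 - √κ / 4 := fun j hj => by
      have := emono hj
      linarith
    have hs0 : √κ / 4 ≤ 1 / 2 := by linarith [hpos p]
    rcases le_or_gt k (p + 1) with h | h
    · have h1 := hle (p + 1 - k) (by omega)
      have h2 := hpos (p + 1 - k)
      rw [y1 k h]
      constructor <;> linarith
    · have h1 := hle (k - (p + 1)) (by omega)
      have h2 := hpos (k - (p + 1))
      rw [y2 k h]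
      constructor <;> linarith
  · intro k _
    rcases le_or_gt k p with h | h
    · rw [V1 k h]
      exact hVbound _ (by omega)
    · rcases le_or_gt k (2 * p + 1) with h' | h'
      · rw [V2 k h h']
        exact hVbound _ (by omega)
      · rw [V3 k h']
        exact hVbound _ le_rfl

/-! ### Trains of bumps -/

open Classical in
/-- The sum over the integers `p` satisfying `χ` of the translates `b (s - p / Q)`, for a function
`b` supported in `(-1 / (2 * Q), 1 / (2 * Q))`. -/
def train (Q : ℕ) (χ : ℤ → Prop) (b : ℝ → ℝ) (s : ℝ) : ℝ :=
  if χ (round (Q * s)) then b (s - round (Q * s) / Q) else 0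

theorem round_eq_of_abs_sub_lt {x : ℝ} {p : ℤ} (h : |x - p| < 1 / 2) : round x = p := by
  rw [round_eq, Int.floor_eq_iff]
  have := abs_lt.1 h
  constructor <;> linarith

section

variable {Q : ℕ} {χ : ℤ → Prop} {b : ℝ → ℝ} {w : ℝ}

theorem abs_mul_sub_eq (hQ : 0 < Q) (s : ℝ) (p : ℤ) : |Q * s - p| = Q * |s - p / Q| := by
  have hQ' : (0 : ℝ) < Q := by exact_mod_cast hQ
  rw [← abs_of_pos hQ', ← abs_mul, abs_of_pos hQ', mul_sub, mul_div_cancel₀ _ hQ'.ne']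

theorem train_apply (hQ : 0 < Q) {p : ℤ} {s : ℝ} (hs : |s - p / Q| < 1 / (2 * Q)) (hp : χ p) :
    train Q χ b s = b (s - p / Q) := by
  have hQ' : (0 : ℝ) < Q := by exact_mod_cast hQ
  have hr : round (Q * s) = p := by
    refine round_eq_of_abs_sub_lt ?_
    rw [abs_mul_sub_eq hQ]
    rw [lt_div_iff₀ (by positivity)] at hs
    linarith
  rw [train, hr, if_pos hp]

theorem train_apply_of_not (hQ : 0 < Q) {p : ℤ} {s : ℝ} (hs : |s - p / Q| < 1 / (2 * Q))
    (hp : ¬ χ p) : train Q χ b s = 0 := by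
  have hQ' : (0 : ℝ) < Q := by exact_mod_cast hQ
  have hr : round (Q * s) = p := by
    refine round_eq_of_abs_sub_lt ?_
    rw [abs_mul_sub_eq hQ]
    rw [lt_div_iff₀ (by positivity)] at hs
    linarith
  rw [train, hr, if_neg hp]

theorem eventually_abs_sub_lt {s a r : ℝ} (h : |s - a| < r) : ∀ᶠ x in 𝓝 s, |x - a| < r :=
  (continuous_abs.comp (continuous_id.sub continuous_const)).continuousAt.eventually_lt_const h

theorem eventually_lt_abs_sub {s a r : ℝ} (h : r < |s - a|) : ∀ᶠ x in 𝓝 s, r < |x - a| :=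
  (continuous_abs.comp (continuous_id.sub continuous_const)).continuousAt.eventually_const_lt h

theorem train_eventuallyEq (hQ : 0 < Q) {p : ℤ} {s : ℝ} (hs : |s - p / Q| < 1 / (2 * Q))
    (hp : χ p) : train Q χ b =ᶠ[𝓝 s] fun x => b (x - p / Q) := by
  filter_upwards [eventually_abs_sub_lt hs] with x hx using train_apply hQ hx hp

/-- The delicate points are the cell boundaries, where `round` jumps. There every centre is at least
1 / (2Q) > w away, and a distance of at least w persists nearby. -/
theorem train_eventuallyEq_zero (hQ : 0 < Q) (hb : ∀ x, w ≤ |x| → b x = 0)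
    (hw : w < 1 / (2 * Q)) {s : ℝ} (hs : ∀ j, χ j → w < |s - j / Q|) :
    train Q χ b =ᶠ[𝓝 s] fun _ => 0 := by
  have hQ' : (0 : ℝ) < Q := by exact_mod_cast hQ
  set p := round (Q * s) with hp
  rcases lt_or_ge |s - p / Q| (1 / (2 * Q)) with h | h
  · by_cases hχ : χ p
    · filter_upwards [train_eventuallyEq (b := b) hQ h hχ, eventually_lt_abs_sub (hs p hχ)]
        with x hx hx'
      rw [hx, hb _ hx'.le]
    · filter_upwards [eventually_abs_sub_lt h] with x hx using train_apply_of_not hQ hx hχ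
  · have hall : ∀ j : ℤ, 1 / (2 * Q) ≤ |s - j / Q| := by
      intro j
      refine h.trans ?_
      have := round_le (Q * s) j
      rw [← hp, abs_mul_sub_eq hQ, abs_mul_sub_eq hQ] at this
      exact le_of_mul_le_mul_left this hQ'
    filter_upwards [Metric.ball_mem_nhds s (sub_pos.2 hw)] with x hx
    rw [train]
    split_ifs
    · refine hb _ ?_
      have h1 := hall (round (Q * x))
      rw [Metric.mem_ball, Real.dist_eq] at hx
      have h2 := abs_sub_le s x ((round (Q * x) : ℤ) / Q)
      rw [abs_sub_comm s x] at h2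
      linarith
    · rfl

/-- Near each point the train is 0 or a single translate of b, so the amplitude does not grow with
the number of bumps. -/
theorem GevreyBound.train {α R A : ℝ} (hg : GevreyBound α R A b) (hR : 0 ≤ R) (hQ : 0 < Q)
    (hb : ∀ x, w ≤ |x| → b x = 0) (hw : w < 1 / (2 * Q)) :
    GevreyBound α R A (train Q χ b) := by
  refine hg.of_locally hR fun s => ?_
  by_cases hs : ∃ p, χ p ∧ |s - p / Q| < 1 / (2 * Q)
  · obtain ⟨p, hp, hs⟩ := hs
    exact Or.inr ⟨_, train_eventuallyEq hQ hs hp⟩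
  · push Not at hs
    exact Or.inl (train_eventuallyEq_zero hQ hb hw fun j hj => hw.trans_le (hs j hj))

theorem train_periodic (hQ : 0 < Q) (hχ : ∀ p : ℤ, χ (p + Q) ↔ χ p) :
    Function.Periodic (train Q χ b) 1 := by
  intro s
  have hQ' : (Q : ℝ) ≠ 0 := by exact_mod_cast hQ.ne'
  have hr : round ((Q : ℝ) * (s + 1)) = round ((Q : ℝ) * s) + Q := by
    rw [mul_add, mul_one, round_add_natCast]
  have ha : s + 1 - ((round ((Q : ℝ) * s) + Q : ℤ) : ℝ) / Q = s - (round ((Q : ℝ) * s) : ℝ) / Q := by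
    push_cast
    field_simp
    ring
  have hiff : χ (round ((Q : ℝ) * (s + 1))) ↔ χ (round ((Q : ℝ) * s)) := by rw [hr, hχ]
  by_cases h : χ (round ((Q : ℝ) * s))
  · rw [train, train, if_pos h, if_pos (hiff.2 h), hr, ha]
  · rw [train, train, if_neg h, if_neg (mt hiff.1 h)]

end

/-! ### The choice of the parameters -/

/-- The parameters attached to the resonances of order `Q`: the strength `κ` of the standard map,
its half period `m`, a bump `b` of width `1 / (Q log Q)` and a bump `f` of width `√κ / (8 Q)`. -/
structure ResonanceData (α R δ C : ℝ) (Q : ℕ) where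
  κ : ℝ
  m : ℕ
  b : ℝ → ℝ
  f : ℝ → ℝ
  Ab : ℝ
  Af : ℝ
  le_Q : 16 ≤ Q
  two_lt_log : 2 < Real.log Q
  κ_pos : 0 < κ
  κ_le : κ ≤ 1 / 4
  Q_le_m : Q ≤ m
  -- This keeps V / Q below half the width of the zone, where the bump b equals 1.
  speed : κ + (1 / (2 * (m : ℝ))) ^ 2 < (1 / (2 * Real.log Q)) ^ 2
  b_bound : GevreyBound α R Ab b
  b_one : ∀ x, |x| ≤ 1 / (Q * Real.log Q) / 2 → b x = 1
  b_zero : ∀ x, 1 / (Q * Real.log Q) ≤ |x| → b x = 0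
  f_bound : GevreyBound α R Af f
  f_one : ∀ x, |x| ≤ √κ / (8 * Q) / 2 → f x = 1
  f_zero : ∀ x, √κ / (8 * Q) ≤ |x| → f x = 0
  u_small : κ / (2 * Real.pi * Q ^ 2) *
    Real.exp (α * (2 * Real.pi * Q / R) ^ (1 / α)) * Ab ≤ δ
  v_small : Af * Ab * (1 / (2 * m * (2 * Real.pi * Q)) *
    Real.exp (α * (2 * Real.pi * Q / R) ^ (1 / α))) ≤ δ
  -- A turn takes 2m steps and 2m turns raise r₂ by 1; the 2 absorbs rounding errors.
  time : ((2 * m : ℕ) : ℝ) ^ 2 * (Estar C (1 / (α - 1)) (2 * (4 / Q)) + 2) ≤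
    Estar C (1 / (α - 1)) (4 / Q)

theorem div_abs_log_rpow {γ a x : ℝ} (ha : 0 < a) (hx : a < x) :
    (a / x / |Real.log (a / x)|) ^ (-γ) = (x / a * Real.log (x / a)) ^ γ := by
  have hx0 : 0 < x := ha.trans hx
  have hlog : 0 < Real.log (x / a) := Real.log_pos (by rwa [one_lt_div ha])
  have h1 : Real.log (a / x) = -Real.log (x / a) := by rw [← Real.log_inv, inv_div]
  rw [h1, abs_neg, abs_of_pos hlog, Real.rpow_neg (by positivity), ← Real.inv_rpow (by positivity)]
  congr 1
  field_simp

theorem eventually_exp_exp_time {τ : ℝ} (hτ : τ < 1) :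
    ∀ᶠ a : ℝ in Filter.atTop, 4 + 3 * Real.exp (τ * a) ≤ Real.exp a := by
  have h1 : Filter.Tendsto (fun a : ℝ => Real.exp ((1 - τ) * a)) Filter.atTop Filter.atTop :=
    Real.tendsto_exp_atTop.comp (Filter.tendsto_id.const_mul_atTop (by linarith))
  filter_upwards [h1.eventually_ge_atTop 4, Real.tendsto_exp_atTop.eventually_ge_atTop 16]
    with a h2 h3
  have h4 : Real.exp a = Real.exp ((1 - τ) * a) * Real.exp (τ * a) := by
    rw [← Real.exp_add]; congr 1; ring
  have h5 := Real.exp_pos (τ * a)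
  nlinarith

/-- Let a = C ((Q/4) log(Q/4))^γ, so that E*(4/Q) = exp(exp a), and X = exp(exp(τa)) with τ =
max(1/2, 2^(-γ)). The constant C is such that cW ≤ a/2, whence m ≤ 2X; also E*(8/Q) ≤ X. The left
side is then at most 48 X³ ≤ exp(4 + 3 exp(τa)). -/
theorem estar_time {C γ c W : ℝ} {Q m : ℕ} (hγ : 0 < γ) (hQ : 16 ≤ Q)
    (hW : W = (Q * Real.log Q) ^ γ) (hc : 0 < c) (hC : C = 2 * c * 8 ^ γ)
    (hm : (m : ℝ) ≤ 2 * Real.exp (Real.exp (c * W)))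
    (ha : ∀ a, 2 * c * W ≤ a →
      4 + 3 * Real.exp (max (1 / 2) (2 ^ (-γ)) * a) ≤ Real.exp a) :
    ((2 * m : ℕ) : ℝ) ^ 2 * (Estar C γ (2 * (4 / Q)) + 2) ≤ Estar C γ (4 / Q) := by
  have hQ' : (16 : ℝ) ≤ Q := by exact_mod_cast hQ
  have hQ0 : (0 : ℝ) < Q := by linarith
  have hlogQ : 0 < Real.log Q := Real.log_pos (by linarith)
  have hC0 : 0 < C := by rw [hC]; positivity
  set y : ℝ := Q / 4 * Real.log (Q / 4) with hy
  have hlog4 : Real.log Q / 2 ≤ Real.log (Q / 4) := by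
    rw [Real.log_div hQ0.ne' (by norm_num)]
    have h1 : Real.log 16 ≤ Real.log Q := Real.log_le_log (by norm_num) hQ'
    have h2 : Real.log 16 = 2 * Real.log 4 := by
      rw [show (16 : ℝ) = 4 ^ 2 by norm_num, Real.log_pow]; norm_num
    linarith
  have hlog40 : 0 < Real.log (Q / 4) := by linarith
  have hy0 : 0 < y := by positivity
  have hlog8 : 0 < Real.log (Q / 8) := Real.log_pos (by linarith)
  have hy8 : (Q : ℝ) * Real.log Q ≤ 8 * y := by
    rw [hy]
    nlinarith
  have hy2 : (Q : ℝ) / 8 * Real.log (Q / 8) ≤ y / 2 := by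
    have : Real.log (Q / 8) ≤ Real.log (Q / 4) := Real.log_le_log (by positivity) (by linarith)
    rw [hy]
    nlinarith
  set a : ℝ := C * y ^ γ with haa
  have e1 : Estar C γ (4 / Q) = Real.exp (Real.exp a) := by
    rw [Estar, E, div_abs_log_rpow (by norm_num) (by linarith)]
  have e2 : Estar C γ (2 * (4 / Q)) ≤ Real.exp (Real.exp (2 ^ (-γ) * a)) := by
    rw [Estar, E, show 2 * (4 / (Q : ℝ)) = 8 / Q by ring,
      div_abs_log_rpow (by norm_num) (by linarith), Real.exp_le_exp, Real.exp_le_exp, haa]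
    have h1 := Real.rpow_le_rpow (by positivity) hy2 hγ.le
    rw [Real.div_rpow hy0.le (by norm_num)] at h1
    rw [Real.rpow_neg (by norm_num)]
    calc C * ((Q : ℝ) / 8 * Real.log (Q / 8)) ^ γ ≤ C * (y ^ γ / 2 ^ γ) := by gcongr
      _ = _ := by ring
  have hWa : 2 * c * W ≤ a := by
    have h1 := Real.rpow_le_rpow (by positivity) hy8 hγ.le
    rw [Real.mul_rpow (by norm_num) hy0.le, ← hW] at h1
    rw [haa, hC]
    calc 2 * c * W ≤ 2 * c * (8 ^ γ * y ^ γ) := by gcongr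
      _ = _ := by ring
  have hfin := ha a hWa
  have ha0 : 0 ≤ a := by positivity
  set τ := max (1 / 2 : ℝ) (2 ^ (-γ)) with hτ
  have t1 : Real.exp (c * W) ≤ Real.exp (τ * a) := by
    rw [Real.exp_le_exp]
    have := mul_le_mul_of_nonneg_right (le_max_left (1 / 2 : ℝ) (2 ^ (-γ))) ha0
    linarith
  have t2 : Real.exp (2 ^ (-γ) * a) ≤ Real.exp (τ * a) := by
    rw [Real.exp_le_exp]
    exact mul_le_mul_of_nonneg_right (le_max_right (1 / 2 : ℝ) (2 ^ (-γ))) ha0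
  set X := Real.exp (Real.exp (τ * a)) with hX
  have hX1 : 1 ≤ X := Real.one_le_exp (Real.exp_pos _).le
  have m1 : (m : ℝ) ≤ 2 * X := hm.trans (by
    have := Real.exp_le_exp.2 t1
    linarith)
  have m2 : Estar C γ (2 * (4 / Q)) ≤ X := e2.trans (Real.exp_le_exp.2 t2)
  rw [e1]
  have e4 : (48 : ℝ) ≤ Real.exp 4 := by
    have h1 := Real.exp_one_gt_d9
    have h2 : Real.exp 4 = Real.exp 1 ^ 4 := by rw [← Real.exp_nat_mul]; norm_num
    rw [h2]
    have h3 : (2.7 : ℝ) ^ 4 ≤ Real.exp 1 ^ 4 := pow_le_pow_left₀ (by norm_num) (by linarith) 4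
    have h4 : (48 : ℝ) ≤ 2.7 ^ 4 := by norm_num
    linarith
  have hE0 : 0 ≤ Estar C γ (2 * (4 / Q)) := (Real.exp_pos _).le
  have hpow : ((2 * m : ℕ) : ℝ) ^ 2 ≤ 16 * X ^ 2 := by
    have : ((2 * m : ℕ) : ℝ) ≤ 4 * X := by push_cast; linarith
    calc ((2 * m : ℕ) : ℝ) ^ 2 ≤ (4 * X) ^ 2 := pow_le_pow_left₀ (by positivity) this 2
      _ = _ := by ring
  calc ((2 * m : ℕ) : ℝ) ^ 2 * (Estar C γ (2 * (4 / Q)) + 2) ≤ (16 * X ^ 2) * (3 * X) := by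
        gcongr
        linarith
    _ = 48 * X ^ 3 := by ring
    _ ≤ Real.exp 4 * X ^ 3 := by gcongr
    _ = Real.exp (4 + 3 * Real.exp (τ * a)) := by
        rw [hX, ← Real.exp_nat_mul, ← Real.exp_add]; norm_num
    _ ≤ _ := Real.exp_le_exp.2 hfin

theorem tendsto_resonance_weight {γ : ℝ} (hγ : 0 < γ) :
    Filter.Tendsto (fun Q : ℕ => ((Q : ℝ) * Real.log Q) ^ γ) Filter.atTop Filter.atTop :=
  (tendsto_rpow_atTop hγ).comp
    ((tendsto_natCast_atTop_atTop).atTop_mul_atTop₀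
      (Real.tendsto_log_atTop.comp tendsto_natCast_atTop_atTop))

theorem eventually_cube_le_exp {γ : ℝ} (hγ : 0 < γ) :
    ∀ᶠ Q : ℕ in Filter.atTop, 16 * (Q : ℝ) ^ 3 ≤ Real.exp ((Q : ℝ) ^ γ) := by
  have h1 : Filter.Tendsto (fun Q : ℕ => (Q : ℝ) ^ γ) Filter.atTop Filter.atTop :=
    (tendsto_rpow_atTop hγ).comp tendsto_natCast_atTop_atTop
  have h2 := ((tendsto_exp_div_rpow_atTop (3 / γ)).comp h1).eventually_ge_atTop 16
  filter_upwards [h2, Filter.eventually_gt_atTop 0] with Q hQ hQ0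
  have hQ0' : (0 : ℝ) < Q := by exact_mod_cast hQ0
  simp only [Function.comp_apply] at hQ
  rw [← Real.rpow_mul hQ0'.le, mul_div_cancel₀ _ hγ.ne', le_div_iff₀ (by positivity)] at hQ
  exact_mod_cast hQ

theorem speed_bound {Q m κ : ℝ} (hQ' : 16 ≤ Q) (hQm' : Q ≤ m)
    (hκQ : κ ≤ 1 / (16 * Q ^ 2)) (hlog0 : 0 < Real.log Q) :
    κ + (1 / (2 * m)) ^ 2 < (1 / (2 * Real.log Q)) ^ 2 := by
  have hQ0 : 0 < Q := by linarith
  have hm0 : 0 < m := by linarith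
  have h1 : (1 / (2 * m)) ^ 2 ≤ 1 / (4 * Q ^ 2) := by
    rw [div_pow, one_pow]
    refine one_div_le_one_div_of_le (by positivity) ?_
    have : Q ^ 2 ≤ m ^ 2 := pow_le_pow_left₀ hQ0.le hQm' 2
    nlinarith
  have h2 : Real.log Q ≤ Q / 2 := by
    have h4 : Real.log Q = 2 * Real.log (√Q) := by
      rw [Real.log_sqrt hQ0.le]; ring
    have h5 := Real.log_le_sub_one_of_pos (Real.sqrt_pos.2 hQ0)
    have h6 : √Q * √Q = Q := Real.mul_self_sqrt hQ0.le
    nlinarith [sq_nonneg (√Q - 2)]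
  have h3 : 1 / Q ^ 2 ≤ (1 / (2 * Real.log Q)) ^ 2 := by
    rw [div_pow, one_pow]
    refine one_div_le_one_div_of_le (by positivity) ?_
    exact pow_le_pow_left₀ (by positivity) (by linarith) 2
  have h4 : κ + (1 / (2 * m)) ^ 2 ≤ (5 / 16) * (1 / Q ^ 2) := by
    have e1 : 1 / (16 * Q ^ 2) = 1 / 16 * (1 / Q ^ 2) := by field_simp
    have e2 : 1 / (4 * Q ^ 2) = 1 / 4 * (1 / Q ^ 2) := by field_simp
    linarith
  have h5 : 0 < 1 / Q ^ 2 := by positivity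
  linarith

-- All sizes are expressed through W = (Q log Q)^γ. The bump in r₁ costs exp(c₁W) and the
-- trigonometric factors exp(c₂W); κ = Q exp(-c₃W) pays for both and leaves exp(-W). The bump in θ₁
-- then costs at most exp(c₁ exp(c₄W)), and m, about exp(exp(c₅W)), pays for it because c₅ exceeds
-- c₄ by 1.
set_option maxHeartbeats 600000 in
theorem exists_resonanceData {α R : ℝ} (hα : 1 < α) (hR : 0 < R) :
    ∃ C : ℝ, 0 < C ∧ ∀ δ : ℝ, 0 < δ →
      ∀ᶠ Q : ℕ in Filter.atTop, Nonempty (ResonanceData α R δ C Q) := by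
  obtain ⟨c₁, hc₁, hbump⟩ := exists_gevreyBound_bump hα hR
  set γ : ℝ := 1 / (α - 1) with hγdef
  have hα1 : 0 < α - 1 := by linarith
  have hα0 : 0 < α := by linarith
  have hγ : 0 < γ := by positivity
  -- A sine of frequency Q costs exp(O(Q^(1/α))); this inequality makes that cost at most
  -- exponential in W.
  have hγα : 1 / α ≤ γ := one_div_le_one_div_of_le hα1 (by linarith)
  set c₂ : ℝ := α * (2 * Real.pi / R) ^ (1 / α) with hc₂
  have hc₂0 : 0 ≤ c₂ := by have := Real.pi_pos; positivity
  clear_value c₂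
  set c₃ : ℝ := c₁ + c₂ + 1 with hc₃
  have hc₃1 : 1 ≤ c₃ := by linarith
  set c₄ : ℝ := γ * (c₃ / 2 + 1) with hc₄
  have hc₄0 : 0 < c₄ := by positivity
  set c₅ : ℝ := c₄ + 1 with hc₅
  have hc₅0 : 0 < c₅ := by positivity
  clear_value c₃ c₄ c₅
  refine ⟨2 * c₅ * 8 ^ γ, by positivity, fun δ hδ => ?_⟩
  set τ := max (1 / 2 : ℝ) (2 ^ (-γ)) with hτ
  have hτ1 : τ < 1 := max_lt (by norm_num)
    (Real.rpow_lt_one_of_one_lt_of_neg (by norm_num) (by linarith))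
  obtain ⟨a₀, ha₀⟩ := Filter.eventually_atTop.1 (eventually_exp_exp_time hτ1)
  have hexp : ∀ᶠ W : ℝ in Filter.atTop, c₁ + c₃ * W ≤ Real.exp W := by
    have h1 := (Real.tendsto_exp_div_pow_atTop 1).eventually_ge_atTop (c₁ + c₃)
    filter_upwards [h1, Filter.eventually_ge_atTop 1] with W hW hW1
    rw [pow_one, le_div_iff₀ (by linarith)] at hW
    nlinarith
  have hTW := tendsto_resonance_weight hγ
  filter_upwards [hTW.eventually_ge_atTop (a₀ / (2 * c₅)), hTW.eventually_ge_atTop (-Real.log δ),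
    hTW.eventually hexp, eventually_cube_le_exp hγ, Filter.eventually_ge_atTop 16,
    (Real.tendsto_log_atTop.comp tendsto_natCast_atTop_atTop).eventually_gt_atTop 2]
    with Q hWa hWδ hWexp hcube hQ16 hlog
  simp only [Function.comp_apply] at hlog
  have hQ' : (16 : ℝ) ≤ Q := by exact_mod_cast hQ16
  have hQ0 : (0 : ℝ) < Q := by linarith
  have hpi := Real.pi_gt_three
  set w : ℝ := 1 / (Q * Real.log Q) with hw
  have hlog0 : 0 < Real.log Q := by linarith
  have hw0 : 0 < w := by positivity
  have hw1 : w ≤ 1 := by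
    rw [hw, div_le_one (by positivity)]
    exact one_le_mul_of_one_le_of_one_le (by linarith) (by linarith)
  set W : ℝ := (Q * Real.log Q) ^ γ with hW
  have hwW : w ^ (-γ) = W := by
    rw [hw, Real.rpow_neg (by positivity), ← Real.inv_rpow (by positivity), one_div, inv_inv]
  have hQγW : (Q : ℝ) ^ γ ≤ W := Real.rpow_le_rpow hQ0.le
    (le_mul_of_one_le_right hQ0.le (by linarith)) hγ.le
  have hQγ1 : 1 ≤ (Q : ℝ) ^ γ := Real.one_le_rpow (by linarith) hγ.le
  have hW1 : 1 ≤ W := hQγ1.trans hQγW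
  have hcubeW : 16 * (Q : ℝ) ^ 3 ≤ Real.exp W := hcube.trans (Real.exp_le_exp.2 hQγW)
  have hδW : Real.exp (-W) ≤ δ := by
    rw [← Real.exp_log hδ, Real.exp_le_exp]
    linarith
  have hQ8 : 8 * (Q : ℝ) ≤ Real.exp W := by
    refine le_trans ?_ hcubeW
    have h1 : (Q : ℝ) * 1 ≤ Q * Q ^ 2 :=
      mul_le_mul_of_nonneg_left (one_le_pow₀ (by linarith)) hQ0.le
    have h2 : (Q : ℝ) * Q ^ 2 = Q ^ 3 := by ring
    linarith
  have hcos : Real.exp (α * (2 * Real.pi * Q / R) ^ (1 / α)) ≤ Real.exp (c₂ * W) := by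
    rw [Real.exp_le_exp, hc₂, mul_div_right_comm, Real.mul_rpow (by positivity) hQ0.le, ← mul_assoc]
    have : (Q : ℝ) ^ (1 / α) ≤ W :=
      (Real.rpow_le_rpow_of_exponent_le (by linarith) hγα).trans hQγW
    gcongr
  set κ : ℝ := Q * Real.exp (-(c₃ * W)) with hκ
  have hκ0 : 0 < κ := by positivity
  have heW : Real.exp (-(c₃ * W)) ≤ Real.exp (-W) := Real.exp_le_exp.2
    (neg_le_neg (le_mul_of_one_le_left (by linarith) hc₃1))
  have hκQ : κ ≤ 1 / (16 * (Q : ℝ) ^ 2) := by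
    rw [le_div_iff₀ (by positivity)]
    calc κ * (16 * (Q : ℝ) ^ 2) = 16 * (Q : ℝ) ^ 3 * Real.exp (-(c₃ * W)) := by rw [hκ]; ring
      _ ≤ Real.exp W * Real.exp (-W) := by gcongr
      _ = 1 := by rw [← Real.exp_add]; simp
  have hκ4 : κ ≤ 1 / 4 := hκQ.trans (one_div_le_one_div_of_le (by norm_num) (by
    have : (1 : ℝ) ≤ (Q : ℝ) ^ 2 := one_le_pow₀ (by linarith)
    linarith))
  set m : ℕ := ⌈Real.exp (Real.exp (c₅ * W))⌉₊ with hm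
  have hmlow : Real.exp (Real.exp (c₅ * W)) ≤ m := Nat.le_ceil _
  have hmup : (m : ℝ) ≤ 2 * Real.exp (Real.exp (c₅ * W)) := by
    have h1 := (Nat.ceil_lt_add_one (Real.exp_pos (Real.exp (c₅ * W))).le).le
    have h2 : 1 ≤ Real.exp (Real.exp (c₅ * W)) := Real.one_le_exp (Real.exp_pos _).le
    linarith
  have hc₅W : W ≤ c₅ * W := le_mul_of_one_le_left (by linarith) (by linarith)
  have hQm' : (Q : ℝ) ≤ m := by
    have h1 := Real.add_one_le_exp (Real.exp (c₅ * W))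
    have h2 := Real.exp_le_exp.2 hc₅W
    linarith
  have hm0 : (0 : ℝ) < m := hQ0.trans_le hQm'
  clear_value m κ W
  obtain ⟨b, hb, hb1, hb0⟩ := hbump w hw0 hw1
  rw [hwW] at hb
  set w' : ℝ := √κ / (8 * Q) with hw'
  have hsκ : 0 < √κ := Real.sqrt_pos.2 hκ0
  have hw'0 : 0 < w' := by positivity
  have hw'1 : w' ≤ 1 := by
    rw [hw', div_le_one (by positivity)]
    have : √κ ≤ 1 := Real.sqrt_le_one.2 (by linarith)
    linarith
  have hw'low : Real.exp (-((c₃ / 2 + 1) * W)) ≤ w' := by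
    rw [hw', le_div_iff₀ (by positivity)]
    have h1 : Real.exp (-(c₃ / 2 * W)) ≤ √κ := by
      refine Real.le_sqrt_of_sq_le ?_
      rw [← Real.exp_nat_mul, hκ]
      refine le_trans (Real.exp_le_exp.2 (le_of_eq ?_))
        (le_mul_of_one_le_left (Real.exp_pos _).le (by linarith))
      push_cast; ring
    calc Real.exp (-((c₃ / 2 + 1) * W)) * (8 * Q)
        ≤ Real.exp (-((c₃ / 2 + 1) * W)) * Real.exp W := by gcongr
      _ = Real.exp (-(c₃ / 2 * W)) := by rw [← Real.exp_add]; congr 1; ring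
      _ ≤ _ := h1
  have hw'W : w' ^ (-γ) ≤ Real.exp (c₄ * W) := by
    refine (Real.rpow_le_rpow_of_nonpos (Real.exp_pos _) hw'low (by linarith)).trans
      (le_of_eq ?_)
    rw [← Real.exp_mul, hc₄]
    congr 1; ring
  obtain ⟨f, hf, hf1, hf0⟩ := hbump w' hw'0 hw'1
  refine ⟨⟨κ, m, b, f, _, _, hQ16, hlog, hκ0, hκ4, by exact_mod_cast hQm', ?_, hb, hb1, hb0, hf,
    hf1, hf0, ?_, ?_, ?_⟩⟩
  · exact speed_bound hQ' hQm' hκQ hlog0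
  · have h1 : κ / (2 * Real.pi * Q ^ 2) ≤ Real.exp (-(c₃ * W)) := by
      rw [div_le_iff₀ (by positivity), hκ]
      have h3 : (Q : ℝ) ≤ 2 * Real.pi * Q ^ 2 := by
        have : 3 * 16 ≤ Real.pi * Q := mul_le_mul hpi.le hQ' (by norm_num) (by linarith)
        calc (Q : ℝ) = Q * 1 := (mul_one _).symm
          _ ≤ Q * (2 * (Real.pi * Q)) := mul_le_mul_of_nonneg_left (by linarith) hQ0.le
          _ = _ := by ring
      rw [mul_comm]
      exact mul_le_mul_of_nonneg_left h3 (Real.exp_pos _).le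
    calc _ ≤ Real.exp (-(c₃ * W)) * Real.exp (c₂ * W) * Real.exp (c₁ * W) := by gcongr
      _ = Real.exp (-W) := by
        rw [← Real.exp_add, ← Real.exp_add, hc₃]; congr 1; ring
      _ ≤ δ := hδW
  · have h1 : 1 / (2 * m * (2 * Real.pi * Q)) ≤ Real.exp (-Real.exp (c₅ * W)) := by
      rw [Real.exp_neg, ← one_div]
      refine one_div_le_one_div_of_le (Real.exp_pos _) (hmlow.trans ?_)
      have h3 : (1 : ℝ) ≤ 2 * (2 * Real.pi * Q) := by
        have : 3 * 16 ≤ Real.pi * Q := mul_le_mul hpi.le hQ' (by norm_num) (by linarith)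
        linarith
      calc (m : ℝ) = m * 1 := (mul_one _).symm
        _ ≤ m * (2 * (2 * Real.pi * Q)) := mul_le_mul_of_nonneg_left h3 hm0.le
        _ = _ := by ring
    have h2 : c₁ * Real.exp (c₄ * W) + c₃ * W ≤ Real.exp (c₅ * W) := by
      have e1 : Real.exp (c₅ * W) = Real.exp (c₄ * W) * Real.exp W := by
        rw [← Real.exp_add, hc₅]; congr 1; ring
      have e2 : 1 ≤ Real.exp (c₄ * W) := Real.one_le_exp (by positivity)
      have e3 : 0 ≤ c₃ * W := by positivity
      have e4 := mul_le_mul_of_nonneg_left hWexp (Real.exp_pos (c₄ * W)).le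
      have e5 : 1 * (c₃ * W) ≤ Real.exp (c₄ * W) * (c₃ * W) := mul_le_mul_of_nonneg_right e2 e3
      rw [e1]
      linarith
    calc _ ≤ Real.exp (c₁ * Real.exp (c₄ * W)) * Real.exp (c₁ * W) *
          (Real.exp (-Real.exp (c₅ * W)) * Real.exp (c₂ * W)) := by gcongr
      _ = Real.exp (c₁ * Real.exp (c₄ * W) + c₁ * W + (-Real.exp (c₅ * W) + c₂ * W)) := by
        rw [← Real.exp_add, ← Real.exp_add, ← Real.exp_add]
      _ ≤ Real.exp (-W) := by
        rw [Real.exp_le_exp]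
        rw [hc₃] at h2
        linarith
      _ ≤ δ := hδW
  · refine estar_time hγ hQ16 hW hc₅0 rfl hmup fun a ha => ha₀ a ?_
    rw [div_le_iff₀ (by positivity)] at hWa
    linarith

/-! ### The sequence of resonances and the perturbations `u` and `v` -/

/-- A sequence of orders of resonance `Q n` that grows fast enough. -/
structure ResonanceSeq (α R C ε : ℝ) where
  Q : ℕ → ℕ
  -- These amplitudes add up to ε/32; the factors 2² and 2⁴ of `gevreyNorm_tensorSum_le` make this
  -- ε/8 for u and ε/2 for v.
  data : ∀ n, ResonanceData α R (ε / (64 * 2 ^ n)) C (Q n)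
  -- The spacing 1 / Q n is at most the zone width of every smaller order.
  sep : ∀ m n, m < n → Q m * Real.log (Q m) ≤ Q n
  -- The doubled zones of order n then have measure at most ε / 2^(n+1) in [0,1].
  le_log : ∀ n, 8 * 2 ^ (n + 1) / ε ≤ Real.log (Q n)
  le_Q : ∀ n, n ≤ Q n
  one_lt_α : 1 < α
  R_pos : 0 < R
  ε_pos : 0 < ε

/-- The previous term enters each maximum to make the sequence monotone, which extends the bound
from consecutive indices to all m < n. -/
theorem exists_fast_sequence (N : ℕ → ℕ) (g : ℕ → ℕ) :
    ∃ Q : ℕ → ℕ, (∀ n, N n ≤ Q n) ∧ ∀ m n, m < n → g (Q m) ≤ Q n := by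
  let Q : ℕ → ℕ := fun n => Nat.rec (N 0) (fun k q => max (N (k + 1)) (max q (g q))) n
  have hstep : ∀ n, Q (n + 1) = max (N (n + 1)) (max (Q n) (g (Q n))) := fun n => rfl
  have hmono : Monotone Q := monotone_nat_of_le_succ fun n => by
    rw [hstep]; exact (le_max_left _ _).trans (le_max_right _ _)
  refine ⟨Q, fun n => ?_, fun m n hmn => ?_⟩
  · cases n with
    | zero => exact le_rfl
    | succ n => rw [hstep]; exact le_max_left _ _
  · refine le_trans ?_ (hmono (Nat.succ_le_of_lt hmn))
    rw [hstep]
    exact (le_max_right _ _).trans (le_max_right _ _)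

theorem exists_resonanceSeq {α R : ℝ} (hα : 1 < α) (hR : 0 < R) :
    ∃ C : ℝ, 0 < C ∧ ∀ ε : ℝ, 0 < ε → Nonempty (ResonanceSeq α R C ε) := by
  obtain ⟨C, hC, hdata⟩ := exists_resonanceData hα hR
  refine ⟨C, hC, fun ε hε => ?_⟩
  have hev : ∀ n : ℕ, ∃ N : ℕ, ∀ Q, N ≤ Q → Nonempty (ResonanceData α R (ε / (64 * 2 ^ n)) C Q) ∧
      8 * 2 ^ (n + 1) / ε ≤ Real.log Q ∧ n ≤ Q := by
    intro n
    refine Filter.eventually_atTop.1 ?_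
    filter_upwards [hdata (ε / (64 * 2 ^ n)) (by positivity),
      (Real.tendsto_log_atTop.comp tendsto_natCast_atTop_atTop).eventually_ge_atTop
        (8 * 2 ^ (n + 1) / ε), Filter.eventually_ge_atTop n] with Q h1 h2 h3 using ⟨h1, h2, h3⟩
  choose N hN using hev
  obtain ⟨Q, hQN, hQ⟩ := exists_fast_sequence N fun q => ⌈(q : ℝ) * Real.log q⌉₊
  exact ⟨{ Q := Q
           data := fun n => (hN n (Q n) (hQN n)).1.some
           sep := fun m n hmn => (Nat.le_ceil _).trans (by exact_mod_cast hQ m n hmn)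
           le_log := fun n => (hN n (Q n) (hQN n)).2.1
           le_Q := fun n => (hN n (Q n) (hQN n)).2.2
           one_lt_α := hα
           R_pos := hR
           ε_pos := hε }⟩

namespace ResonanceSeq

variable {α R C ε : ℝ} (S : ResonanceSeq α R C ε) (ω₁ : ℝ)

/-- The half width of the resonant zones of order `Q n`. -/
def w (n : ℕ) : ℝ := 1 / (S.Q n * Real.log (S.Q n))

/-- The resonance `p / Q n` is kept if its zone does not meet the zones of smaller order. -/
def adm (n : ℕ) (p : ℤ) : Prop :=
  ∀ m, m < n → ∀ j : ℤ, S.w m + S.w n ≤ |(p : ℝ) / S.Q n - j / S.Q m|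

/-- The bumps in the action `r₁` that localize the perturbation at the resonances. -/
def B (n : ℕ) (r : ℝ) : ℝ := train (S.Q n) (S.adm n) (S.data n).b (r + ω₁)

/-- The bumps in the angle `θ₁`. -/
def F (n : ℕ) (θ : ℝ) : ℝ :=
  train (S.Q n) (fun _ => True) (S.data n).f (θ + -(1 / (2 * S.Q n)))

/-- The potential `κ / (2π Q²) cos (2π Q θ)`. -/
def c (n : ℕ) (θ : ℝ) : ℝ :=
  (S.data n).κ / (2 * Real.pi * S.Q n ^ 2) *
    Real.sin (2 * Real.pi * S.Q n * θ + Real.pi / 2)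

/-- The potential `- sin (2π Q θ) / (4π Q m)`. -/
def g (n : ℕ) (θ : ℝ) : ℝ :=
  -(1 / (2 * (S.data n).m * (2 * Real.pi * S.Q n))) *
    Real.sin (2 * Real.pi * S.Q n * θ + 0)

/-- The actions `r₁` at which the perturbation is flat. -/
def flatSet : Set ℝ := {r | ∀ m, ∀ j : ℤ, 2 * S.w m ≤ |r + ω₁ - j / S.Q m|}

/-! ### Elementary bounds and periodicity of the factors -/

theorem Q_pos (n : ℕ) : 0 < S.Q n := lt_of_lt_of_le (by norm_num) (S.data n).le_Q

theorem Q_pos' (n : ℕ) : (0 : ℝ) < S.Q n := by exact_mod_cast S.Q_pos n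

theorem log_Q_pos (n : ℕ) : 0 < Real.log (S.Q n) := by linarith [(S.data n).two_lt_log]

theorem w_pos (n : ℕ) : 0 < S.w n :=
  one_div_pos.2 (mul_pos (S.Q_pos' n) (S.log_Q_pos n))

theorem w_lt (n : ℕ) : S.w n < 1 / (2 * S.Q n) := by
  have := S.Q_pos' n
  refine one_div_lt_one_div_of_lt (by positivity) ?_
  nlinarith [(S.data n).two_lt_log]

theorem inv_Q_le_w {m n : ℕ} (h : m < n) : 1 / (S.Q n : ℝ) ≤ S.w m :=
  one_div_le_one_div_of_le (mul_pos (S.Q_pos' m) (S.log_Q_pos m)) (S.sep m n h)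

theorem half_inv_Q (n : ℕ) : 1 / (S.Q n : ℝ) = 1 / (2 * S.Q n) + 1 / (2 * S.Q n) := by
  have := (S.Q_pos' n).ne'
  field_simp
  norm_num

theorem m_pos (n : ℕ) : 1 ≤ (S.data n).m :=
  (S.Q_pos n).trans_le (S.data n).Q_le_m

theorem adm_add (n : ℕ) (p : ℤ) : S.adm n (p + S.Q n) ↔ S.adm n p := by
  have key : ∀ m (p j k : ℤ), ((p + k * S.Q n : ℤ) : ℝ) / S.Q n - ((j + k * S.Q m : ℤ) : ℝ) / S.Q m =
      (p : ℝ) / S.Q n - j / S.Q m := by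
    intro m p j k
    have h1 := (S.Q_pos' m).ne'
    have h2 := (S.Q_pos' n).ne'
    push_cast
    field_simp
    ring
  constructor
  · intro h m hm j
    have := h m hm (j + 1 * S.Q m)
    rwa [← key m p j 1, one_mul (S.Q n : ℤ)]
  · intro h m hm j
    have := h m hm (j + -1 * S.Q m)
    rwa [show p = (p + S.Q n) + -1 * (S.Q n : ℤ) by ring, key] at this

theorem b_train_periodic (n : ℕ) : Function.Periodic (S.B ω₁ n) 1 := by
  intro r
  have := train_periodic (b := (S.data n).b) (S.Q_pos n) (S.adm_add n) (r + ω₁)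
  rw [B, B, show r + 1 + ω₁ = r + ω₁ + 1 by ring, this]

theorem f_train_periodic (n : ℕ) : Function.Periodic (S.F n) 1 := by
  intro θ
  have := train_periodic (b := (S.data n).f) (χ := fun _ => True) (S.Q_pos n) (by simp)
    (θ + -(1 / (2 * S.Q n)))
  rw [F, F, show θ + 1 + -(1 / (2 * (S.Q n : ℝ))) = θ + -(1 / (2 * S.Q n)) + 1 by ring, this]

theorem sin_periodic (n : ℕ) (A b : ℝ) :
    Function.Periodic (fun θ => A * Real.sin (2 * Real.pi * S.Q n * θ + b)) 1 := by
  intro θ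
  simp only
  rw [show 2 * Real.pi * S.Q n * (θ + 1) + b =
    2 * Real.pi * S.Q n * θ + b + (S.Q n : ℕ) * (2 * Real.pi) by ring, Real.sin_add_nat_mul_two_pi]

theorem c_periodic (n : ℕ) : Function.Periodic (S.c n) 1 := S.sin_periodic n _ _

theorem g_periodic (n : ℕ) : Function.Periodic (S.g n) 1 := S.sin_periodic n _ _

/-- The Gevrey bound for `sin (2π Q θ + b)`. -/
def sinBound (n : ℕ) : ℝ := Real.exp (α * (2 * Real.pi * S.Q n / R) ^ (1 / α))

theorem B_bound (n : ℕ) : GevreyBound α R (S.data n).Ab (S.B ω₁ n) :=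
  ((S.data n).b_bound.train S.R_pos.le (S.Q_pos n) (S.data n).b_zero (S.w_lt n)).comp_add_const ω₁

theorem f_width_lt (n : ℕ) : √(S.data n).κ / (8 * S.Q n) < 1 / (2 * S.Q n) := by
  have hQ := S.Q_pos' n
  have h1 : √(S.data n).κ ≤ 1 := Real.sqrt_le_one.2 (by linarith [(S.data n).κ_le])
  rw [div_lt_div_iff₀ (by positivity) (by positivity)]
  nlinarith

theorem F_bound (n : ℕ) : GevreyBound α R (S.data n).Af (S.F n) :=
  ((S.data n).f_bound.train S.R_pos.le (S.Q_pos n) (S.data n).f_zero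
    (S.f_width_lt n)).comp_add_const _

theorem sin_bound (n : ℕ) (b : ℝ) : GevreyBound α R (S.sinBound n)
    (fun θ => Real.sin (2 * Real.pi * S.Q n * θ + b)) :=
  GevreyBound.sin_mul_add (by linarith [S.one_lt_α]) S.R_pos
    (by have := Real.pi_pos; positivity) b

theorem c_bound (n : ℕ) : GevreyBound α R
    ((S.data n).κ / (2 * Real.pi * S.Q n ^ 2) * S.sinBound n) (S.c n) := by
  have h := (S.sin_bound n (Real.pi / 2)).const_mul ((S.data n).κ / (2 * Real.pi * S.Q n ^ 2))
  rwa [abs_of_nonneg (div_nonneg (S.data n).κ_pos.le (by have := Real.pi_pos; positivity))] at h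

theorem g_bound (n : ℕ) : GevreyBound α R
    (1 / (2 * (S.data n).m * (2 * Real.pi * S.Q n)) * S.sinBound n) (S.g n) := by
  have h := (S.sin_bound n 0).const_mul (-(1 / (2 * (S.data n).m * (2 * Real.pi * S.Q n))))
  rwa [abs_neg, abs_of_nonneg (by have := Real.pi_pos; positivity)] at h

/-! The one-variable factors of `u` on `M₁`, of `u` on `M₁ × M₂` and of `v`. -/

def hu (n : ℕ) : Fin 2 → ℝ → ℝ := ![S.c n, S.B ω₁ n]

def hU (n : ℕ) : Fin 4 → ℝ → ℝ := ![S.c n, S.B ω₁ n, fun _ => 1, fun _ => 1]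

def hv (n : ℕ) : Fin 4 → ℝ → ℝ := ![S.F n, S.B ω₁ n, S.g n, fun _ => 1]

def Au (n : ℕ) : Fin 2 → ℝ :=
  ![(S.data n).κ / (2 * Real.pi * S.Q n ^ 2) * S.sinBound n, (S.data n).Ab]

def AU (n : ℕ) : Fin 4 → ℝ :=
  ![(S.data n).κ / (2 * Real.pi * S.Q n ^ 2) * S.sinBound n, (S.data n).Ab, 1, 1]

def Av (n : ℕ) : Fin 4 → ℝ :=
  ![(S.data n).Af, (S.data n).Ab,
    1 / (2 * (S.data n).m * (2 * Real.pi * S.Q n)) * S.sinBound n, 1]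

theorem one_bound (S : ResonanceSeq α R C ε) : GevreyBound α R 1 (fun _ => 1) := by
  simpa using GevreyBound.const (α := α) S.R_pos.le 1

theorem hu_bound (n : ℕ) (i : Fin 2) : GevreyBound α R (S.Au n i) (S.hu ω₁ n i) := by
  fin_cases i
  · exact S.c_bound n
  · exact S.B_bound ω₁ n

theorem hU_bound (n : ℕ) (i : Fin 4) : GevreyBound α R (S.AU n i) (S.hU ω₁ n i) := by
  fin_cases i
  · exact S.c_bound n
  · exact S.B_bound ω₁ n
  · exact S.one_bound
  · exact S.one_bound

theorem hv_bound (n : ℕ) (i : Fin 4) : GevreyBound α R (S.Av n i) (S.hv ω₁ n i) := by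
  fin_cases i
  · exact S.F_bound n
  · exact S.B_bound ω₁ n
  · exact S.g_bound n
  · exact S.one_bound

theorem hasSum_small : HasSum (fun n : ℕ => ε / (64 * 2 ^ n)) (ε / 32) := by
  have h1 : (fun n : ℕ => ε / (64 * 2 ^ n)) = fun n => ε / 64 * (1 / 2) ^ n := by
    funext n
    rw [div_pow, one_pow]
    field_simp
  rw [h1, show ε / 32 = ε / 64 * 2 by ring]
  exact hasSum_geometric_two.mul_left (ε / 64)

theorem prod_Au_le (n : ℕ) : ∏ i, S.Au n i ≤ ε / (64 * 2 ^ n) := by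
  rw [Fin.prod_univ_two]
  exact (S.data n).u_small

theorem prod_AU_eq (n : ℕ) : ∏ i, S.AU n i = ∏ i, S.Au n i := by
  rw [Fin.prod_univ_two, Fin.prod_univ_four]
  simp [AU, Au]

theorem prod_Av_le (n : ℕ) : ∏ i, S.Av n i ≤ ε / (64 * 2 ^ n) := by
  rw [Fin.prod_univ_four]
  exact (mul_one _).trans_le (S.data n).v_small

theorem summable_Au : Summable fun n => ∏ i, S.Au n i :=
  Summable.of_nonneg_of_le
    (fun n => Finset.prod_nonneg fun i _ => (S.hu_bound 0 n i).nonneg) S.prod_Au_le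
    hasSum_small.summable

theorem summable_AU : Summable fun n => ∏ i, S.AU n i := by
  simpa only [S.prod_AU_eq] using S.summable_Au

theorem summable_Av : Summable fun n => ∏ i, S.Av n i :=
  Summable.of_nonneg_of_le
    (fun n => Finset.prod_nonneg fun i _ => (S.hv_bound 0 n i).nonneg) S.prod_Av_le
    hasSum_small.summable

theorem tsum_Au_le : ∑' n, ∏ i, S.Au n i ≤ ε / 32 :=
  (S.summable_Au.tsum_le_tsum S.prod_Au_le hasSum_small.summable).trans hasSum_small.tsum_eq.le

theorem tsum_Av_le : ∑' n, ∏ i, S.Av n i ≤ ε / 32 :=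
  (S.summable_Av.tsum_le_tsum S.prod_Av_le hasSum_small.summable).trans hasSum_small.tsum_eq.le

/-- The perturbation `u` on `M₁`. -/
def u (z : Annulus) : ℝ := ∑' n, (S.c_periodic n).lift z.fst * S.B ω₁ n z.snd

/-- The perturbation `v` on `M₁ × M₂`. -/
def v (z : Phase) : ℝ :=
  ∑' n, (S.f_train_periodic n).lift z.fst.fst * S.B ω₁ n z.fst.snd *
    (S.g_periodic n).lift z.snd.fst

theorem u_comp_cover : S.u ω₁ ∘ annulusCover = tensorSum (S.hu ω₁) 0 := by
  funext x
  simp only [Function.comp_apply, u, tensorSum, Pi.zero_apply, iteratedDeriv_zero,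
    Fin.prod_univ_two]
  rfl

theorem extend_u_comp_cover : extend (S.u ω₁) ∘ phaseCover = tensorSum (S.hU ω₁) 0 := by
  funext x
  simp only [Function.comp_apply, extend, u, tensorSum, Pi.zero_apply, iteratedDeriv_zero,
    Fin.prod_univ_four]
  simp only [hU, Matrix.cons_val, mul_one]
  rfl

theorem v_comp_cover : S.v ω₁ ∘ phaseCover = tensorSum (S.hv ω₁) 0 := by
  funext x
  simp only [Function.comp_apply, v, tensorSum, Pi.zero_apply, iteratedDeriv_zero,
    Fin.prod_univ_four]
  simp only [hv, Matrix.cons_val, mul_one]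
  rfl

/-! Local behaviour of the bumps in `r₁`. -/

theorem iteratedDeriv_eq_zero_of_eventuallyEq {f : ℝ → ℝ} {x : ℝ} (h : f =ᶠ[𝓝 x] fun _ => 0)
    (k : ℕ) : iteratedDeriv k f x = 0 := by
  rw [h.iteratedDeriv_eq k, iteratedDeriv_const]
  simp

theorem iteratedDeriv_B_eq_zero {n : ℕ} {r : ℝ}
    (h : ∀ j : ℤ, S.adm n j → S.w n < |r + ω₁ - j / S.Q n|) (k : ℕ) :
    iteratedDeriv k (S.B ω₁ n) r = 0 := by
  have h1 := train_eventuallyEq_zero (S.Q_pos n) (S.data n).b_zero (S.w_lt n) h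
  refine iteratedDeriv_eq_zero_of_eventuallyEq ?_ k
  exact (continuous_id.add continuous_const).continuousAt.eventually h1

theorem iteratedDeriv_B_of_mem_flatSet {r : ℝ} (hr : r ∈ S.flatSet ω₁) (n k : ℕ) :
    iteratedDeriv k (S.B ω₁ n) r = 0 :=
  S.iteratedDeriv_B_eq_zero ω₁ (fun j _ => by linarith [hr n j, S.w_pos n]) k

/-- For m < n the resonance p was kept because it avoids all zones of order m; for n < m the
resonances j kept at order m avoid the zone of p. -/
theorem iteratedDeriv_B_of_ne {n m : ℕ} {p : ℤ} (hp : S.adm n p) {r : ℝ}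
    (hr : |r + ω₁ - p / S.Q n| < S.w n) (hmn : m ≠ n) (k : ℕ) :
    iteratedDeriv k (S.B ω₁ m) r = 0 := by
  refine S.iteratedDeriv_B_eq_zero ω₁ (fun j hj => ?_) k
  have key : S.w m + S.w n ≤ |(p : ℝ) / S.Q n - j / S.Q m| := by
    rcases lt_or_gt_of_ne hmn with h | h
    · exact hp m h j
    · have := hj n h p
      rwa [abs_sub_comm, add_comm] at this
  have h2 := abs_sub_le ((p : ℝ) / S.Q n) (r + ω₁) (j / S.Q m)
  rw [abs_sub_comm ((p : ℝ) / S.Q n) (r + ω₁)] at h2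
  linarith

theorem B_eventuallyEq_one {n : ℕ} {p : ℤ} (hp : S.adm n p) {r : ℝ}
    (hr : |r + ω₁ - p / S.Q n| < S.w n / 2) : S.B ω₁ n =ᶠ[𝓝 r] fun _ => 1 := by
  have hw := S.w_pos n
  have hr' : ∀ᶠ x in 𝓝 r, |x + ω₁ - p / S.Q n| < S.w n / 2 :=
    (continuous_id.add continuous_const).continuousAt.eventually (eventually_abs_sub_lt hr)
  filter_upwards [hr'] with x hx
  have h1 : |x + ω₁ - p / S.Q n| < 1 / (2 * S.Q n) := by linarith [S.w_lt n]
  rw [B, train_apply (S.Q_pos n) h1 hp, (S.data n).b_one _ hx.le]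

theorem B_eq_one {n : ℕ} {p : ℤ} (hp : S.adm n p) {r : ℝ}
    (hr : |r + ω₁ - p / S.Q n| < S.w n / 2) : S.B ω₁ n r = 1 :=
  (S.B_eventuallyEq_one ω₁ hp hr).eq_of_nhds

theorem iteratedDeriv_one_B {n : ℕ} {p : ℤ} (hp : S.adm n p) {r : ℝ}
    (hr : |r + ω₁ - p / S.Q n| < S.w n / 2) : iteratedDeriv 1 (S.B ω₁ n) r = 0 := by
  rw [(S.B_eventuallyEq_one ω₁ hp hr).iteratedDeriv_eq 1, iteratedDeriv_const]
  simp

/-- The resonances of order m < n are 2 `w m` away from r + ω₁, while 1/(2 Q n) + `w n` < 1/Q n ≤ `w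
m`. This is why `flatSet` excludes zones of double width. -/
theorem adm_round {r : ℝ} (hr : r ∈ S.flatSet ω₁) (n : ℕ) :
    S.adm n (round (S.Q n * (r + ω₁))) ∧
      |r + ω₁ - round (S.Q n * (r + ω₁)) / S.Q n| ≤ 1 / (2 * S.Q n) := by
  have hQ := S.Q_pos' n
  set p := round (S.Q n * (r + ω₁)) with hp
  have hclose : |r + ω₁ - p / S.Q n| ≤ 1 / (2 * S.Q n) := by
    have h1 := abs_sub_round (S.Q n * (r + ω₁))
    rw [← hp, abs_mul_sub_eq (S.Q_pos n)] at h1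
    rw [le_div_iff₀ (by positivity)]
    linarith
  refine ⟨fun m hm j => ?_, hclose⟩
  have h1 := hr m j
  have h2 := S.inv_Q_le_w hm
  have h3 := S.w_lt n
  have h4 := S.half_inv_Q n
  have h5 := abs_sub_le (r + ω₁) ((p : ℝ) / S.Q n) (j / S.Q m)
  linarith

/-! Values of the vector fields. -/

theorem tensorSum_eq_zero_of_mem_flatSet {N : ℕ} {h : ℕ → Fin N → ℝ → ℝ} {i : Fin N}
    (hi : ∀ n, h n i = S.B ω₁ n) {x : Fin N → ℝ} (hx : x i ∈ S.flatSet ω₁) (k : Fin N → ℕ) :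
    tensorSum h k x = 0 := by
  have : ∀ n, ∏ i, iteratedDeriv (k i) (h n i) (x i) = 0 := fun n =>
    Finset.prod_eq_zero (Finset.mem_univ i)
      (by rw [hi, S.iteratedDeriv_B_of_mem_flatSet ω₁ hx])
  simp [tensorSum, this]

theorem tensorSum_eq_single {N : ℕ} {h : ℕ → Fin N → ℝ → ℝ} {i : Fin N}
    (hi : ∀ n, h n i = S.B ω₁ n) {n : ℕ} {p : ℤ} (hp : S.adm n p) {x : Fin N → ℝ}
    (hx : |x i + ω₁ - p / S.Q n| < S.w n / 2) (k : Fin N → ℕ) :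
    tensorSum h k x = ∏ i, iteratedDeriv (k i) (h n i) (x i) := by
  refine tsum_eq_single n fun m hm => Finset.prod_eq_zero (Finset.mem_univ i) ?_
  rw [hi, S.iteratedDeriv_B_of_ne ω₁ hp (by linarith [S.w_pos n]) hm]

theorem iteratedDeriv_one_c (n : ℕ) (θ : ℝ) : iteratedDeriv 1 (S.c n) θ =
    -((S.data n).κ / S.Q n * Real.sin (2 * Real.pi * (S.Q n * θ))) := by
  have hQ := (S.Q_pos' n).ne'
  have hpi := Real.pi_pos.ne'
  have h1 : S.c n = fun θ => (S.data n).κ / (2 * Real.pi * S.Q n ^ 2) *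
    Real.sin (2 * Real.pi * S.Q n * θ + Real.pi / 2) := rfl
  rw [h1, iteratedDeriv_const_mul_field, iteratedDeriv_sin_mul_add]
  simp only [Nat.cast_one, one_mul, pow_one]
  rw [show Real.pi / 2 + Real.pi / 2 = Real.pi by ring, Real.sin_add_pi,
    show 2 * Real.pi * S.Q n * θ = 2 * Real.pi * (S.Q n * θ) by ring]
  field_simp

theorem iteratedDeriv_one_g (n : ℕ) (θ : ℝ) : iteratedDeriv 1 (S.g n) θ =
    -(1 / (2 * (S.data n).m) * Real.cos (2 * Real.pi * (S.Q n * θ))) := by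
  have hQ := (S.Q_pos' n).ne'
  have hpi := Real.pi_pos.ne'
  have hm : ((S.data n).m : ℝ) ≠ 0 := by exact_mod_cast Nat.one_le_iff_ne_zero.1 (S.m_pos n)
  have h1 : S.g n = fun θ => -(1 / (2 * (S.data n).m * (2 * Real.pi * S.Q n))) *
    Real.sin (2 * Real.pi * S.Q n * θ + 0) := rfl
  rw [h1, iteratedDeriv_const_mul_field, iteratedDeriv_sin_mul_add]
  simp only [Nat.cast_one, one_mul, pow_one, zero_add]
  rw [Real.sin_add_pi_div_two,
    show 2 * Real.pi * S.Q n * θ = 2 * Real.pi * (S.Q n * θ) by ring]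
  field_simp

theorem iteratedDeriv_one_const (a x : ℝ) : iteratedDeriv 1 (fun _ : ℝ => a) x = 0 := by
  rw [iteratedDeriv_const]
  simp

/-- Where the bump in r₁ is 1, a single term survives and it depends on θ₁ only: the flow kicks r₁
and fixes the angles. -/
theorem hamVectorField_u {n : ℕ} {p : ℤ} (hp : S.adm n p) {x : Fin 4 → ℝ}
    (hx : |x 1 + ω₁ - p / S.Q n| < S.w n / 2) :
    hamVectorField (extend (S.u ω₁) ∘ phaseCover) x =
      ![0, (S.data n).κ / S.Q n * Real.sin (2 * Real.pi * (S.Q n * x 0)), 0, 0] := by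
  rw [S.extend_u_comp_cover, hamVectorField_tensorSum (S.hU_bound ω₁) S.summable_AU]
  simp only [S.tensorSum_eq_single ω₁ (h := S.hU ω₁) (i := 1) (fun _ => rfl) hp hx,
    Fin.prod_univ_four]
  simp [hU, S.iteratedDeriv_one_B ω₁ hp hx, S.B_eq_one ω₁ hp hx, S.iteratedDeriv_one_c,
    iteratedDeriv_one_const, -iteratedDeriv_one]

theorem hamVectorField_v {n : ℕ} {p : ℤ} (hp : S.adm n p) {x : Fin 4 → ℝ}
    (hx : |x 1 + ω₁ - p / S.Q n| < S.w n / 2) :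
    hamVectorField (S.v ω₁ ∘ phaseCover) x =
      ![0, -(iteratedDeriv 1 (S.F n) (x 0) * S.g n (x 2)), 0,
        S.F n (x 0) * (1 / (2 * (S.data n).m) * Real.cos (2 * Real.pi * (S.Q n * x 2)))] := by
  rw [S.v_comp_cover, hamVectorField_tensorSum (S.hv_bound ω₁) S.summable_Av]
  simp only [S.tensorSum_eq_single ω₁ (h := S.hv ω₁) (i := 1) (fun _ => rfl) hp hx,
    Fin.prod_univ_four]
  simp [hv, S.iteratedDeriv_one_B ω₁ hp hx, S.B_eq_one ω₁ hp hx, S.iteratedDeriv_one_g,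
    iteratedDeriv_one_const, -iteratedDeriv_one]

theorem hamVectorField_u_of_mem_flatSet {x : Fin 4 → ℝ} (hx : x 1 ∈ S.flatSet ω₁) :
    hamVectorField (extend (S.u ω₁) ∘ phaseCover) x = 0 := by
  rw [S.extend_u_comp_cover, hamVectorField_tensorSum (S.hU_bound ω₁) S.summable_AU]
  simp only [S.tensorSum_eq_zero_of_mem_flatSet ω₁ (h := S.hU ω₁) (i := 1) (fun _ => rfl) hx]
  simp

theorem hamVectorField_v_of_mem_flatSet {x : Fin 4 → ℝ} (hx : x 1 ∈ S.flatSet ω₁) :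
    hamVectorField (S.v ω₁ ∘ phaseCover) x = 0 := by
  rw [S.v_comp_cover, hamVectorField_tensorSum (S.hv_bound ω₁) S.summable_Av]
  simp only [S.tensorSum_eq_zero_of_mem_flatSet ω₁ (h := S.hv ω₁) (i := 1) (fun _ => rfl) hx]
  simp

end ResonanceSeq

/-! ### The drifting orbits -/

theorem T₀_phaseCover (ω₁ ω₂ a r b s : ℝ) :
    T₀ ω₁ ω₂ (phaseCover ![a, r, b, s]) = phaseCover ![a + (ω₁ + r), r, b + (ω₂ + s), s] := by
  simp [T₀, twist, phaseCover, phasePt, annulusPt]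

theorem phaseCover_add_int (a r b s : ℝ) (k : ℤ) :
    phaseCover ![a, r, b + k, s] = phaseCover ![a, r, b, s] := by
  rw [phaseCover_eq_iff]
  refine ⟨⟨rfl, rfl⟩, ?_, rfl⟩
  have h := AddCircle.coe_eq_zero_iff (p := (1 : ℝ)) (x := (k : ℝ))
  have h1 : ((k : ℝ) : UnitAddCircle) = 0 := h.2 ⟨k, by simp⟩
  change ((b + k : ℝ) : UnitAddCircle) = (b : UnitAddCircle)
  rw [AddCircle.coe_add, h1, add_zero]

theorem IsTimeOneMap.apply_of_const {H : Phase → ℝ} {Φ : Phase → Phase} {K : NNReal}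
    (hΦ : IsTimeOneMap H Φ) (hv : LipschitzWith K (hamVectorField (H ∘ phaseCover)))
    {x a : Fin 4 → ℝ}
    (h : ∀ t ∈ Set.Icc (0 : ℝ) 1, hamVectorField (H ∘ phaseCover) (x + t • a) = a) :
    Φ (phaseCover x) = phaseCover (x + a) := by
  have := hΦ.apply_of_hasDerivAt hv (c := fun t => x + t • a) fun t ht => by
    simpa [h t ht] using ((hasDerivAt_id t).smul_const a).const_add x
  simpa using this

namespace ResonanceSeq

variable {α R C ε : ℝ} (S : ResonanceSeq α R C ε) {ω₁ ω₂ : ℝ} {Φu Φv : Phase → Phase}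

theorem exists_lipschitzWith_u (ω₁ : ℝ) :
    ∃ K, LipschitzWith K (hamVectorField (extend (S.u ω₁) ∘ phaseCover)) := by
  rw [S.extend_u_comp_cover]
  exact exists_lipschitzWith_hamVectorField (S.hU_bound ω₁) S.summable_AU

theorem exists_lipschitzWith_v (ω₁ : ℝ) :
    ∃ K, LipschitzWith K (hamVectorField (S.v ω₁ ∘ phaseCover)) := by
  rw [S.v_comp_cover]
  exact exists_lipschitzWith_hamVectorField (S.hv_bound ω₁) S.summable_Av

theorem exists_isTimeOneMap_u (ω₁ : ℝ) : ∃ Φ, IsTimeOneMap (extend (S.u ω₁)) Φ := by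
  obtain ⟨K, hK⟩ := S.exists_lipschitzWith_u ω₁
  obtain ⟨M, hM⟩ := exists_norm_hamVectorField_le (S.hU_bound ω₁) S.summable_AU
  rw [← S.extend_u_comp_cover] at hM
  exact exists_isTimeOneMap hK hM

theorem exists_isTimeOneMap_v (ω₁ : ℝ) : ∃ Φ, IsTimeOneMap (S.v ω₁) Φ := by
  obtain ⟨K, hK⟩ := S.exists_lipschitzWith_v ω₁
  obtain ⟨M, hM⟩ := exists_norm_hamVectorField_le (S.hv_bound ω₁) S.summable_Av
  rw [← S.v_comp_cover] at hM
  exact exists_isTimeOneMap hK hM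

theorem flow_u_of_mem_flatSet (hu : IsTimeOneMap (extend (S.u ω₁)) Φu) {x : Fin 4 → ℝ}
    (hx : x 1 ∈ S.flatSet ω₁) : Φu (phaseCover x) = phaseCover x := by
  obtain ⟨K, hK⟩ := S.exists_lipschitzWith_u ω₁
  simpa using hu.apply_of_const hK (x := x) (a := 0) fun t _ => by
    simpa using S.hamVectorField_u_of_mem_flatSet ω₁ hx

theorem flow_v_of_mem_flatSet (hv : IsTimeOneMap (S.v ω₁) Φv) {x : Fin 4 → ℝ}
    (hx : x 1 ∈ S.flatSet ω₁) : Φv (phaseCover x) = phaseCover x := by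
  obtain ⟨K, hK⟩ := S.exists_lipschitzWith_v ω₁
  simpa using hv.apply_of_const hK (x := x) (a := 0) fun t _ => by
    simpa using S.hamVectorField_v_of_mem_flatSet ω₁ hx

/-- θ₁ does not move, so the field is constant along the segment from r to r', and this segment lies
in the zone because its two ends do. -/
theorem flow_u_resonant (hu : IsTimeOneMap (extend (S.u ω₁)) Φu) {n : ℕ} {p : ℤ}
    (hp : S.adm n p) {a r r' : ℝ} (b s : ℝ)
    (hr' : r' = r + (S.data n).κ / S.Q n * Real.sin (2 * Real.pi * (S.Q n * a)))
    (h : |r + ω₁ - p / S.Q n| < S.w n / 2) (h' : |r' + ω₁ - p / S.Q n| < S.w n / 2) :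
    Φu (phaseCover ![a, r, b, s]) = phaseCover ![a, r', b, s] := by
  obtain ⟨K, hK⟩ := S.exists_lipschitzWith_u ω₁
  set q := (S.data n).κ / S.Q n * Real.sin (2 * Real.pi * (S.Q n * a)) with hq
  have key := hu.apply_of_const hK (x := ![a, r, b, s]) (a := ![0, q, 0, 0]) fun t ht => by
    rw [S.hamVectorField_u ω₁ hp]
    · simp [hq]
    · rw [abs_lt] at h h' ⊢
      simp only [Pi.add_apply, Pi.smul_apply, Matrix.cons_val, smul_eq_mul]
      obtain ⟨t0, t1⟩ := ht
      subst hr'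
      rcases le_total 0 q with h0 | h0
      · have h1 : 0 ≤ t * q := mul_nonneg t0 h0
        have h2 : t * q ≤ q := mul_le_of_le_one_left h0 t1
        constructor <;> linarith
      · have h1 : t * q ≤ 0 := mul_nonpos_of_nonneg_of_nonpos t0 h0
        have h2 : q ≤ t * q := le_mul_of_le_one_left h0 t1
        constructor <;> linarith
  rw [key, hr']
  congr 1
  ext i
  fin_cases i <;> simp

/-- The kick in r₁ is proportional to the derivative of `S.F n`; local constancy kills it, so v does
not disturb the orbit of the standard map. -/
theorem flow_v_resonant (hv : IsTimeOneMap (S.v ω₁) Φv) {n : ℕ} {p : ℤ}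
    (hp : S.adm n p) {a r : ℝ} (b s : ℝ) (h : |r + ω₁ - p / S.Q n| < S.w n / 2) {e : ℝ}
    (hF : S.F n =ᶠ[𝓝 a] fun _ => e) :
    Φv (phaseCover ![a, r, b, s]) = phaseCover ![a, r, b,
      s + e * (1 / (2 * (S.data n).m) * Real.cos (2 * Real.pi * (S.Q n * b)))] := by
  obtain ⟨K, hK⟩ := S.exists_lipschitzWith_v ω₁
  have h0 : S.F n a = e := hF.eq_of_nhds
  have h1 : iteratedDeriv 1 (S.F n) a = 0 := by
    rw [hF.iteratedDeriv_eq 1, iteratedDeriv_one_const]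
  set q := e * (1 / (2 * (S.data n).m) * Real.cos (2 * Real.pi * (S.Q n * b))) with hq
  have key := hv.apply_of_const hK (x := ![a, r, b, s]) (a := ![0, 0, 0, q]) fun t ht => by
    rw [S.hamVectorField_v ω₁ hp]
    · simp only [Pi.add_apply, Pi.smul_apply, Matrix.cons_val, smul_eq_mul, mul_zero, add_zero,
        h0, h1, zero_mul, neg_zero, ← hq]
    · simpa using h
  rw [key]
  congr 1
  ext i
  fin_cases i <;> simp

theorem F_eventuallyEq_one (n : ℕ) (j : ℤ) :
    S.F n =ᶠ[𝓝 ((1 / 2 + (j : ℝ)) / S.Q n)] fun _ => 1 := by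
  have hQ := S.Q_pos' n
  have hκ := Real.sqrt_pos.2 (S.data n).κ_pos
  have h0 : (1 / 2 + (j : ℝ)) / (S.Q n : ℝ) + -(1 / (2 * S.Q n)) - j / S.Q n = 0 := by
    field_simp
    ring
  have h1 : ∀ᶠ x : ℝ in 𝓝 ((1 / 2 + (j : ℝ)) / (S.Q n : ℝ)),
      |x + -(1 / (2 * S.Q n)) - j / S.Q n| < √(S.data n).κ / (8 * S.Q n) / 2 :=
    (continuous_id.add continuous_const).continuousAt.eventually
      (eventually_abs_sub_lt (by
        change |(1 / 2 + (j : ℝ)) / S.Q n + -(1 / (2 * (S.Q n : ℝ))) - j / S.Q n| < _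
        rw [h0, abs_zero]
        positivity))
  filter_upwards [h1] with x hx
  have hlt := S.f_width_lt n
  have hpos : 0 < √(S.data n).κ / (8 * S.Q n) := by positivity
  have hx' : |x + -(1 / (2 * S.Q n)) - j / S.Q n| < 1 / (2 * S.Q n) := by linarith
  rw [F, train_apply (S.Q_pos n) hx' trivial, (S.data n).f_one _ hx.le]

/-- In the variable Qθ₁ the bumps vanish beyond distance √κ/8 from their centres, half the gap
granted by `exists_standard_orbit`. -/
theorem F_eventuallyEq_zero (n : ℕ) {y : ℝ} (j : ℤ) (h1 : 1 / 2 + √(S.data n).κ / 4 ≤ y)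
    (h2 : y ≤ 3 / 2 - √(S.data n).κ / 4) :
    S.F n =ᶠ[𝓝 ((y + j) / S.Q n)] fun _ => 0 := by
  have hQ := S.Q_pos' n
  have hκ := Real.sqrt_pos.2 (S.data n).κ_pos
  have key := train_eventuallyEq_zero (χ := fun _ => True) (S.Q_pos n) (S.data n).f_zero
    (S.f_width_lt n) (s := (y + j) / S.Q n + -(1 / (2 * S.Q n))) fun i _ => by
      have e : (y + j) / (S.Q n : ℝ) + -(1 / (2 * S.Q n)) - i / S.Q n =
          (y - 1 / 2 - ((i - j : ℤ) : ℝ)) / S.Q n := by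
        push_cast
        field_simp
        ring
      have hcase : √(S.data n).κ / 8 < |y - 1 / 2 - ((i - j : ℤ) : ℝ)| := by
        rw [lt_abs]
        rcases le_or_gt (i - j) 0 with h | h
        · left
          have : ((i - j : ℤ) : ℝ) ≤ 0 := by exact_mod_cast h
          linarith
        · right
          have : (1 : ℝ) ≤ ((i - j : ℤ) : ℝ) := by exact_mod_cast h
          linarith
      rw [e, abs_div, abs_of_pos hQ, ← div_div]
      exact div_lt_div_of_pos_right hcase hQ
  exact (continuous_id.add continuous_const).continuousAt.eventually key

/-- A point on a drifting orbit: `y` is the phase in the resonance and `V` its speed. -/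
def driftPt (n : ℕ) (ω₁ ω₂ : ℝ) (p : ℤ) (y V b l : ℝ) : Phase :=
  phaseCover ![y / S.Q n, p / S.Q n + V / S.Q n - ω₁, b, l / (2 * (S.data n).m) - ω₂]

theorem sin_two_pi_add_int (y : ℝ) (j : ℤ) :
    Real.sin (2 * Real.pi * (y + j)) = Real.sin (2 * Real.pi * y) := by
  rw [show 2 * Real.pi * (y + j) = 2 * Real.pi * y + j * (2 * Real.pi) by ring,
    Real.sin_add_int_mul_two_pi]

theorem speed_bound (n : ℕ) {V : ℝ} (h0 : 0 ≤ V)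
    (h : V ^ 2 ≤ (S.data n).κ + (1 / (2 * (S.data n).m)) ^ 2) (p : ℤ) :
    |p / S.Q n + V / S.Q n - ω₁ + ω₁ - p / S.Q n| < S.w n / 2 := by
  have hQ := S.Q_pos' n
  have hl := S.log_Q_pos n
  have h1 : V < 1 / (2 * Real.log (S.Q n)) :=
    lt_of_pow_lt_pow_left₀ 2 (by positivity) (h.trans_lt (S.data n).speed)
  rw [show (p : ℝ) / S.Q n + V / S.Q n - ω₁ + ω₁ - p / S.Q n = V / S.Q n by ring,
    abs_of_nonneg (by positivity)]
  calc V / S.Q n < 1 / (2 * Real.log (S.Q n)) / S.Q n := div_lt_div_of_pos_right h1 hQ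
    _ = S.w n / 2 := by rw [w]; field_simp

/-- One step of the map before the kick given by `v`. -/
theorem flow_u_driftPt (hu : IsTimeOneMap (extend (S.u ω₁)) Φu) {n : ℕ} {p : ℤ}
    (hp : S.adm n p) {y y' V V' : ℝ} (b l : ℝ) (j : ℤ) (hy : y' = y + V)
    (hV : V' = V + (S.data n).κ * Real.sin (2 * Real.pi * y'))
    (h0 : 0 ≤ V) (h : V ^ 2 ≤ (S.data n).κ + (1 / (2 * (S.data n).m)) ^ 2)
    (h0' : 0 ≤ V') (h' : V' ^ 2 ≤ (S.data n).κ + (1 / (2 * (S.data n).m)) ^ 2) :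
    Φu (T₀ ω₁ ω₂ (S.driftPt n ω₁ ω₂ p (y + j) V b l)) =
      S.driftPt n ω₁ ω₂ p (y' + ((j + p : ℤ) : ℝ)) V' (b + l / (2 * (S.data n).m)) l := by
  have hQ := (S.Q_pos' n).ne'
  have e1 : (y + j) / (S.Q n : ℝ) + (ω₁ + (p / S.Q n + V / S.Q n - ω₁)) =
      (y' + ((j + p : ℤ) : ℝ)) / S.Q n := by
    rw [hy]; push_cast; field_simp; ring
  have e2 : b + (ω₂ + (l / (2 * (S.data n).m) - ω₂)) = b + l / (2 * (S.data n).m) := by ring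
  rw [driftPt, T₀_phaseCover, e1, e2]
  refine S.flow_u_resonant hu hp _ _ ?_ (S.speed_bound n h0 h p) (S.speed_bound n h0' h' p)
  rw [mul_div_cancel₀ _ hQ, sin_two_pi_add_int, hV]
  ring

/-- A turn restores V and θ₂ mod 1 and raises l by 1, so it can be repeated without end; V is the
same for all starting points. -/
theorem exists_drift (hu : IsTimeOneMap (extend (S.u ω₁)) Φu) (hv : IsTimeOneMap (S.v ω₁) Φv)
    {n : ℕ} {p : ℤ} (hp : S.adm n p) (ω₂ : ℝ) :
    ∃ V, 0 ≤ V ∧ V < 1 ∧ ∀ (j i l : ℤ) (M : ℕ), ∃ j' i' : ℤ,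
      (Φv ∘ Φu ∘ T₀ ω₁ ω₂)^[2 * (S.data n).m * M]
        (S.driftPt n ω₁ ω₂ p (1 / 2 + j) V (i / S.Q n) l) =
      S.driftPt n ω₁ ω₂ p (1 / 2 + j') V (i' / S.Q n) (l + M) := by
  obtain ⟨y, V, y0, y1, hV1, hy, hV, hya, hVa⟩ := exists_standard_orbit (S.data n).κ_pos
    (S.data n).κ_le (S.m_pos n)
  have hQ := S.Q_pos' n
  have hm : (0 : ℝ) < (S.data n).m := by exact_mod_cast S.m_pos n
  have hm1 := S.m_pos n
  set m := (S.data n).m with hmdef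
  set T := Φv ∘ Φu ∘ T₀ ω₁ ω₂ with hT
  -- Before the last step of the turn `S.F n` vanishes along the orbit: r₂ is constant, θ₂ rotates
  -- by l/(2m) per step, and Qθ₁ follows y with an extra p per step.
  have horb : ∀ (j i l : ℤ) (k : ℕ), k < 2 * m →
      T^[k] (S.driftPt n ω₁ ω₂ p (y 0 + j) (V 0) (i / S.Q n) l) =
        S.driftPt n ω₁ ω₂ p (y k + ((j + k * p : ℤ) : ℝ)) (V k) (i / S.Q n + k * (l / (2 * m)))
          l := by
    intro j i l k
    induction k with
    | zero => simp
    | succ k ih =>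
      intro hk
      have hk' : k < 2 * m := by omega
      have e1 : j + k * p + p = j + ((k + 1 : ℕ) : ℤ) * p := by push_cast; ring
      have e2 : (i : ℝ) / S.Q n + k * (l / (2 * m)) + l / (2 * m) =
          i / S.Q n + ((k + 1 : ℕ) : ℝ) * (l / (2 * m)) := by push_cast; ring
      rw [Function.iterate_succ_apply', ih hk', hT, Function.comp_apply, Function.comp_apply,
        S.flow_u_driftPt hu hp _ _ _ (hy k hk') (hV k hk') (hVa k hk'.le).1 (hVa k hk'.le).2
          (hVa _ hk.le).1 (hVa _ hk.le).2, driftPt,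
        S.flow_v_resonant hv hp _ _ (S.speed_bound n (hVa _ hk.le).1 (hVa _ hk.le).2 p)
          (S.F_eventuallyEq_zero n _ (hya _ k.succ_pos hk).1 (hya _ k.succ_pos hk).2),
        zero_mul, add_zero, driftPt, e1, ← hmdef, e2]
  have hloop : ∀ j i l : ℤ, ∃ j' i' : ℤ,
      T^[2 * m] (S.driftPt n ω₁ ω₂ p (1 / 2 + j) (V 0) (i / S.Q n) l) =
        S.driftPt n ω₁ ω₂ p (1 / 2 + j') (V 0) (i' / S.Q n) ((l + 1 : ℤ) : ℝ) := by
    intro j i l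
    obtain ⟨k, hk⟩ : ∃ k, 2 * m = k + 1 := ⟨2 * m - 1, by omega⟩
    have hk' : k < 2 * m := by omega
    -- The 1 comes from y ending at 3/2 = 1/2 + 1; θ₂ has turned by the integer l, so i is
    -- unchanged.
    refine ⟨1 + (j + k * p + p), i, ?_⟩
    have hV' := hVa (k + 1) hk.ge
    have h1 := horb j i l k hk'
    rw [y0] at h1
    have hθ : (y (k + 1) + ((j + k * p + p : ℤ) : ℝ)) / (S.Q n : ℝ) =
        (1 / 2 + ((1 + (j + k * p + p) : ℤ) : ℝ)) / S.Q n := by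
      rw [← hk, y1]; push_cast; ring
    have hb : (i : ℝ) / S.Q n + k * (l / (2 * m)) + l / (2 * m) = i / S.Q n + l := by
      have : (2 * m : ℝ) = k + 1 := by exact_mod_cast hk
      have h2 : ((k : ℝ) + 1) ≠ 0 := by positivity
      rw [this]
      field_simp
      ring
    rw [hk, Function.iterate_succ_apply', h1, hT, Function.comp_apply, Function.comp_apply,
      S.flow_u_driftPt hu hp _ _ _ (hy k hk') (hV k hk') (hVa k hk'.le).1 (hVa k hk'.le).2
        hV'.1 hV'.2, driftPt, hθ, ← hmdef, hb, phaseCover_add_int,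
      S.flow_v_resonant hv hp _ _ (S.speed_bound n hV'.1 hV'.2 p) (S.F_eventuallyEq_one n _),
      driftPt, mul_div_cancel₀ _ hQ.ne', ← hk, hV1, ← hmdef]
    have hcos : Real.cos (2 * Real.pi * i) = 1 := by
      rw [mul_comm]; exact Real.cos_int_mul_two_pi i
    have hs : (l : ℝ) / (2 * m) - ω₂ + 1 * (1 / (2 * m) * 1) = ((l + 1 : ℤ) : ℝ) / (2 * m) - ω₂ := by
      push_cast
      ring
    rw [hcos, hs]
  refine ⟨V 0, (hVa 0 (by omega)).1, ?_, fun j i l M => ?_⟩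
  · have h1 := (hVa 0 (by omega)).2.trans_lt (S.data n).speed
    have h2 : 1 / (2 * Real.log (S.Q n)) ≤ 1 := by
      rw [div_le_one (by linarith [S.log_Q_pos n])]
      linarith [(S.data n).two_lt_log]
    have h3 : 0 ≤ 1 / (2 * Real.log (S.Q n)) := by have := S.log_Q_pos n; positivity
    nlinarith [(hVa 0 (by omega)).1]
  · induction M with
    | zero => exact ⟨j, i, by simp⟩
    | succ M ih =>
      obtain ⟨j', i', h⟩ := ih
      obtain ⟨j'', i'', h'⟩ := hloop j' i' (l + M)
      refine ⟨j'', i'', ?_⟩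
      rw [mul_add, mul_one, add_comm, Function.iterate_add_apply, h]
      push_cast at h' ⊢
      rw [h', add_assoc]

/-- Both vector fields vanish at flat actions, so the map reduces there to the integrable twist. -/
theorem image_torus (hu : IsTimeOneMap (extend (S.u ω₁)) Φu) (hv : IsTimeOneMap (S.v ω₁) Φv)
    {r₁ : ℝ} (hr : r₁ ∈ S.flatSet ω₁) (r₂ : ℝ) :
    (Φv ∘ Φu ∘ T₀ ω₁ ω₂) '' torus r₁ r₂ = torus r₁ r₂ := by
  have key : ∀ a b, (Φv ∘ Φu ∘ T₀ ω₁ ω₂) (phaseCover ![a, r₁, b, r₂]) =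
      phaseCover ![a + (ω₁ + r₁), r₁, b + (ω₂ + r₂), r₂] := by
    intro a b
    rw [Function.comp_apply, Function.comp_apply, T₀_phaseCover,
      S.flow_u_of_mem_flatSet hu (by simpa using hr), S.flow_v_of_mem_flatSet hv (by simpa using hr)]
  have hmem : ∀ z ∈ torus r₁ r₂, ∃ a b, z = phaseCover ![a, r₁, b, r₂] := by
    rintro z ⟨h1, h2⟩
    obtain ⟨x, rfl⟩ := phaseCover_surjective z
    refine ⟨x 0, x 2, ?_⟩
    rw [phaseCover_eq_iff]
    exact ⟨⟨rfl, h1⟩, rfl, h2⟩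
  ext z
  constructor
  · rintro ⟨z, hz, rfl⟩
    obtain ⟨a, b, rfl⟩ := hmem z hz
    rw [key]
    exact ⟨rfl, rfl⟩
  · intro hz
    obtain ⟨a, b, rfl⟩ := hmem z hz
    refine ⟨phaseCover ![a - (ω₁ + r₁), r₁, b - (ω₂ + r₂), r₂], ⟨rfl, rfl⟩, ?_⟩
    rw [key, sub_add_cancel, sub_add_cancel]

end ResonanceSeq

/-! ### Distances in the phase space -/

theorem dist_coe_le (a b : ℝ) : dist (a : UnitAddCircle) (b : UnitAddCircle) ≤ |a - b| := by
  rw [dist_eq_norm, ← AddCircle.coe_sub, UnitAddCircle.norm_eq]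
  simpa using round_le (a - b) 0

theorem dist_withLp_prod_le {A B : Type*} [SeminormedAddCommGroup A] [SeminormedAddCommGroup B]
    (x y : WithLp 2 (A × B)) : dist x y ≤ dist x.fst y.fst + dist x.snd y.snd := by
  rw [WithLp.prod_dist_eq_of_L2]
  refine Real.sqrt_le_iff.2 ⟨by positivity, ?_⟩
  have h1 : 0 ≤ dist x.fst y.fst := dist_nonneg
  have h2 : 0 ≤ dist x.snd y.snd := dist_nonneg
  nlinarith

theorem dist_annulusPt_le (a r a' r' : ℝ) :
    dist (annulusPt (a : UnitAddCircle) r) (annulusPt (a' : UnitAddCircle) r') ≤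
      |a - a'| + |r - r'| :=
  (dist_withLp_prod_le _ _).trans (add_le_add (dist_coe_le a a') (Real.dist_eq r r').le)

theorem dist_phaseCover_le (x y : Fin 4 → ℝ) : dist (phaseCover x) (phaseCover y) ≤
    |x 0 - y 0| + |x 1 - y 1| + (|x 2 - y 2| + |x 3 - y 3|) :=
  (dist_withLp_prod_le _ _).trans
    (add_le_add (dist_annulusPt_le _ _ _ _) (dist_annulusPt_le _ _ _ _))

theorem sub_le_dist_phaseCover (x y : Fin 4 → ℝ) :
    x 3 - y 3 ≤ dist (phaseCover x) (phaseCover y) :=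
  calc x 3 - y 3 ≤ dist (x 3) (y 3) := le_abs_self _
    _ ≤ dist (phaseCover x).snd (phaseCover y).snd :=
      WithLp.dist_snd_le (phaseCover x).snd (phaseCover y).snd
    _ ≤ _ := WithLp.dist_snd_le (phaseCover x) (phaseCover y)

theorem IsDiffusiveStar.mono {M : Type*} [MetricSpace M] {C γ : ℝ} {T : M → M} {X Y : Set M}
    (h : IsDiffusiveStar C γ T Y) (hXY : X ⊆ Y) : IsDiffusiveStar C γ T X := by
  obtain ⟨ν, h1, h2, h3⟩ := h
  exact ⟨ν, h1, h2, fun n z hz => h3 n z (hXY hz)⟩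

namespace ResonanceSeq

variable {α R C ε : ℝ} (S : ResonanceSeq α R C ε) {ω₁ ω₂ : ℝ} {Φu Φv : Phase → Phase}

/-! ### Diffusion -/

theorem abs_div_sub_le {q x y : ℝ} (hq : 0 < q) (h : |q * x - y| ≤ 1 / 2) :
    |y / q - x| ≤ 1 / (2 * q) := by
  rw [show y / q - x = -((q * x - y) / q) by field_simp; ring, abs_neg, abs_div, abs_of_pos hq,
    ← div_div]
  exact div_le_div_of_nonneg_right h hq.le

/-- The starting point is the point nearest to z on the grid of drifting orbits: 1/2 + ℤ for Qθ₁, ℤ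
for Qθ₂, ℤ/(2m) for r₂ + ω₂, with r₁ + ω₁ equal to (p + V)/Q. As V < 1 and Q ≤ m, the four errors
add up to at most 3/Q. -/
theorem isNuDiffusiveStarAt (hu : IsTimeOneMap (extend (S.u ω₁)) Φu)
    (hv : IsTimeOneMap (S.v ω₁) Φv) (n : ℕ) {z : Phase} (hz : z.fst.snd ∈ S.flatSet ω₁) :
    IsNuDiffusiveStarAt C (1 / (α - 1)) (Φv ∘ Φu ∘ T₀ ω₁ ω₂) (4 / S.Q n) z := by
  obtain ⟨x, rfl⟩ := phaseCover_surjective z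
  have hx : x 1 ∈ S.flatSet ω₁ := hz
  obtain ⟨hp, hpx⟩ := S.adm_round ω₁ hx n
  set p := round (S.Q n * (x 1 + ω₁))
  obtain ⟨V, hV0, hV1, hdrift⟩ := S.exists_drift hu hv hp ω₂
  have hQ := S.Q_pos' n
  have hm : (0 : ℝ) < (S.data n).m := by exact_mod_cast S.m_pos n
  have hQm : (S.Q n : ℝ) ≤ (S.data n).m := by exact_mod_cast (S.data n).Q_le_m
  have htime := (S.data n).time
  set m := (S.data n).m with hmdef
  set D := Estar C (1 / (α - 1)) (2 * (4 / S.Q n)) with hD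
  have hDpos : 0 < D := Real.exp_pos _
  set j := round (S.Q n * x 0 - 1 / 2) with hj
  set i := round (S.Q n * x 2) with hi
  set l := round (2 * m * (x 3 + ω₂)) with hl
  -- M turns raise r₂ by at least D + 1; the 1 makes up for the initial offset in r₂, at most
  -- 1/(2Q).
  set M := ⌈2 * m * (D + 1)⌉₊ with hM
  have hMpos : 0 < M := Nat.ceil_pos.2 (by positivity)
  obtain ⟨j', i', horb⟩ := hdrift j i l M
  have h0 : |(1 / 2 + j) / S.Q n - x 0| ≤ 1 / (2 * S.Q n) := by
    refine abs_div_sub_le hQ ?_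
    have := abs_sub_round (S.Q n * x 0 - 1 / 2)
    rwa [← hj, sub_sub] at this
  have h1 : |(p / S.Q n + V / S.Q n - ω₁) - x 1| ≤ 1 / (2 * S.Q n) + 1 / S.Q n := by
    have e : (p / S.Q n + V / S.Q n - ω₁) - x 1 = -(x 1 + ω₁ - p / S.Q n) + V / S.Q n := by ring
    rw [e]
    refine (abs_add_le _ _).trans (add_le_add (by rwa [abs_neg]) ?_)
    rw [abs_of_nonneg (by positivity)]
    exact div_le_div_of_nonneg_right hV1.le hQ.le
  have h2 : |(i : ℝ) / S.Q n - x 2| ≤ 1 / (2 * S.Q n) := abs_div_sub_le hQ (abs_sub_round _)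
  have h3 : |(l / (2 * m) - ω₂) - x 3| ≤ 1 / (2 * S.Q n) := by
    have := abs_div_sub_le (by positivity) (abs_sub_round (2 * m * (x 3 + ω₂)))
    rw [← hl] at this
    rw [sub_sub, add_comm ω₂]
    exact this.trans (one_div_le_one_div_of_le (by positivity) (by linarith))
  have hM1 : 2 * m * (D + 1) ≤ M := Nat.le_ceil _
  have hM2 : (M : ℝ) ≤ 2 * m * (D + 1) + 1 := (Nat.ceil_lt_add_one (by positivity)).le
  have hm1 : (1 : ℝ) ≤ m := by exact_mod_cast S.m_pos n
  refine ⟨S.driftPt n ω₁ ω₂ p (1 / 2 + j) V (i / S.Q n) l, 2 * m * M,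
    by have := S.m_pos n; positivity, ?_, ?_, ?_⟩
  · refine (dist_phaseCover_le _ _).trans ?_
    simp only [Matrix.cons_val]
    have e : 1 / (2 * (S.Q n : ℝ)) = 1 / 2 * (1 / S.Q n) := by field_simp
    have e' : 4 / (S.Q n : ℝ) = 4 * (1 / S.Q n) := by ring
    have hpos : 0 < 1 / (S.Q n : ℝ) := by positivity
    rw [e] at h0 h1 h2 h3
    rw [e']
    linarith
  · refine le_trans ?_ htime
    push_cast
    have : 2 * (m : ℝ) * M ≤ 2 * m * (2 * m * (D + 2)) :=
      mul_le_mul_of_nonneg_left (by nlinarith) (by positivity)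
    linarith
  · rw [horb]
    refine le_trans ?_ (sub_le_dist_phaseCover _ _)
    simp only [Matrix.cons_val, ← hmdef]
    have h4 : 1 / (2 * (S.Q n : ℝ)) ≤ 1 := by
      rw [div_le_one (by positivity)]
      have : (1 : ℝ) ≤ S.Q n := by exact_mod_cast S.Q_pos n
      linarith
    have h5 : D + 1 ≤ M / (2 * m) := by
      rw [le_div_iff₀ (by positivity)]
      linarith
    have h6 := neg_le_of_abs_le h3
    rw [add_div]
    linarith

theorem tendsto_nu : Filter.Tendsto (fun n => 4 / (S.Q n : ℝ)) Filter.atTop (𝓝 0) := by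
  refine Filter.Tendsto.const_div_atTop ?_ 4
  exact Filter.tendsto_atTop_mono (fun n => by exact_mod_cast S.le_Q n)
    tendsto_natCast_atTop_atTop

theorem isDiffusiveStar (hu : IsTimeOneMap (extend (S.u ω₁)) Φu)
    (hv : IsTimeOneMap (S.v ω₁) Φv) :
    IsDiffusiveStar C (1 / (α - 1)) (Φv ∘ Φu ∘ T₀ ω₁ ω₂)
      {z : Phase | z.fst.snd ∈ S.flatSet ω₁} := by
  refine ⟨fun n => 4 / S.Q n, fun n => ⟨by have := S.Q_pos' n; positivity, ?_⟩, S.tendsto_nu,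
    fun n z hz => S.isNuDiffusiveStarAt hu hv n hz⟩
  have : (16 : ℝ) ≤ S.Q n := by exact_mod_cast (S.data n).le_Q
  rw [div_lt_div_iff₀ (by linarith) (by norm_num)]
  linarith

/-! ### The set of flat actions -/

theorem isClosed_flatSet (ω₁ : ℝ) : IsClosed (S.flatSet ω₁) := by
  simp only [flatSet, Set.ofPred_forall]
  exact isClosed_iInter fun m => isClosed_iInter fun j =>
    isClosed_le continuous_const (by fun_prop)

theorem add_int_mem_flatSet {r : ℝ} (hr : r ∈ S.flatSet ω₁) (k : ℤ) : r + k ∈ S.flatSet ω₁ := by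
  intro m j
  have hQ := (S.Q_pos' m).ne'
  have e : r + k + ω₁ - j / S.Q m = r + ω₁ - ((j - k * S.Q m : ℤ) : ℝ) / S.Q m := by
    push_cast
    field_simp
    ring
  rw [e]
  exact hr m _

/-- Since 2w < 1/Q, only Q + 2 resonances of order Q can reach [0,1]. -/
theorem resonant_zone_subset (n : ℕ) (ω₁ : ℝ) {r : ℝ} (h0 : 0 ≤ r) (h1 : r ≤ 1) {j : ℤ}
    (h : |r + ω₁ - j / S.Q n| < 2 * S.w n) :
    j ∈ Finset.Icc ⌊S.Q n * ω₁⌋ (⌊S.Q n * ω₁⌋ + S.Q n + 1) := by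
  have hQ := S.Q_pos' n
  have h2 : |S.Q n * (r + ω₁) - j| < 1 := by
    rw [abs_mul_sub_eq (S.Q_pos n)]
    have h3 : |r + ω₁ - j / S.Q n| < 1 / S.Q n := by
      linarith [S.w_lt n, S.half_inv_Q n]
    rwa [lt_div_iff₀ hQ, mul_comm] at h3
  rw [abs_lt] at h2
  have h3 := Int.floor_le (S.Q n * ω₁)
  have h4 := Int.lt_floor_add_one (S.Q n * ω₁)
  have h5 : 0 ≤ S.Q n * r := by positivity
  have h6 : S.Q n * r ≤ S.Q n := mul_le_of_le_one_right hQ.le h1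
  rw [Finset.mem_Icc]
  constructor
  · have : ((⌊S.Q n * ω₁⌋ : ℤ) : ℝ) < ((j + 1 : ℤ) : ℝ) := by push_cast; linarith
    exact Int.lt_add_one_iff.1 (by exact_mod_cast this)
  · have : ((j : ℤ) : ℝ) < ((⌊S.Q n * ω₁⌋ + S.Q n + 1 + 1 : ℤ) : ℝ) := by push_cast; linarith
    exact Int.lt_add_one_iff.1 (by exact_mod_cast this)

/-- Q + 2 ≤ 2Q intervals of length 4/(Q log Q) have total length at most 8/log Q: the logarithm in
the width is what makes this small. -/
theorem volume_resonant_zone_le (n : ℕ) (ω₁ : ℝ) :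
    MeasureTheory.volume (⋃ j ∈ Finset.Icc ⌊S.Q n * ω₁⌋ (⌊S.Q n * ω₁⌋ + S.Q n + 1),
      Metric.closedBall ((j : ℝ) / S.Q n - ω₁) (2 * S.w n)) ≤ ENNReal.ofReal (ε / 2 / 2 ^ n) := by
  refine (MeasureTheory.measure_biUnion_finset_le _ _).trans ?_
  simp only [Real.volume_closedBall, Finset.sum_const, Int.card_Icc, nsmul_eq_mul]
  have e : (⌊S.Q n * ω₁⌋ + S.Q n + 1 + 1 - ⌊S.Q n * ω₁⌋).toNat = S.Q n + 2 := by omega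
  have hQ := S.Q_pos' n
  have hlog := S.log_Q_pos n
  have hε := S.ε_pos
  rw [e, ← ENNReal.ofReal_natCast, ← ENNReal.ofReal_mul (by positivity)]
  refine ENNReal.ofReal_le_ofReal ?_
  have h16 : (16 : ℝ) ≤ S.Q n := by exact_mod_cast (S.data n).le_Q
  have h1 := S.le_log n
  rw [div_le_iff₀ hε] at h1
  rw [w, div_div, ← pow_succ', le_div_iff₀ (by positivity)]
  push_cast
  have h2 : ((S.Q n : ℝ) + 2) * (2 * (2 * (1 / (S.Q n * Real.log (S.Q n))))) * 2 ^ (n + 1) =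
      4 * ((S.Q n : ℝ) + 2) * 2 ^ (n + 1) / (S.Q n * Real.log (S.Q n)) := by ring
  rw [h2, div_le_iff₀ (by positivity)]
  have h3 : (0 : ℝ) < 2 ^ (n + 1) := by positivity
  calc 4 * ((S.Q n : ℝ) + 2) * 2 ^ (n + 1) ≤ 4 * (2 * S.Q n) * 2 ^ (n + 1) := by
        gcongr; linarith
    _ = S.Q n * (8 * 2 ^ (n + 1)) := by ring
    _ ≤ S.Q n * (Real.log (S.Q n) * ε) := by gcongr
    _ = ε * (S.Q n * Real.log (S.Q n)) := by ring

theorem le_volume_flatSet (ω₁ : ℝ) :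
    ENNReal.ofReal (1 - ε) ≤ MeasureTheory.volume (Set.Icc 0 1 ∩ S.flatSet ω₁) := by
  set Z := ⋃ n, ⋃ j ∈ Finset.Icc ⌊S.Q n * ω₁⌋ (⌊S.Q n * ω₁⌋ + S.Q n + 1),
      Metric.closedBall ((j : ℝ) / S.Q n - ω₁) (2 * S.w n) with hZ
  have hsum := hasSum_geometric_two' ε
  have hvol : MeasureTheory.volume Z ≤ ENNReal.ofReal ε := by
    refine (MeasureTheory.measure_iUnion_le _).trans ?_
    refine (ENNReal.tsum_le_tsum fun n => S.volume_resonant_zone_le n ω₁).trans ?_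
    have hε := S.ε_pos
    rw [← ENNReal.ofReal_tsum_of_nonneg (fun n => by positivity) hsum.summable, hsum.tsum_eq]
  have hsub : Set.Icc (0 : ℝ) 1 \ Z ⊆ Set.Icc 0 1 ∩ S.flatSet ω₁ := by
    rintro r ⟨hr, hrZ⟩
    refine ⟨hr, fun n j => ?_⟩
    by_contra! h
    refine hrZ (Set.mem_iUnion.2 ⟨n, Set.mem_iUnion₂.2
      ⟨j, S.resonant_zone_subset n ω₁ hr.1 hr.2 h, ?_⟩⟩)
    rw [Metric.mem_closedBall, Real.dist_eq, show r - ((j : ℝ) / S.Q n - ω₁) =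
      r + ω₁ - j / S.Q n by ring]
    exact h.le
  calc ENNReal.ofReal (1 - ε) = 1 - ENNReal.ofReal ε := by
        rw [ENNReal.ofReal_sub _ S.ε_pos.le, ENNReal.ofReal_one]
    _ ≤ MeasureTheory.volume (Set.Icc (0 : ℝ) 1) - MeasureTheory.volume Z := by
        rw [Real.volume_Icc, sub_zero, ENNReal.ofReal_one]
        exact tsub_le_tsub_left hvol 1
    _ ≤ MeasureTheory.volume (Set.Icc (0 : ℝ) 1 \ Z) := MeasureTheory.le_measure_sdiff
    _ ≤ _ := MeasureTheory.measure_mono hsub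

theorem addInt_subset_flatSet (ω₁ : ℝ) :
    addInt (Set.Icc 0 1 ∩ S.flatSet ω₁) ⊆ S.flatSet ω₁ := by
  rintro _ ⟨x, hx, k, rfl⟩
  exact S.add_int_mem_flatSet hx.2 k

/-! ### Periodicity and flatness of u and v -/

theorem u_periodic (ω₁ : ℝ) (θ : UnitAddCircle) (r : ℝ) :
    S.u ω₁ (annulusPt θ (r + 1)) = S.u ω₁ (annulusPt θ r) := by
  refine tsum_congr fun n => ?_
  have h : S.B ω₁ n (annulusPt θ (r + 1)).snd = S.B ω₁ n (annulusPt θ r).snd :=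
    S.b_train_periodic ω₁ n r
  rw [h]
  rfl

theorem v_periodic (ω₁ : ℝ) (θ : UnitAddCircle) (r : ℝ) (z : Annulus) :
    S.v ω₁ (phasePt (annulusPt θ (r + 1)) z) = S.v ω₁ (phasePt (annulusPt θ r) z) := by
  refine tsum_congr fun n => ?_
  have h : S.B ω₁ n (phasePt (annulusPt θ (r + 1)) z).fst.snd =
      S.B ω₁ n (phasePt (annulusPt θ r) z).fst.snd := S.b_train_periodic ω₁ n r
  rw [h]
  rfl

theorem isFlatOn_u (ω₁ : ℝ) : IsFlatOn (S.u ω₁ ∘ annulusCover) {x | x 1 ∈ S.flatSet ω₁} := by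
  intro x hx ℓ
  rw [S.u_comp_cover, multiDeriv_tensorSum (S.hu_bound ω₁) S.summable_Au]
  exact S.tensorSum_eq_zero_of_mem_flatSet ω₁ (i := 1) (fun _ => rfl) hx ℓ

theorem isFlatOn_v (ω₁ : ℝ) : IsFlatOn (S.v ω₁ ∘ phaseCover) {x | x 1 ∈ S.flatSet ω₁} := by
  intro x hx ℓ
  rw [S.v_comp_cover, multiDeriv_tensorSum (S.hv_bound ω₁) S.summable_Av]
  exact S.tensorSum_eq_zero_of_mem_flatSet ω₁ (i := 1) (fun _ => rfl) hx ℓ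

end ResonanceSeq

/-! ### Gevrey norms of u and v -/

section

variable {α L C ε : ℝ} (S : ResonanceSeq α (1 / (2 * L ^ α)) C ε) (ω₁ : ℝ)

theorem ResonanceSeq.gevreyNorm_u_le (hL : 0 < L) :
    gevreyNorm α L (S.u ω₁ ∘ annulusCover) ≤ ENNReal.ofReal (ε / 8) := by
  rw [S.u_comp_cover]
  refine (gevreyNorm_tensorSum_le hL (S.hu_bound ω₁) S.summable_Au).trans ?_
  rw [show (2 : ℝ≥0∞) ^ 2 = ENNReal.ofReal 4 by norm_num, ← ENNReal.ofReal_mul (by norm_num)]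
  exact ENNReal.ofReal_le_ofReal (by linarith [S.tsum_Au_le])

theorem ResonanceSeq.gevreyNorm_v_le (hL : 0 < L) :
    gevreyNorm α L (S.v ω₁ ∘ phaseCover) ≤ ENNReal.ofReal (ε / 2) := by
  rw [S.v_comp_cover]
  refine (gevreyNorm_tensorSum_le hL (S.hv_bound ω₁) S.summable_Av).trans ?_
  rw [show (2 : ℝ≥0∞) ^ 4 = ENNReal.ofReal 16 by norm_num, ← ENNReal.ofReal_mul (by norm_num)]
  exact ENNReal.ofReal_le_ofReal (by linarith [S.tsum_Av_le])

theorem ResonanceSeq.isGevrey_u (hL : 0 < L) : IsGevrey α L (S.u ω₁ ∘ annulusCover) := by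
  refine ⟨?_, (S.gevreyNorm_u_le ω₁ hL).trans_lt ENNReal.ofReal_lt_top⟩
  rw [S.u_comp_cover]
  exact contDiff_tensorSum (S.hu_bound ω₁) S.summable_Au 0

theorem ResonanceSeq.isGevrey_v (hL : 0 < L) : IsGevrey α L (S.v ω₁ ∘ phaseCover) := by
  refine ⟨?_, (S.gevreyNorm_v_le ω₁ hL).trans_lt ENNReal.ofReal_lt_top⟩
  rw [S.v_comp_cover]
  exact contDiff_tensorSum (S.hv_bound ω₁) S.summable_Av 0

theorem ResonanceSeq.gevreyNorm_add_lt (hL : 0 < L) :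
    gevreyNorm α L (S.u ω₁ ∘ annulusCover) + gevreyNorm α L (S.v ω₁ ∘ phaseCover) <
      ENNReal.ofReal ε := by
  have hε := S.ε_pos
  refine (add_le_add (S.gevreyNorm_u_le ω₁ hL) (S.gevreyNorm_v_le ω₁ hL)).trans_lt ?_
  rw [← ENNReal.ofReal_add (by positivity) (by positivity), ENNReal.ofReal_lt_ofReal_iff hε]
  linarith

end

end ManyTori

end

open ManyTori in
theorem mainTheorem4 (α L : ℝ) (hα : 1 < α) (hL : 0 < L) :
    ∃ C : ℝ, 0 < C ∧ ∀ ω₁ ω₂ ε : ℝ, 0 < ε →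
      ∃ (u : Annulus → ℝ) (v : Phase → ℝ) (X : Set ℝ),
        -- `u ∈ G^{α,L}(M₁)` and `v ∈ G^{α,L}(M₁ × M₂)`
        IsGevrey α L (u ∘ annulusCover) ∧ IsGevrey α L (v ∘ phaseCover) ∧
        -- `u` and `v` are `1`-periodic in `r₁`
        (∀ θ₁ r₁, u (annulusPt θ₁ (r₁ + 1)) = u (annulusPt θ₁ r₁)) ∧
        (∀ θ₁ r₁ z₂, v (phasePt (annulusPt θ₁ (r₁ + 1)) z₂) =
          v (phasePt (annulusPt θ₁ r₁) z₂)) ∧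
        -- the set `X`
        IsClosed X ∧ X ⊆ Set.Icc 0 1 ∧
        ENNReal.ofReal (1 - ε) ≤ MeasureTheory.volume X ∧
        -- (1) flatness for `r₁ ∈ X + ℤ`
        IsFlatOn (u ∘ annulusCover) {x | x 1 ∈ addInt X} ∧
        IsFlatOn (v ∘ phaseCover) {x | x 1 ∈ addInt X} ∧
        -- (2) smallness
        gevreyNorm α L (u ∘ annulusCover) + gevreyNorm α L (v ∘ phaseCover) < ENNReal.ofReal ε ∧
        -- (3) the flows of `u` and `v` are complete and, for `T = Φ^v ∘ Φ^u ∘ T₀`, the tori are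
        -- invariant and diffusive-`*`, and so is their union
        ∃ Φu Φv : Phase → Phase, IsTimeOneMap (extend u) Φu ∧ IsTimeOneMap v Φv ∧
          (∀ r₁ ∈ addInt X, ∀ r₂ : ℝ,
            (Φv ∘ Φu ∘ T₀ ω₁ ω₂) '' torus r₁ r₂ = torus r₁ r₂ ∧
            IsDiffusiveStar C (1 / (α - 1)) (Φv ∘ Φu ∘ T₀ ω₁ ω₂) (torus r₁ r₂)) ∧
          IsDiffusiveStar C (1 / (α - 1)) (Φv ∘ Φu ∘ T₀ ω₁ ω₂)
            {z : Phase | z.fst.snd ∈ addInt X} := by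
  -- C comes from α and the rate R alone, before ω and ε are given.
  obtain ⟨C, hC, hseq⟩ := exists_resonanceSeq (R := 1 / (2 * L ^ α)) hα (by positivity)
  refine ⟨C, hC, fun ω₁ ω₂ ε hε => ?_⟩
  obtain ⟨S⟩ := hseq ε hε
  obtain ⟨Φu, hu⟩ := S.exists_isTimeOneMap_u ω₁
  obtain ⟨Φv, hv⟩ := S.exists_isTimeOneMap_v ω₁
  have hX := S.addInt_subset_flatSet ω₁
  have hdiff := (S.isDiffusiveStar (ω₂ := ω₂) hu hv).mono
    fun z (hz : z.fst.snd ∈ addInt (Set.Icc 0 1 ∩ S.flatSet ω₁)) => hX hz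
  refine ⟨S.u ω₁, S.v ω₁, Set.Icc 0 1 ∩ S.flatSet ω₁, S.isGevrey_u ω₁ hL, S.isGevrey_v ω₁ hL,
    S.u_periodic ω₁, S.v_periodic ω₁, isClosed_Icc.inter (S.isClosed_flatSet ω₁),
    Set.inter_subset_left, S.le_volume_flatSet ω₁, fun x hx => S.isFlatOn_u ω₁ x (hX hx),
    fun x hx => S.isFlatOn_v ω₁ x (hX hx), S.gevreyNorm_add_lt ω₁ hL, Φu, Φv, hu, hv,
    fun r₁ hr₁ r₂ => ⟨S.image_torus hu hv (hX hr₁) r₂, hdiff.mono ?_⟩, hdiff⟩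
  rintro z ⟨rfl, -⟩
  exact hr₁
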